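/- **Setting.** Let $a,b,c>0$ with $b^2=27ac$, let $\mathcal Q$ be the space of symmetric traceless real $3\times3$ matrices with the Frobenius norm, and set $$F(q)=\tfrac a2\operatorname{tr}q^2-\tfrac b3\operatorname{tr}q^3+\tfrac c4(\operatorname{tr}q^2)^2,\quad F_\varepsilon=F+\varepsilon^3,\quad f(s)=\tfrac{s^2}{27}(9a-2bs+3cs^2),$$ $$s_+=\frac{b+\sqrt{b^2-24ac}}{4c},\quad \sigma=\tfrac{2}{\sqrt3}\int_0^{s_+}\!\sqrt{f(\tau)}\,d\tau,\quad \mathcal N=\{s_+(e\otimes e-\tfrac13I_3): e\in\mathbb S^2\}.$$ Let $d^F(q)=\inf\int_0^1\sqrt{2F(\gamma)}\,|\gamma'|\,dt$ over Lipschitz curves $\gamma:[0,1]\to\mathcal Q$ with $\gamma(0)\in\mathcal N$, $\gamma(1)=q$. For a smooth nonnegative $\eta:\mathcal Q\to\mathbb R$ with integral $1$, supported in the open unit ball and isotropic ($\eta(M^\top qM)=\eta(q)$ for $M\in O(3)$), let $d^F_\varepsilon=\eta_\varepsilon*d^F$ with $\eta_\varepsilon(q)=\varepsilon^{-20}\eta(\varepsilon^{-4}q)$.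 Let $\Omega\subset\mathbb R^3$ be a smooth bounded domain, $\Omega^+$ a smooth simply connected domain with $\overline{\Omega^+}\subset\Omega$, $\Gamma_0=\partial\Omega^+$, $\Omega^-=\Omega\setminus\overline{\Omega^+}$. Let $d_\Gamma$ be the signed distance to $\Gamma_0$, positive in $\Omega^+$ and negative in $\Omega^-$, and $\Gamma_0(r)=\{y\in\Omega:\operatorname{dist}(y,\Gamma_0)<r\}$. Let $\delta>0$ be such that $\operatorname{dist}(\Gamma_0,\partial\Omega)\ge3\delta$ and $d_\Gamma$ is smooth in $\Gamma_0(3\delta)$. Let $\phi:\mathbb R\to[0,\infty)$ be smooth, even, nonincreasing on $[0,1]$, positive for $|x|<1$, zero for $|x|\ge1$, with $1-4x^2\le\phi(x)\le1-\frac12x^2$ for $|x|\le\frac12$, and let $\boldsymbol\xi=-\phi(d_\Gamma/\delta)\nabla d_\Gamma$, so that on $\Gamma_0$ it is the unit normal pointing into $\Omega^-$. Let $\vartheta(r)=-r$ for $|r|\le\delta$, $\vartheta(r)=-\delta$ for $r\ge\delta$, $\vartheta(r)=\delta$ for $r\le-\delta$. For $Q:\Omega\to\mathcal Q$ put $\psi_\varepsilon=d^F_\varepsilon\circ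 Q$ and $$E[v_\varepsilon,Q\,|\,v]=\int_\Omega\tfrac12|v_\varepsilon-v|^2dx+\int_\Omega\Big(\tfrac\varepsilon2|\nabla Q|^2+\tfrac1\varepsilon F_\varepsilon(Q)-\boldsymbol\xi\cdot\nabla\psi_\varepsilon\Big)dx,\qquad E_{\rm vol}[Q]=\int_\Omega(\sigma\chi_{\Omega^-}-\psi_\varepsilon)\,\vartheta(d_\Gamma)\,dx .$$ Let $\tilde\zeta:\mathbb R\to[0,1]$ be smooth with $\tilde\zeta=1$ on $|s|\le\frac12$ and $\tilde\zeta=0$ on $|s|\ge1$, let $S(z)=\frac{s_+}2\big(1+\tanh(\frac{\sqrt a}2z)\big)$ and $$\tilde S_\varepsilon=\tilde\zeta\big(\tfrac{d_\Gamma}\delta\big)S\big(\tfrac{d_\Gamma}\varepsilon\big)+\Big(1-\tilde\zeta\big(\tfrac{d_\Gamma}\delta\big)\Big)s_+\chi_{\Omega^+}.$$ **Proposition.** For $u_0\in H^1(\Omega;\mathbb S^2)$ and $0<\varepsilon\le1$ let $Q_{0,\varepsilon}=\tilde S_\varepsilon\,(u_0\otimes u_0-\frac13I_3)$. Then $Q_{0,\varepsilon}\in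 H^1(\Omega;\mathcal Q)\cap L^\infty(\Omega;\mathcal Q)$ and $$Q_{0,\varepsilon}=\begin{cases}s_+(u_0\otimes u_0-\frac13I_3)&\text{in }\Omega^+\setminus\Gamma_0(\delta),\\ S(d_\Gamma/\varepsilon)(u_0\otimes u_0-\frac13I_3)&\text{in }\Gamma_0(\delta/2),\\ 0&\text{in }\Omega^-\setminus\Gamma_0(\delta).\end{cases}$$ Moreover $\psi_\varepsilon=d^F_\varepsilon\circ Q_{0,\varepsilon}\in H^1(\Omega)$, the integrands depending on $Q_{0,\varepsilon}$ in $E$ and $E_{\rm vol}$ are integrable, and for every $M$ there is $C_0>0$, depending only on $M$ and on the fixed data $a,b,c,\Omega,\Omega^+,\delta,\phi,\tilde\zeta$ (not on $\varepsilon$, $\eta$, or on $u_0$ otherwise), such that whenever $\|u_0\|_{H^1(\Omega)}\le M$, $0<\varepsilon\le 1$, and the initial velocities $v_{0,\varepsilon},v_0\in L^2(\Omega;\mathbb R^3)$ satisfy $\frac12\int_\Omega|v_{0,\varepsilon}-v_0|^2dx\le K\varepsilon$ for some $K$, $$E[v_{0,\varepsilon},Q_{0,\varepsilon}\,|\,v_0]+E_{\rm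 vol}[Q_{0,\varepsilon}]\le (C_0+K)\,\varepsilon ;$$ in particular the left side is at most $C_0\varepsilon$ if $v_{0,\varepsilon}=v_0$. -/

import Mathlib

open MeasureTheory Set Metric
open scoped ContDiff

noncomputable section

namespace BerisEdwards

abbrev Vec3 := EuclideanSpace ℝ (Fin 3)

/-- The unit sphere of three-dimensional space. -/
abbrev S2 := Metric.sphere (0 : Vec3) 1

/-! ### Symmetric traceless matrices -/

/-- Symmetric traceless real `3 × 3` matrices, as a subspace of the matrices with the Frobenius
inner product. -/
def symTraceless : Submodule ℝ (EuclideanSpace ℝ (Fin 3 × Fin 3)) where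
  carrier := {q | (∀ i j, q (i, j) = q (j, i)) ∧ ∑ i, q (i, i) = 0}
  add_mem' := by
    rintro p q ⟨hp, hp'⟩ ⟨hq, hq'⟩
    refine ⟨fun i j => ?_, ?_⟩
    · simp [hp i j, hq i j]
    · simp [Finset.sum_add_distrib, hp', hq']
  zero_mem' := by simp
  smul_mem' := by
    rintro c q ⟨hq, hq'⟩
    refine ⟨fun i j => ?_, ?_⟩
    · simp [hq i j]
    · simp [← Finset.mul_sum, hq']

/-- The five-dimensional space of Q-tensors. -/
abbrev QTensor := ↥symTraceless

/-- A Q-tensor as a matrix. -/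
def QTensor.mat (q : QTensor) : Matrix (Fin 3) (Fin 3) ℝ := Matrix.of fun i j => q.1 (i, j)

/-- Lebesgue measure on the Euclidean space of Q-tensors. -/
def qMeasure : Measure QTensor := (stdOrthonormalBasis ℝ QTensor).toBasis.addHaar

/-- The uniaxial tensor `e ⊗ e - I / 3`. -/
def director (e : S2) : QTensor :=
  ⟨WithLp.toLp 2 fun ij => e.1 ij.1 * e.1 ij.2 - if ij.1 = ij.2 then 1 / 3 else 0, by
    refine ⟨fun i j => ?_, ?_⟩
    · simp [mul_comm, eq_comm]
    · have h : ‖e.1‖ = 1 := by simp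
      have h2 := EuclideanSpace.real_norm_sq_eq e.1
      rw [h] at h2
      simp only [Fin.sum_univ_three] at h2 ⊢
      norm_num
      linarith⟩

/-! ### Bulk energy -/

/-- The bulk energy density `F`. -/
def bulkEnergy (a b c : ℝ) (q : QTensor) : ℝ :=
  a / 2 * (q.mat ^ 2).trace - b / 3 * (q.mat ^ 3).trace + c / 4 * ((q.mat ^ 2).trace) ^ 2

/-- The regularized bulk energy density `F_ε = F + ε ^ 3`. -/
def bulkEnergyReg (a b c ε : ℝ) (q : QTensor) : ℝ := bulkEnergy a b c q + ε ^ 3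

/-- The bulk energy `f (s)` of a uniaxial tensor of order `s`. -/
def uniaxialEnergy (a b c s : ℝ) : ℝ := s ^ 2 / 27 * (9 * a - 2 * b * s + 3 * c * s ^ 2)

/-- The equilibrium order parameter `s_+`. -/
def sPlus (a b c : ℝ) : ℝ := (b + √(b ^ 2 - 24 * a * c)) / (4 * c)

/-- The surface tension `σ`. -/
def surfaceTension (a b c : ℝ) : ℝ :=
  2 / √3 * ∫ τ in (0 : ℝ)..sPlus a b c, √(uniaxialEnergy a b c τ)

/-- The manifold of nematic minimizers of the bulk energy. -/
def nematic (a b c : ℝ) : Set QTensor := {q | ∃ e : S2, q = sPlus a b c • director e}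

/-- The quasi-distance `d^F` to the nematic manifold. -/
def quasiDist (a b c : ℝ) (q : QTensor) : ℝ :=
  sInf {L | ∃ γ : ℝ → QTensor, (∃ K, LipschitzOnWith K γ (Icc 0 1)) ∧
    γ 0 ∈ nematic a b c ∧ γ 1 = q ∧
    L = ∫ t in (0 : ℝ)..1, √(2 * bulkEnergy a b c (γ t)) * ‖deriv γ t‖}

/-- Smooth, nonnegative, isotropic mollifiers of unit mass, supported in the unit ball. -/
structure IsIsotropicMollifier (η : QTensor → ℝ) : Prop where
  smooth : ContDiff ℝ ∞ η
  nonneg : ∀ q, 0 ≤ η q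
  support : tsupport η ⊆ ball 0 1
  mass : ∫ q, η q ∂qMeasure = 1
  isotropic : ∀ M ∈ Matrix.orthogonalGroup (Fin 3) ℝ, ∀ p q : QTensor,
    q.mat = M.transpose * p.mat * M → η q = η p

/-- The mollified quasi-distance `d^F_ε = η_ε * d^F` with `η_ε (q) = ε ^ (-20) η (ε ^ (-4) q)`. -/
def quasiDistReg (a b c : ℝ) (η : QTensor → ℝ) (ε : ℝ) : QTensor → ℝ :=
  convolution (fun q => (ε ^ 20)⁻¹ * η ((ε ^ 4)⁻¹ • q)) (quasiDist a b c)
    (ContinuousLinearMap.mul ℝ ℝ) qMeasure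

/-! ### Weak derivatives and the space `H¹` -/

section Sobolev

variable {E : Type*} [NormedAddCommGroup E] [NormedSpace ℝ E]

/-- `G k` is the weak `k`-th partial derivative of `w` in the open set `Ω`, for all `k`. -/
structure IsWeakGradient (Ω : Set Vec3) (w : Vec3 → E) (G : Fin 3 → Vec3 → E) : Prop where
  locInt : LocallyIntegrableOn w Ω
  locInt_grad : ∀ k, LocallyIntegrableOn (G k) Ω
  byParts : ∀ k, ∀ φ : Vec3 → ℝ, ContDiff ℝ ∞ φ → HasCompactSupport φ → tsupport φ ⊆ Ω →
    ∫ x in Ω, fderiv ℝ φ x (EuclideanSpace.single k 1) • w x = -∫ x in Ω, φ x • G k x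

open Classical in
/-- The weak gradient (unique almost everywhere in `Ω`), and zero if there is none. -/
def weakGrad (Ω : Set Vec3) (w : Vec3 → E) : Fin 3 → Vec3 → E :=
  if h : ∃ G, IsWeakGradient Ω w G then h.choose else 0

/-- Membership in `H¹(Ω; E)`. -/
def MemH1 (Ω : Set Vec3) (w : Vec3 → E) : Prop :=
  MemLp w 2 (volume.restrict Ω) ∧
    ∃ G, IsWeakGradient Ω w G ∧ ∀ k, MemLp (G k) 2 (volume.restrict Ω)

/-- The `H¹(Ω; E)` norm. -/
def h1Norm (Ω : Set Vec3) (w : Vec3 → E) : ℝ :=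
  √((∫ x in Ω, ‖w x‖ ^ 2) + ∫ x in Ω, ∑ k, ‖weakGrad Ω w k x‖ ^ 2)

end Sobolev

/-! ### The initial interface -/

/-- `U` has smooth boundary and lies locally on one side of it. -/
def HasSmoothBoundary (U : Set Vec3) : Prop :=
  ∀ p ∈ frontier U, ∃ (V : Set Vec3) (ρ : Vec3 → ℝ), IsOpen V ∧ p ∈ V ∧ ContDiffOn ℝ ∞ ρ V ∧
    fderiv ℝ ρ p ≠ 0 ∧ U ∩ V = {x ∈ V | 0 < ρ x}

/-- The outer phase `Ω⁻`. -/
def outerPhase (Ω Ωp : Set Vec3) : Set Vec3 := Ω \ closure Ωp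

open Classical in
/-- The signed distance `d_Γ`, positive in `Ω⁺` and negative in `Ω⁻`. -/
def sdist (Ω Ωp : Set Vec3) (x : Vec3) : ℝ :=
  if x ∈ outerPhase Ω Ωp then -infDist x Ωp else infDist x (outerPhase Ω Ωp)

/-- The tube of radius `r` about the interface `Γ₀ = ∂Ω⁺`. -/
def tube (Ω Ωp : Set Vec3) (r : ℝ) : Set Vec3 := {y ∈ Ω | infDist y (frontier Ωp) < r}

/-- `Ω` is a smooth bounded domain, `Ω⁺` a smooth simply connected domain compactly contained in
it, and `δ` is a tubular width of the interface `Γ₀ = ∂Ω⁺`: the interface has distance at least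
`3δ` from `∂Ω`, and the signed distance is smooth in the tube of radius `3δ`. -/
structure IsInterface (Ω Ωp : Set Vec3) (δ : ℝ) : Prop where
  isOpen : IsOpen Ω
  connected : IsConnected Ω
  bounded : Bornology.IsBounded Ω
  smooth : HasSmoothBoundary Ω
  isOpen_plus : IsOpen Ωp
  simplyConnected_plus : SimplyConnectedSpace Ωp
  smooth_plus : HasSmoothBoundary Ωp
  closure_plus : closure Ωp ⊆ Ω
  δ_pos : 0 < δ
  dist_boundary : ∀ x ∈ frontier Ωp, ∀ y ∈ frontier Ω, 3 * δ ≤ dist x y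
  smooth_sdist : ContDiffOn ℝ ∞ (sdist Ω Ωp) (tube Ω Ωp (3 * δ))

/-! ### Relative energy and bulk error at a fixed time -/

/-- The cut-off in the definition of the calibration `ξ`. -/
structure IsCalibrationCutoff (φ : ℝ → ℝ) : Prop where
  smooth : ContDiff ℝ ∞ φ
  even : ∀ x, φ (-x) = φ x
  antitone : AntitoneOn φ (Icc 0 1)
  pos : ∀ x, |x| < 1 → 0 < φ x
  zero : ∀ x, 1 ≤ |x| → φ x = 0
  bounds : ∀ x, |x| ≤ 1 / 2 → 1 - 4 * x ^ 2 ≤ φ x ∧ φ x ≤ 1 - 1 / 2 * x ^ 2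

/-- The calibration: a cut-off extension of the unit normal of `Γ₀` that points into `Ω⁻`, the
side where `ψ_ε` is large. -/
def calibration (Ω Ωp : Set Vec3) (δ : ℝ) (φ : ℝ → ℝ) (x : Vec3) : Vec3 :=
  -(φ (sdist Ω Ωp x / δ) • gradient (sdist Ω Ωp) x)

/-- `ψ_ε = d^F_ε ∘ Q`. -/
def psi (a b c : ℝ) (η : QTensor → ℝ) (ε : ℝ) (Q : Vec3 → QTensor) (x : Vec3) : ℝ :=
  quasiDistReg a b c η ε (Q x)

/-- The density `ε/2 |∇Q|² + F_ε(Q)/ε - ξ · ∇ψ_ε`. -/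
def relativeDensity (a b c : ℝ) (Ω Ωp : Set Vec3) (δ : ℝ) (φ : ℝ → ℝ) (η : QTensor → ℝ) (ε : ℝ)
    (Q : Vec3 → QTensor) (x : Vec3) : ℝ :=
  ε / 2 * ∑ k, ‖weakGrad Ω Q k x‖ ^ 2 + 1 / ε * bulkEnergyReg a b c ε (Q x)
    - ∑ k, calibration Ω Ωp δ φ x k * weakGrad Ω (psi a b c η ε Q) k x

/-- The relative energy `E[v_ε, Q_ε | v, χ]` at a fixed time. -/
def relativeEnergy (a b c : ℝ) (Ω Ωp : Set Vec3) (δ : ℝ) (φ : ℝ → ℝ) (η : QTensor → ℝ) (ε : ℝ)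
    (vε v : Vec3 → Vec3) (Q : Vec3 → QTensor) : ℝ :=
  (∫ x in Ω, 1 / 2 * ‖vε x - v x‖ ^ 2) + ∫ x in Ω, relativeDensity a b c Ω Ωp δ φ η ε Q x

/-- The truncation `ϑ` of (minus) the signed distance. -/
def truncation (δ r : ℝ) : ℝ := if δ ≤ r then -δ else if r ≤ -δ then δ else -r

/-- The density `(σ χ_{Ω⁻} - ψ_ε) ϑ(d_Γ)`. -/
def bulkErrorDensity (a b c : ℝ) (Ω Ωp : Set Vec3) (δ : ℝ) (η : QTensor → ℝ) (ε : ℝ)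
    (Q : Vec3 → QTensor) (x : Vec3) : ℝ :=
  (surfaceTension a b c * (outerPhase Ω Ωp).indicator 1 x - psi a b c η ε Q x) *
    truncation δ (sdist Ω Ωp x)

/-- The bulk error `E_vol[Q_ε | χ]` at a fixed time. -/
def bulkError (a b c : ℝ) (Ω Ωp : Set Vec3) (δ : ℝ) (η : QTensor → ℝ) (ε : ℝ)
    (Q : Vec3 → QTensor) : ℝ :=
  ∫ x in Ω, bulkErrorDensity a b c Ω Ωp δ η ε Q x

/-! ### The initial datum -/

/-- The cut-off in the definition of the initial datum. -/
structure IsInitialCutoff (ζ : ℝ → ℝ) : Prop where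
  smooth : ContDiff ℝ ∞ ζ
  range : ∀ s, ζ s ∈ Icc 0 1
  one : ∀ s, |s| ≤ 1 / 2 → ζ s = 1
  zero : ∀ s, 1 ≤ |s| → ζ s = 0

/-- The transition profile `S`. -/
def profile (a b c z : ℝ) : ℝ := sPlus a b c / 2 * (1 + Real.tanh (√a / 2 * z))

/-- The order parameter of the initial datum. -/
def initialOrder (a b c : ℝ) (Ω Ωp : Set Vec3) (δ : ℝ) (ζ : ℝ → ℝ) (ε : ℝ) (x : Vec3) : ℝ :=
  ζ (sdist Ω Ωp x / δ) * profile a b c (sdist Ω Ωp x / ε)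
    + (1 - ζ (sdist Ω Ωp x / δ)) * (sPlus a b c * Ωp.indicator 1 x)

/-- The initial datum `Q_{0,ε}`. -/
def initialDatum (a b c : ℝ) (Ω Ωp : Set Vec3) (δ : ℝ) (ζ : ℝ → ℝ) (ε : ℝ) (u₀ : Vec3 → S2)
    (x : Vec3) : QTensor :=
  initialOrder a b c Ω Ωp δ ζ ε x • director (u₀ x)

end BerisEdwards

end

open BerisEdwards

/-!
At `b ^ 2 = 27 a c` the two wells `0` and `s₊` have equal depth, and the bulk energy of
`s (e ⊗ e - I / 3)` is the square of `w s = √c / 3 · s (s₊ - s)`. Since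
`√(2 F γ) |γ'| ≥ 2 / √3 · |w s| |s'|` with `s = √(3 / 2) |γ|` along every curve `γ`, the
quasi-distance of a uniaxial tensor of order `s ∈ [0, s₊]` is explicit: it is `W s₊ - W s`, where
`W' = 2 / √3 · w`, and `σ = W s₊`. For a datum with order parameter `s (d_Γ)` and a constant
director, the energy density with `d^F` in place of `d^F_ε` is therefore, up to the `ε ^ 2` that
comes from `F_ε = F + ε ^ 3`,
`(√(ε / 3) s' - w s / √ε) ^ 2 + 2 / √3 · (1 - φ) w s · s'`.

The hyperbolic tangent profile makes the square vanish, and the remaining term is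
`2 (1 - φ) (w s) ^ 2 / ε`. It is of order `ε` because `1 - φ` is at most `4 (d_Γ / δ) ^ 2` while
`w s` decays exponentially at scale `ε`; the cut-off `ζ` only acts where `|d_Γ| ≥ δ / 2` and
contributes exponentially small errors. The gradient of the director field is orthogonal to the
normal part and adds at most a multiple of `ε |∇u₀| ^ 2`.

Replacing `d^F` by `d^F_ε` changes the potential by at most a multiple of `ε ^ 4`, because `d^F` is
locally Lipschitz; integrating the flux by parts against the compactly supported calibration turns
this into an error in the energy. In the bulk term `ϑ (d_Γ)` vanishes linearly on the interface, so
the mismatch of order one in a layer of width `ε` is again of order `ε`.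
-/

namespace BerisEdwards

open Filter Topology

/-! ### Weak derivatives -/

section LocallyIntegrable

variable {X E : Type*} [TopologicalSpace X] [T2Space X] [MeasurableSpace X] [OpensMeasurableSpace X]
  {μ : Measure X} [NormedAddCommGroup E] [NormedSpace ℝ E]

lemma integrable_smul_of_eq_zero_off_compact {U K : Set X} {w : X → E} {f : X → ℝ}
    (hw : LocallyIntegrableOn w U μ) (hf : ContinuousOn f U) (hK : IsCompact K) (hKU : K ⊆ U)
    (hfK : ∀ x ∉ K, f x = 0) : Integrable (fun x => f x • w x) μ := by
  have hint : IntegrableOn (fun x => f x • w x) K μ :=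
    (hw.integrableOn_compact_subset hKU hK).continuousOn_smul (hf.mono hKU) hK
  refine (integrableOn_iff_integrable_of_support_subset fun x hx => ?_).mp hint
  by_contra hxK
  exact hx (by simp only [hfK x hxK, zero_smul])

end LocallyIntegrable

lemma setIntegral_eq_integral_of_eq_zero_off {X E : Type*} [MeasurableSpace X] {μ : Measure X}
    [NormedAddCommGroup E] [NormedSpace ℝ E] {U K : Set X} {w : X → E} (hKU : K ⊆ U)
    (hw : ∀ x ∉ K, w x = 0) : ∫ x in U, w x ∂μ = ∫ x, w x ∂μ :=
  setIntegral_eq_integral_of_forall_compl_eq_zero fun x hx => hw x fun h => hx (hKU h)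

section SmoothFunctions

variable {X F : Type*} [NormedAddCommGroup X] [NormedSpace ℝ X]
  [NormedAddCommGroup F] [NormedSpace ℝ F] {U : Set X}

lemma contDiff_smul_of_tsupport_subset {n : WithTop ℕ∞} (hU : IsOpen U) {φ : X → ℝ} {g : X → F}
    (hφ : ContDiff ℝ n φ) (hs : tsupport φ ⊆ U) (hg : ContDiffOn ℝ n g U) :
    ContDiff ℝ n (fun x => φ x • g x) := by
  rw [contDiff_iff_contDiffAt]
  intro x
  by_cases hx : x ∈ tsupport φ
  · exact hφ.contDiffAt.smul (hg.contDiffAt (hU.mem_nhds (hs hx)))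
  · refine (contDiffAt_const (c := (0 : F))).congr_of_eventuallyEq ?_
    filter_upwards [(isClosed_tsupport φ).isOpen_compl.mem_nhds hx] with y hy
    rw [image_eq_zero_of_notMem_tsupport hy, zero_smul]

lemma continuousOn_fderiv_apply (hU : IsOpen U) {g : X → F} (hg : ContDiffOn ℝ 1 g U) (v : X) :
    ContinuousOn (fun x => fderiv ℝ g x v) U :=
  (hg.continuousOn_fderiv_of_isOpen hU le_rfl).clm_apply continuousOn_const

end SmoothFunctions

namespace IsWeakGradient

variable {E : Type*} [NormedAddCommGroup E] [NormedSpace ℝ E] {Ω : Set Vec3} {w : Vec3 → E}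
  {G G' : Fin 3 → Vec3 → E}

lemma ae_eq [CompleteSpace E] (hΩ : IsOpen Ω) (h : IsWeakGradient Ω w G)
    (h' : IsWeakGradient Ω w G') (k : Fin 3) : G k =ᵐ[volume.restrict Ω] G' k := by
  have hzero := hΩ.ae_eq_zero_of_integral_contDiff_smul_eq_zero
    ((h.locInt_grad k).sub (h'.locInt_grad k)) fun φ hφ hc hs => by
      have hφ0 : ∀ x ∉ tsupport φ, φ x = 0 := fun _ => image_eq_zero_of_notMem_tsupport
      have hint := integrable_smul_of_eq_zero_off_compact (h.locInt_grad k)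
        hφ.continuous.continuousOn hc hs hφ0
      have hint' := integrable_smul_of_eq_zero_off_compact (h'.locInt_grad k)
        hφ.continuous.continuousOn hc hs hφ0
      have heq := (h.byParts k φ hφ hc hs).symm.trans (h'.byParts k φ hφ hc hs)
      rw [neg_inj, setIntegral_eq_integral_of_eq_zero_off hs fun x hx => by simp [hφ0 x hx],
        setIntegral_eq_integral_of_eq_zero_off hs fun x hx => by simp [hφ0 x hx]] at heq
      simp only [Pi.sub_apply, smul_sub]
      rw [integral_sub hint hint', heq, sub_self]
  rw [Filter.EventuallyEq, ae_restrict_iff' hΩ.measurableSet]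
  filter_upwards [hzero] with x hx hxΩ
  exact sub_eq_zero.mp (hx hxΩ)

section Product

variable {φ g : Vec3 → ℝ}

lemma integrable_mul_smul (h : IsWeakGradient Ω w G) (hφ : ContinuousOn φ Ω)
    (hg : ContinuousOn g Ω) {K : Set Vec3} (hK : IsCompact K) (hKΩ : K ⊆ Ω)
    (hφK : ∀ x ∉ K, φ x = 0) : Integrable (fun x => (φ x * g x) • w x) :=
  integrable_smul_of_eq_zero_off_compact h.locInt (hφ.mul hg) hK hKΩ fun x hx => by
    rw [hφK x hx, zero_mul]

lemma integrable_mul_smul_grad (h : IsWeakGradient Ω w G) (k : Fin 3) (hφ : ContinuousOn φ Ω)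
    (hg : ContinuousOn g Ω) {K : Set Vec3} (hK : IsCompact K) (hKΩ : K ⊆ Ω)
    (hφK : ∀ x ∉ K, φ x = 0) : Integrable (fun x => (φ x * g x) • G k x) :=
  integrable_smul_of_eq_zero_off_compact (h.locInt_grad k) (hφ.mul hg) hK hKΩ fun x hx => by
    rw [hφK x hx, zero_mul]

lemma byParts_mul (hΩ : IsOpen Ω) (h : IsWeakGradient Ω w G) (k : Fin 3)
    (hφ : ContDiff ℝ ∞ φ) (hc : HasCompactSupport φ) (hs : tsupport φ ⊆ Ω)
    (hg : ContDiffOn ℝ ∞ g Ω) :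
    (∫ x in Ω, (φ x * fderiv ℝ g x (EuclideanSpace.single k 1)) • w x) +
        ∫ x in Ω, (fderiv ℝ φ x (EuclideanSpace.single k 1) * g x) • w x =
      -∫ x in Ω, (φ x * g x) • G k x := by
  have hsub : tsupport (fun x => φ x * g x) ⊆ tsupport φ := tsupport_mul_subset_left
  have hparts := h.byParts k (fun x => φ x * g x) (contDiff_smul_of_tsupport_subset hΩ hφ hs hg)
    (hc.mono' ((subset_tsupport _).trans hsub)) (hsub.trans hs)
  have hint := (h.integrable_mul_smul hφ.continuous.continuousOn
    (continuousOn_fderiv_apply hΩ (hg.of_le (by simp)) (EuclideanSpace.single k 1)) hc hs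
    fun x => image_eq_zero_of_notMem_tsupport).integrableOn (s := Ω)
  have hint' := (h.integrable_mul_smul
    (continuousOn_fderiv_apply hΩ (hφ.contDiffOn.of_le (by simp)) (EuclideanSpace.single k 1))
    hg.continuousOn hc hs
    fun x hx => by rw [fderiv_of_notMem_tsupport ℝ hx, zero_apply]).integrableOn (s := Ω)
  rw [← integral_add hint hint', ← hparts]
  refine setIntegral_congr_fun hΩ.measurableSet fun x hx => ?_
  simp only [← add_smul]
  rw [fderiv_fun_mul (hφ.differentiable (by simp) x)
    ((hg.contDiffAt (hΩ.mem_nhds hx)).differentiableAt (by simp))]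
  simp only [add_apply, smul_apply, smul_eq_mul, mul_comm]

protected lemma smul (hΩ : IsOpen Ω) (h : IsWeakGradient Ω w G) (hg : ContDiffOn ℝ ∞ g Ω) :
    IsWeakGradient Ω (fun x => g x • w x)
      (fun k x => fderiv ℝ g x (EuclideanSpace.single k 1) • w x + g x • G k x) where
  locInt := h.locInt.continuousOn_smul hΩ.isLocallyClosed hg.continuousOn
  locInt_grad k := (h.locInt.continuousOn_smul hΩ.isLocallyClosed
    (continuousOn_fderiv_apply hΩ (hg.of_le (by simp)) _)).add
      ((h.locInt_grad k).continuousOn_smul hΩ.isLocallyClosed hg.continuousOn)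
  byParts k φ hφ hc hs := by
    have hφ0 : ∀ x ∉ tsupport φ, φ x = 0 := fun _ => image_eq_zero_of_notMem_tsupport
    have hint := h.integrable_mul_smul hφ.continuous.continuousOn
      (continuousOn_fderiv_apply hΩ (hg.of_le (by simp)) (EuclideanSpace.single k 1)) hc hs hφ0
    have hint' := h.integrable_mul_smul_grad k hφ.continuous.continuousOn hg.continuousOn hc hs hφ0
    simp only [smul_add, smul_smul]
    rw [integral_add hint.integrableOn hint'.integrableOn, neg_add,
      ← h.byParts_mul hΩ k hφ hc hs hg, neg_add_cancel_left]

end Product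

section Cutoff

variable {χ : Vec3 → ℝ}

lemma integrable_cutoff (h : IsWeakGradient Ω w G) (hχ : Continuous χ)
    (hc : HasCompactSupport χ) (hs : tsupport χ ⊆ Ω) : Integrable (fun x => χ x • w x) :=
  integrable_smul_of_eq_zero_off_compact h.locInt hχ.continuousOn hc hs
    fun _ => image_eq_zero_of_notMem_tsupport

lemma integrable_grad_cutoff (hΩ : IsOpen Ω) (h : IsWeakGradient Ω w G) (k : Fin 3)
    (hχ : ContDiff ℝ 1 χ) (hc : HasCompactSupport χ) (hs : tsupport χ ⊆ Ω) :
    Integrable (fun x => fderiv ℝ χ x (EuclideanSpace.single k 1) • w x + χ x • G k x) :=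
  (integrable_smul_of_eq_zero_off_compact h.locInt
    (continuousOn_fderiv_apply hΩ hχ.contDiffOn _) hc hs
      fun x hx => by rw [fderiv_of_notMem_tsupport ℝ hx, zero_apply]).add
  (integrable_smul_of_eq_zero_off_compact (h.locInt_grad k) hχ.continuous.continuousOn hc hs
    fun _ => image_eq_zero_of_notMem_tsupport)

lemma cutoff (hΩ : IsOpen Ω) (h : IsWeakGradient Ω w G) (hχ : ContDiff ℝ ∞ χ)
    (hc : HasCompactSupport χ) (hs : tsupport χ ⊆ Ω) :
    IsWeakGradient univ (fun x => χ x • w x)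
      (fun k x => fderiv ℝ χ x (EuclideanSpace.single k 1) • w x + χ x • G k x) where
  locInt := (h.integrable_cutoff hχ.continuous hc hs).locallyIntegrable.locallyIntegrableOn _
  locInt_grad k := (h.integrable_grad_cutoff hΩ k
    (hχ.of_le (by simp)) hc hs).locallyIntegrable.locallyIntegrableOn _
  byParts k f hf _ _ := by
    have hχ0 : ∀ x ∉ tsupport χ, χ x = 0 := fun _ => image_eq_zero_of_notMem_tsupport
    have hχ0' : ∀ x ∉ tsupport χ, fderiv ℝ χ x (EuclideanSpace.single k 1) = 0 := fun x hx => by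
      rw [fderiv_of_notMem_tsupport ℝ hx, zero_apply]
    have hparts := h.byParts_mul hΩ k hχ hc hs hf.contDiffOn
    rw [setIntegral_eq_integral_of_eq_zero_off hs fun x hx => by simp [hχ0 x hx],
      setIntegral_eq_integral_of_eq_zero_off hs fun x hx => by simp [hχ0' x hx],
      setIntegral_eq_integral_of_eq_zero_off hs fun x hx => by simp [hχ0 x hx]] at hparts
    have hint := h.integrable_mul_smul
      (continuousOn_fderiv_apply hΩ (hχ.contDiffOn.of_le (by simp)) (EuclideanSpace.single k 1))
      hf.continuous.continuousOn hc hs hχ0'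
    have hint' := h.integrable_mul_smul_grad k hχ.continuous.continuousOn
      hf.continuous.continuousOn hc hs hχ0
    simp only [setIntegral_univ, smul_add, smul_smul, mul_comm (f _),
      mul_comm (fderiv ℝ f _ _)]
    rw [integral_add hint hint', neg_add, ← hparts]
    abel

end Cutoff

end IsWeakGradient

lemma isWeakGradient_const {E : Type*} [NormedAddCommGroup E] [NormedSpace ℝ E] (Ω : Set Vec3)
    (e : E) : IsWeakGradient Ω (fun _ => e) (fun _ _ => 0) where
  locInt := (locallyIntegrable_const e).locallyIntegrableOn Ω
  locInt_grad _ := (locallyIntegrable_const (0 : E)).locallyIntegrableOn Ω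
  byParts k φ hφ hc hs := by
    set v : Vec3 := EuclideanSpace.single k 1
    have hdφ : Continuous fun x => fderiv ℝ φ x v :=
      (hφ.continuous_fderiv (by simp)).clm_apply continuous_const
    have hparts := integral_smul_fderiv_eq_neg_fderiv_smul_of_integrable
      (μ := (volume : Measure Vec3)) (f := φ) (g := fun _ => e) (v := v)
      ((hdφ.integrable_of_hasCompactSupport (hc.fderiv_apply (𝕜 := ℝ) v)).smul_const e)
      (by simp) ((hφ.continuous.integrable_of_hasCompactSupport hc).smul_const e)
      (fun x _ => hφ.differentiable (by simp) x) (fun _ _ => differentiableAt_const e)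
    rw [setIntegral_eq_integral_of_eq_zero_off hs
      fun x hx => by rw [fderiv_of_notMem_tsupport ℝ hx, zero_apply, zero_smul]]
    simpa using hparts.symm

lemma isWeakGradient_of_contDiffOn {Ω : Set Vec3} (hΩ : IsOpen Ω) {g : Vec3 → ℝ}
    (hg : ContDiffOn ℝ ∞ g Ω) :
    IsWeakGradient Ω g (fun k x => fderiv ℝ g x (EuclideanSpace.single k 1)) := by
  simpa using (isWeakGradient_const Ω (1 : ℝ)).smul hΩ hg

/-! ### Mollification and the chain rule -/

section L1Convergence

variable {α ι : Type*} [MeasurableSpace α] {μ : Measure α} {l : Filter ι} [l.IsCountablyGenerated]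

lemma tendsto_integral_abs_sub {h : ι → α → ℝ} {h' : α → ℝ} (hh : ∀ i, Integrable (h i) μ)
    (hh' : Integrable h' μ) (hnonneg : ∀ i, 0 ≤ᵐ[μ] h i)
    (hlim : ∀ᵐ x ∂μ, Tendsto (fun i => h i x) l (𝓝 (h' x)))
    (hint : Tendsto (fun i => ∫ x, h i x ∂μ) l (𝓝 (∫ x, h' x ∂μ))) :
    Tendsto (fun i => ∫ x, |h i x - h' x| ∂μ) l (𝓝 0) := by
  have hdeficit : Tendsto (fun i => ∫ x, max (h' x - h i x) 0 ∂μ) l (𝓝 0) := by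
    have hdom := tendsto_integral_filter_of_dominated_convergence (μ := μ) (l := l)
      (F := fun i x => max (h' x - h i x) 0) (f := fun _ => 0) (fun x => |h' x|)
      (Eventually.of_forall fun i => (hh'.sub (hh i)).pos_part.aestronglyMeasurable)
      (Eventually.of_forall fun i => ?_) hh'.abs ?_
    · simpa only [integral_zero] using hdom
    · filter_upwards [hnonneg i] with x hx
      rw [Real.norm_of_nonneg (le_max_right _ _)]
      exact max_le ((sub_le_self _ hx).trans (le_abs_self _)) (abs_nonneg _)
    · filter_upwards [hlim] with x hx
      simpa using (hx.const_sub (h' x)).max (tendsto_const_nhds (x := (0 : ℝ)))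
  have hsplit (i : ι) : ∫ x, |h i x - h' x| ∂μ =
      (∫ x, h i x ∂μ) - (∫ x, h' x ∂μ) + 2 * ∫ x, max (h' x - h i x) 0 ∂μ := by
    rw [← integral_sub (hh i) hh', ← integral_const_mul,
      ← integral_add (f := fun x => h i x - h' x) (g := fun x => 2 * max (h' x - h i x) 0)
      ((hh i).sub hh') ((hh'.sub (hh i)).pos_part.const_mul 2)]
    refine integral_congr_ae (Eventually.of_forall fun x => ?_)
    beta_reduce
    rcases le_total (h i x) (h' x) with hle | hle
    · rw [abs_of_nonpos (sub_nonpos.mpr hle), max_eq_left (sub_nonneg.mpr hle)]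
      ring
    · rw [abs_of_nonneg (sub_nonneg.mpr hle), max_eq_right (sub_nonpos.mpr hle)]
      ring
  simpa only [hsplit, sub_self, mul_zero, add_zero] using
    (hint.sub_const (∫ x, h' x ∂μ)).add (hdeficit.const_mul 2)

variable {E F : Type*} [NormedAddCommGroup E]

lemma tendsto_integral_norm_sub {f : ι → α → E} {f' : α → E} {h : ι → α → ℝ} {h' : α → ℝ}
    (hf : ∀ i, AEStronglyMeasurable (f i) μ) (hf' : Integrable f' μ)
    (hh : ∀ i, Integrable (h i) μ) (hh' : Integrable h' μ) (hle : ∀ i x, ‖f i x‖ ≤ h i x)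
    (hlim : ∀ᵐ x ∂μ, Tendsto (fun i => f i x) l (𝓝 (f' x)))
    (hhlim : ∀ᵐ x ∂μ, Tendsto (fun i => h i x) l (𝓝 (h' x)))
    (hint : Tendsto (fun i => ∫ x, h i x ∂μ) l (𝓝 (∫ x, h' x ∂μ))) :
    Tendsto (fun i => ∫ x, ‖f i x - f' x‖ ∂μ) l (𝓝 0) := by
  have hdominating := tendsto_integral_abs_sub hh hh'
    (fun i => Eventually.of_forall fun x => (norm_nonneg _).trans (hle i x)) hhlim hint
  have hdiff (i : ι) : Integrable (fun x => ‖f i x - f' x‖) μ :=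
    (((hh i).mono' (hf i) (Eventually.of_forall (hle i))).sub hf').norm
  have hexcess_int (i : ι) : Integrable (fun x => max (‖f i x - f' x‖ - |h i x - h' x|) 0) μ :=
    ((hdiff i).sub ((hh i).sub hh').abs).pos_part
  have hexcess : Tendsto (fun i => ∫ x, max (‖f i x - f' x‖ - |h i x - h' x|) 0 ∂μ) l (𝓝 0) := by
    have hdom := tendsto_integral_filter_of_dominated_convergence (μ := μ) (l := l)
      (F := fun i x => max (‖f i x - f' x‖ - |h i x - h' x|) 0) (f := fun _ => 0)
      (fun x => |h' x| + ‖f' x‖)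
      (Eventually.of_forall fun i => (hexcess_int i).aestronglyMeasurable)
      (Eventually.of_forall fun i => Eventually.of_forall fun x => ?_) (hh'.abs.add hf'.norm) ?_
    · simpa only [integral_zero] using hdom
    · rw [Real.norm_of_nonneg (le_max_right _ _)]
      refine max_le ?_ (by positivity)
      linarith [norm_sub_le (f i x) (f' x), hle i x, le_abs_self (h i x - h' x),
        le_abs_self (h' x)]
    · filter_upwards [hlim, hhlim] with x hx hhx
      simpa using ((hx.sub_const (f' x)).norm.sub (hhx.sub_const (h' x)).abs).max
        (tendsto_const_nhds (x := (0 : ℝ)))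
  refine squeeze_zero (fun i => integral_nonneg fun x => norm_nonneg _) (fun i => ?_)
    (by simpa only [add_zero] using hdominating.add hexcess)
  rw [← integral_add (f := fun x => |h i x - h' x|) ((hh i).sub hh').abs (hexcess_int i)]
  exact integral_mono (hdiff i) (((hh i).sub hh').abs.add (hexcess_int i)) fun x =>
    sub_le_iff_le_add'.mp (le_max_left _ _)

variable [NormedSpace ℝ E] [NormedAddCommGroup F] [NormedSpace ℝ F]

lemma memLp_clm_apply {p : ENNReal} {A : α → E →L[ℝ] F} {g : α → E} {C : ℝ}
    (hA : AEStronglyMeasurable A μ) (hC : ∀ x, ‖A x‖ ≤ C) (hg : MemLp g p μ) :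
    MemLp (fun x => A x (g x)) p μ :=
  hg.of_le_mul (c := C) ((ContinuousLinearMap.id ℝ (E →L[ℝ] F)).aestronglyMeasurable_comp₂ hA
    hg.aestronglyMeasurable) (Eventually.of_forall fun x => (A x).le_of_opNorm_le (hC x) _)

lemma tendsto_integral_clm_apply {A : ι → α → E →L[ℝ] F} {A' : α → E →L[ℝ] F} {f : ι → α → E}
    {f' : α → E} {C : ℝ} (hA : ∀ i, AEStronglyMeasurable (A i) μ) (hC : ∀ i x, ‖A i x‖ ≤ C)
    (hf : ∀ i, Integrable (f i) μ) (hf' : Integrable f' μ)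
    (hAlim : ∀ᵐ x ∂μ, Tendsto (fun i => A i x) l (𝓝 (A' x)))
    (hlim : Tendsto (fun i => ∫ x, ‖f i x - f' x‖ ∂μ) l (𝓝 0)) :
    Tendsto (fun i => ∫ x, A i x (f i x) ∂μ) l (𝓝 (∫ x, A' x (f' x) ∂μ)) := by
  have happly_int (i : ι) {g : α → E} (hg : Integrable g μ) :
      Integrable (fun x => A i x (g x)) μ :=
    memLp_one_iff_integrable.mp (memLp_clm_apply (hA i) (hC i) (memLp_one_iff_integrable.mpr hg))
  have hfrozen : Tendsto (fun i => ∫ x, A i x (f' x) ∂μ) l (𝓝 (∫ x, A' x (f' x) ∂μ)) := by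
    refine tendsto_integral_filter_of_dominated_convergence (fun x => C * ‖f' x‖)
      (Eventually.of_forall fun i => (happly_int i hf').aestronglyMeasurable)
      (Eventually.of_forall fun i => Eventually.of_forall fun x =>
        (A i x).le_of_opNorm_le (hC i x) _) (hf'.norm.const_mul C) ?_
    filter_upwards [hAlim] with x hx
    exact ((ContinuousLinearMap.apply ℝ F (f' x)).continuous.tendsto _).comp hx
  have herror : Tendsto (fun i => ∫ x, A i x (f i x - f' x) ∂μ) l (𝓝 0) := by
    refine squeeze_zero_norm (fun i => ?_) (by simpa only [mul_zero] using hlim.const_mul C)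
    rw [← integral_const_mul]
    exact norm_integral_le_of_norm_le ((((hf i).sub hf').norm).const_mul C)
      (Eventually.of_forall fun x => (A i x).le_of_opNorm_le (hC i x) _)
  have hsplit (i : ι) : ∫ x, A i x (f i x) ∂μ =
      (∫ x, A i x (f i x - f' x) ∂μ) + ∫ x, A i x (f' x) ∂μ := by
    rw [← integral_add (f := fun x => A i x (f i x - f' x)) (happly_int i ((hf i).sub hf'))
      (happly_int i hf')]
    simp only [map_sub, sub_add_cancel]
  simpa only [hsplit, zero_add] using herror.add hfrozen

end L1Convergence

lemma exists_seq_contDiffBump_rOut_tendsto_zero {X : Type*} (x : X) :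
    ∃ β : ℕ → ContDiffBump x, Tendsto (fun n => (β n).rOut) atTop (𝓝 0) ∧
      ∀ n, (β n).rOut ≤ 2 * (β n).rIn := by
  refine ⟨fun n => ⟨1 / ((n : ℝ) + 1), 2 * (1 / ((n : ℝ) + 1)), by positivity,
    lt_two_mul_self (by positivity)⟩, ?_, fun n => le_rfl⟩
  simpa only [mul_zero] using (tendsto_one_div_add_atTop_nhds_zero_nat (𝕜 := ℝ)).const_mul 2

section Mollification

open ContinuousLinearMap

variable {X E : Type*} [NormedAddCommGroup X] [MeasurableSpace X] {μ : Measure X}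
  [NormedAddCommGroup E] [NormedSpace ℝ E]

lemma norm_convolution_lsmul_le {ρ : X → ℝ} (hρ : ∀ x, 0 ≤ ρ x) (f : X → E) (x : X) :
    ‖convolution ρ f (lsmul ℝ ℝ) μ x‖ ≤ convolution ρ (fun y => ‖f y‖) (lsmul ℝ ℝ) μ x := by
  refine (norm_integral_le_integral_norm _).trans_eq (integral_congr_ae ?_)
  refine Eventually.of_forall fun y => ?_
  simp only [lsmul_apply, norm_smul, smul_eq_mul, Real.norm_of_nonneg (hρ y)]

variable [NormedSpace ℝ X] [FiniteDimensional ℝ X] [BorelSpace X] [μ.IsAddHaarMeasure]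

lemma tendsto_integral_norm_convolution_sub [CompleteSpace E] {ι : Type*} {l : Filter ι}
    [l.IsCountablyGenerated] {β : ι → ContDiffBump (0 : X)} {K : ℝ}
    (hβ : Tendsto (fun i => (β i).rOut) l (𝓝 0)) (hK : ∀ᶠ i in l, (β i).rOut ≤ K * (β i).rIn)
    {f : X → E} (hf : Integrable f μ) :
    Tendsto (fun i => ∫ x, ‖convolution ((β i).normed μ) f (lsmul ℝ ℝ) μ x - f x‖ ∂μ) l (𝓝 0) := by
  refine tendsto_integral_norm_sub
    (h := fun i => convolution ((β i).normed μ) (fun y => ‖f y‖) (lsmul ℝ ℝ) μ)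
    (fun i => ((β i).integrable_normed.integrable_convolution _ hf).aestronglyMeasurable) hf
    (fun i => (β i).integrable_normed.integrable_convolution _ hf.norm) hf.norm
    (fun i => norm_convolution_lsmul_le (β i).nonneg_normed f)
    (ContDiffBump.ae_convolution_tendsto_right_of_locallyIntegrable hβ hK hf.locallyIntegrable)
    (ContDiffBump.ae_convolution_tendsto_right_of_locallyIntegrable hβ hK
      hf.norm.locallyIntegrable) ?_
  have hmass (i : ι) : ∫ x, convolution ((β i).normed μ) (fun y => ‖f y‖) (lsmul ℝ ℝ) μ x ∂μ =
      ∫ x, ‖f x‖ ∂μ := by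
    rw [integral_convolution (lsmul ℝ ℝ) (β i).integrable_normed hf.norm, (β i).integral_normed,
      lsmul_apply, one_smul]
  simpa only [hmass] using tendsto_const_nhds

end Mollification

section WholeSpace

open ContinuousLinearMap

variable {E F : Type*} [NormedAddCommGroup E] [NormedSpace ℝ E] [NormedAddCommGroup F]
  [NormedSpace ℝ F] {W : Vec3 → E} {H : Fin 3 → Vec3 → E}

lemma IsWeakGradient.fderiv_convolution (h : IsWeakGradient univ W H) (k : Fin 3) {ρ : Vec3 → ℝ}
    (hρ : ContDiff ℝ ∞ ρ) (hc : HasCompactSupport ρ) (x : Vec3) :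
    fderiv ℝ (convolution ρ W (lsmul ℝ ℝ) volume) x (EuclideanSpace.single k 1) =
      convolution ρ (H k) (lsmul ℝ ℝ) volume x := by
  set v : Vec3 := EuclideanSpace.single k 1
  have hW : LocallyIntegrable W := locallyIntegrableOn_univ.mp h.locInt
  have hρ' : ContDiff ℝ 1 ρ := hρ.of_le (by simp)
  have hreflect (t : Vec3) : fderiv ℝ (fun t => ρ (x - t)) t v = -(fderiv ℝ ρ (x - t) v) := by
    have hcomp := (hρ'.differentiable one_ne_zero (x - t)).hasFDerivAt.comp t
      ((hasFDerivAt_const x t).sub (hasFDerivAt_id t))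
    simpa [Function.comp_def] using congrArg (· v) hcomp.fderiv
  have hparts := h.byParts k (fun t => ρ (x - t)) (hρ.comp (contDiff_const.sub contDiff_id))
    (hc.comp_homeomorph (Homeomorph.subLeft x)) (subset_univ _)
  simp only [setIntegral_univ] at hparts
  rw [(hc.hasFDerivAt_convolution_left (lsmul ℝ ℝ) hρ' hW x).fderiv, convolution_eq_swap,
    convolution_eq_swap, ContinuousLinearMap.integral_apply
      ((hc.fderiv (𝕜 := ℝ)).convolutionExists_left _
        (hρ'.continuous_fderiv one_ne_zero) hW x).integrable_swap]
  simp only [precompL_apply, lsmul_apply]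
  rw [← neg_inj, ← integral_neg, ← hparts]
  exact integral_congr_ae (Eventually.of_forall fun t => by
    simp only [v, ← neg_smul, ← hreflect])

variable {Φ : E → F} {φ : Vec3 → ℝ}

lemma IsWeakGradient.integral_fderiv_smul_comp_convolution (h : IsWeakGradient univ W H)
    (k : Fin 3) {ρ : Vec3 → ℝ} (hρ : ContDiff ℝ ∞ ρ) (hρc : HasCompactSupport ρ)
    (hΦ : ContDiff ℝ 1 Φ) (hφ : ContDiff ℝ 1 φ) (hc : HasCompactSupport φ) :
    ∫ x, fderiv ℝ φ x (EuclideanSpace.single k 1) •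
        Φ (convolution ρ W (lsmul ℝ ℝ) volume x) =
      -∫ x, φ x • fderiv ℝ Φ (convolution ρ W (lsmul ℝ ℝ) volume x)
        (convolution ρ (H k) (lsmul ℝ ℝ) volume x) := by
  set v : Vec3 := EuclideanSpace.single k 1
  set V := convolution ρ W (lsmul ℝ ℝ) volume
  have hVdiff : ContDiff ℝ 1 V := hρc.contDiff_convolution_left _ (hρ.of_le (by simp))
    (locallyIntegrableOn_univ.mp h.locInt)
  have hcomp : ContDiff ℝ 1 (fun x => Φ (V x)) := hΦ.comp hVdiff
  have hderiv (x : Vec3) : fderiv ℝ Φ (V x) (convolution ρ (H k) (lsmul ℝ ℝ) volume x) =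
      fderiv ℝ (fun x => Φ (V x)) x v := by
    rw [← h.fderiv_convolution k hρ hρc x,
      fderiv_fun_comp x (hΦ.differentiable one_ne_zero _) (hVdiff.differentiable one_ne_zero _)]
    rfl
  have hdφ : Continuous fun x => fderiv ℝ φ x v :=
    (hφ.continuous_fderiv one_ne_zero).clm_apply continuous_const
  have hdcomp : Continuous fun x => fderiv ℝ (fun x => Φ (V x)) x v :=
    (hcomp.continuous_fderiv one_ne_zero).clm_apply continuous_const
  simp only [hderiv]
  rw [integral_smul_fderiv_eq_neg_fderiv_smul_of_integrable
    ((hdφ.smul hcomp.continuous).integrable_of_hasCompactSupport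
      (hc.fderiv_apply (𝕜 := ℝ) v).smul_right)
    ((hφ.continuous.smul hdcomp).integrable_of_hasCompactSupport hc.smul_right)
    ((hφ.continuous.smul hcomp.continuous).integrable_of_hasCompactSupport hc.smul_right)
    (fun x _ => hφ.differentiable one_ne_zero x)
    (fun x _ => hcomp.differentiable one_ne_zero x), neg_neg]

lemma IsWeakGradient.integral_fderiv_smul_comp [CompleteSpace E] (h : IsWeakGradient univ W H)
    (hW : Integrable W) {k : Fin 3} (hH : Integrable (H k)) (hΦ : ContDiff ℝ 1 Φ) {B : ℝ}
    (hB : ∀ q, ‖Φ q‖ ≤ B) (hB' : ∀ q, ‖fderiv ℝ Φ q‖ ≤ B) (hφ : ContDiff ℝ 1 φ)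
    (hc : HasCompactSupport φ) :
    ∫ x, fderiv ℝ φ x (EuclideanSpace.single k 1) • Φ (W x) =
      -∫ x, φ x • fderiv ℝ Φ (W x) (H k x) := by
  obtain ⟨β, hβ, hβ'⟩ := exists_seq_contDiffBump_rOut_tendsto_zero (0 : Vec3)
  set v : Vec3 := EuclideanSpace.single k 1
  set V : ℕ → Vec3 → E := fun n => convolution ((β n).normed volume) W (lsmul ℝ ℝ) volume
  have hVcont (n : ℕ) : Continuous (V n) :=
    (β n).hasCompactSupport_normed.continuous_convolution_left _ (β n).continuous_normed
      hW.locallyIntegrable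
  have hVlim : ∀ᵐ x, Tendsto (fun n => V n x) atTop (𝓝 (W x)) :=
    ContDiffBump.ae_convolution_tendsto_right_of_locallyIntegrable hβ
      (Eventually.of_forall hβ') hW.locallyIntegrable
  have hdφ : Continuous fun x => fderiv ℝ φ x v :=
    (hφ.continuous_fderiv one_ne_zero).clm_apply continuous_const
  have hΦ' : Continuous (fderiv ℝ Φ) := hΦ.continuous_fderiv one_ne_zero
  obtain ⟨C, hC⟩ := hφ.continuous.bounded_above_of_compact_support hc
  have hleft : Tendsto (fun n => ∫ x, fderiv ℝ φ x v • Φ (V n x)) atTop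
      (𝓝 (∫ x, fderiv ℝ φ x v • Φ (W x))) := by
    refine tendsto_integral_of_dominated_convergence (fun x => ‖fderiv ℝ φ x v‖ * B)
      (fun n => (hdφ.smul (hΦ.continuous.comp (hVcont n))).aestronglyMeasurable)
      ((hdφ.integrable_of_hasCompactSupport (hc.fderiv_apply (𝕜 := ℝ) v)).norm.mul_const B)
      (fun n => Eventually.of_forall fun x => ?_) ?_
    · exact (norm_smul _ _).trans_le (mul_le_mul_of_nonneg_left (hB _) (norm_nonneg _))
    · filter_upwards [hVlim] with x hx
      exact ((hΦ.continuous.tendsto _).comp hx).const_smul _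
  have hright := tendsto_integral_clm_apply (A := fun n x => φ x • fderiv ℝ Φ (V n x))
    (A' := fun x => φ x • fderiv ℝ Φ (W x)) (C := C * B)
    (fun n => (hφ.continuous.smul (hΦ'.comp (hVcont n))).aestronglyMeasurable)
    (fun n x => (norm_smul _ _).trans_le
      (mul_le_mul (hC x) (hB' _) (norm_nonneg _) ((norm_nonneg _).trans (hC x))))
    (fun n => (β n).integrable_normed.integrable_convolution (lsmul ℝ ℝ) hH) hH
    (hVlim.mono fun x hx => ((hΦ'.tendsto _).comp hx).const_smul _)
    (tendsto_integral_norm_convolution_sub hβ (Eventually.of_forall hβ') hH)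
  refine tendsto_nhds_unique hleft (hright.neg.congr fun n => ?_)
  exact (h.integral_fderiv_smul_comp_convolution k (β n).contDiff_normed
    (β n).hasCompactSupport_normed hΦ hφ hc).symm

end WholeSpace

lemma exists_contDiff_cutoff {X : Type*} [NormedAddCommGroup X] [NormedSpace ℝ X]
    [FiniteDimensional ℝ X] {U K : Set X} (hU : IsOpen U) (hK : IsCompact K) (hKU : K ⊆ U) :
    ∃ χ : X → ℝ, ContDiff ℝ ∞ χ ∧ HasCompactSupport χ ∧ tsupport χ ⊆ U ∧
      ∀ x ∈ K, χ =ᶠ[𝓝 x] fun _ => 1 := by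
  have := FiniteDimensional.proper_real X
  obtain ⟨L, hL, hKL, hLU⟩ := exists_compact_between hK hU hKU
  obtain ⟨χ, hone, hzero, -⟩ := exists_contMDiffMap_one_nhds_of_subset_interior (n := (⊤ : ℕ∞))
    (modelWithCornersSelf ℝ X) hK.isClosed hKL
  have hs : tsupport χ ⊆ L :=
    closure_minimal (fun x hx => by_contra fun hxL => hx (hzero x hxL)) hL.isClosed
  exact ⟨χ, χ.contMDiff.contDiff, hL.of_isClosed_subset (isClosed_tsupport _) hs, hs.trans hLU,
    fun x hx => hone.filter_mono (nhds_le_nhdsSet hx)⟩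

section BoundedComposition

variable {X E F : Type*} [NormedAddCommGroup E] [NormedAddCommGroup F] {w : X → E}

lemma exists_norm_comp_le [ProperSpace E] {R : ℝ} (hR : ∀ x, ‖w x‖ ≤ R) {Φ : E → F}
    (hΦ : Continuous Φ) : ∃ B, ∀ x, ‖Φ (w x)‖ ≤ B :=
  ((isCompact_closedBall (0 : E) R).exists_bound_of_continuousOn hΦ.continuousOn).imp
    fun _ hB x => hB _ (mem_closedBall_zero_iff.mpr (hR x))

variable [TopologicalSpace X] [LocallyCompactSpace X] [MeasurableSpace X] {μ : Measure X}
  {U : Set X} {B : ℝ}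

lemma locallyIntegrableOn_comp_of_norm_le [IsFiniteMeasureOnCompacts μ] (hU : IsLocallyClosed U)
    (hw : LocallyIntegrableOn w U μ) {Φ : E → F} (hΦ : Continuous Φ) (hB : ∀ q, ‖Φ q‖ ≤ B) :
    LocallyIntegrableOn (fun x => Φ (w x)) U μ := by
  rw [locallyIntegrableOn_iff hU]
  exact fun K hKU hK => IntegrableOn.of_bound hK.measure_lt_top
    (hΦ.comp_aestronglyMeasurable (hw.integrableOn_compact_subset hKU hK).aestronglyMeasurable) B
    (Eventually.of_forall fun x => hB _)

lemma locallyIntegrableOn_clm_apply_of_norm_le [NormedSpace ℝ E] [NormedSpace ℝ F]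
    (hU : IsLocallyClosed U) (hw : LocallyIntegrableOn w U μ) {g : X → E}
    (hg : LocallyIntegrableOn g U μ) {A : E → E →L[ℝ] F} (hA : Continuous A)
    (hB : ∀ q, ‖A q‖ ≤ B) : LocallyIntegrableOn (fun x => A (w x) (g x)) U μ := by
  rw [locallyIntegrableOn_iff hU]
  exact fun K hKU hK => memLp_one_iff_integrable.mp <| memLp_clm_apply
    (hA.comp_aestronglyMeasurable (hw.integrableOn_compact_subset hKU hK).aestronglyMeasurable)
    (fun x => hB _) (memLp_one_iff_integrable.mpr (hg.integrableOn_compact_subset hKU hK))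

end BoundedComposition

section ChainRule

variable {E F : Type*} [NormedAddCommGroup E] [NormedSpace ℝ E]
  [NormedAddCommGroup F] [NormedSpace ℝ F]

section Bounded

variable {Ω : Set Vec3} {w : Vec3 → E} {G : Fin 3 → Vec3 → E} {Φ : E → F} {R : ℝ}

lemma IsWeakGradient.comp [CompleteSpace E] (hΩ : IsOpen Ω) (hw : IsWeakGradient Ω w G)
    (hΦ : ContDiff ℝ 1 Φ) {B : ℝ} (hB : ∀ q, ‖Φ q‖ ≤ B) (hB' : ∀ q, ‖fderiv ℝ Φ q‖ ≤ B) :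
    IsWeakGradient Ω (fun x => Φ (w x)) (fun k x => fderiv ℝ Φ (w x) (G k x)) where
  locInt := locallyIntegrableOn_comp_of_norm_le hΩ.isLocallyClosed hw.locInt hΦ.continuous hB
  locInt_grad k := locallyIntegrableOn_clm_apply_of_norm_le hΩ.isLocallyClosed hw.locInt
    (hw.locInt_grad k) (hΦ.continuous_fderiv one_ne_zero) hB'
  byParts k φ hφ hc hs := by
    obtain ⟨χ, hχ, hχc, hχs, hχone⟩ := exists_contDiff_cutoff hΩ hc hs
    have hφ0 : ∀ x ∉ tsupport φ, φ x = 0 := fun _ => image_eq_zero_of_notMem_tsupport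
    have hφ0' : ∀ x ∉ tsupport φ, fderiv ℝ φ x = 0 := fun _ => fderiv_of_notMem_tsupport ℝ
    have hglobal := (hw.cutoff hΩ hχ hχc hχs).integral_fderiv_smul_comp
      (hw.integrable_cutoff hχ.continuous hχc hχs)
      (hw.integrable_grad_cutoff hΩ k (hχ.of_le (by simp)) hχc hχs) hΦ hB hB'
      (hφ.of_le (by simp)) hc
    rw [setIntegral_eq_integral_of_eq_zero_off hs fun x hx => by simp [hφ0' x hx],
      setIntegral_eq_integral_of_eq_zero_off hs fun x hx => by simp [hφ0 x hx]]
    convert hglobal using 1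
    · refine integral_congr_ae (Eventually.of_forall fun x => ?_)
      by_cases hx : x ∈ tsupport φ
      · simp [(hχone x hx).self_of_nhds]
      · simp [hφ0' x hx]
    · congr 1
      refine integral_congr_ae (Eventually.of_forall fun x => ?_)
      by_cases hx : x ∈ tsupport φ
      · simp [(hχone x hx).self_of_nhds, (hχone x hx).fderiv_eq]
      · simp [hφ0 x hx]

lemma IsWeakGradient.comp_of_bounded [FiniteDimensional ℝ E] (hΩ : IsOpen Ω)
    (hw : IsWeakGradient Ω w G) (hR : ∀ x, ‖w x‖ ≤ R) (hΦ : ContDiff ℝ 1 Φ) :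
    IsWeakGradient Ω (fun x => Φ (w x)) (fun k x => fderiv ℝ Φ (w x) (G k x)) := by
  have := FiniteDimensional.proper_real E
  obtain ⟨χ, hχ, hχc, -, hχone⟩ :=
    exists_contDiff_cutoff isOpen_univ (isCompact_closedBall (0 : E) R) (subset_univ _)
  have hΨ : ContDiff ℝ 1 (fun q => χ q • Φ q) := (hχ.of_le (by simp)).smul hΦ
  have hΨc : HasCompactSupport (fun q => χ q • Φ q) := hχc.smul_right
  obtain ⟨B, hB⟩ := hΨ.continuous.bounded_above_of_compact_support hΨc
  obtain ⟨B', hB'⟩ := (hΨ.continuous_fderiv one_ne_zero).bounded_above_of_compact_support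
    (hΨc.fderiv (𝕜 := ℝ))
  have heq (x : Vec3) : (fun q => χ q • Φ q) =ᶠ[𝓝 (w x)] Φ := by
    filter_upwards [hχone (w x) (mem_closedBall_zero_iff.mpr (hR x))] with q hq
    rw [hq, one_smul]
  have hcomp := hw.comp hΩ hΨ (B := max B B') (fun q => (hB q).trans (le_max_left _ _))
    fun q => (hB' q).trans (le_max_right _ _)
  simpa only [(heq _).self_of_nhds, (heq _).fderiv_eq] using hcomp

end Bounded

namespace MemH1

variable {Ω : Set Vec3} {w : Vec3 → E}

lemma comp_of_bounded [FiniteDimensional ℝ E] (hΩ : IsOpen Ω) (hfin : volume Ω ≠ ⊤)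
    (hw : MemH1 Ω w) {R : ℝ} (hR : ∀ x, ‖w x‖ ≤ R) {Φ : E → F} (hΦ : ContDiff ℝ 1 Φ) :
    MemH1 Ω (fun x => Φ (w x)) := by
  have := FiniteDimensional.proper_real E
  have : IsFiniteMeasure (volume.restrict Ω) := isFiniteMeasure_restrict.mpr hfin
  obtain ⟨hw2, G, hG, hG2⟩ := hw
  have hΦ' := hΦ.continuous_fderiv one_ne_zero
  obtain ⟨B, hB⟩ := exists_norm_comp_le hR hΦ.continuous
  obtain ⟨B', hB'⟩ := exists_norm_comp_le hR hΦ'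
  exact ⟨MemLp.of_bound (hΦ.continuous.comp_aestronglyMeasurable hw2.aestronglyMeasurable) B
    (Eventually.of_forall hB), _, hG.comp_of_bounded hΩ hR hΦ, fun k =>
    memLp_clm_apply (hΦ'.comp_aestronglyMeasurable hw2.aestronglyMeasurable) hB' (hG2 k)⟩

lemma isWeakGradient_weakGrad (hw : MemH1 Ω w) : IsWeakGradient Ω w (weakGrad Ω w) := by
  have h : ∃ G, IsWeakGradient Ω w G := hw.2.imp fun _ => And.left
  rw [weakGrad, dif_pos h]
  exact h.choose_spec

lemma memLp_weakGrad [CompleteSpace E] (hΩ : IsOpen Ω) (hw : MemH1 Ω w) (k : Fin 3) :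
    MemLp (weakGrad Ω w k) 2 (volume.restrict Ω) := by
  obtain ⟨G, hG, hG2⟩ := hw.2
  exact (memLp_congr_ae (hG.ae_eq hΩ hw.isWeakGradient_weakGrad k)).mp (hG2 k)

end MemH1

end ChainRule

/-! ### Bulk energy of Q-tensors -/

namespace QTensor

lemma mat_symm (q : QTensor) (i j : Fin 3) : q.mat i j = q.mat j i := q.2.1 i j

lemma trace_mat (q : QTensor) : q.mat.trace = 0 := q.2.2

lemma mat_smul (s : ℝ) (q : QTensor) : (s • q).mat = s • q.mat := rfl

lemma continuous_mat : Continuous mat := by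
  refine continuous_matrix fun i j => ?_
  change Continuous fun q : QTensor => q.1 (i, j)
  fun_prop

lemma trace_mat_sq (q : QTensor) : (q.mat ^ 2).trace = ‖q‖ ^ 2 := by
  rw [Submodule.coe_norm, EuclideanSpace.real_norm_sq_eq, Fintype.sum_prod_type]
  simp only [pow_two, Matrix.trace, Matrix.diag_apply, Matrix.mul_apply]
  refine Finset.sum_congr rfl fun i _ => Finset.sum_congr rfl fun j _ => ?_
  rw [q.mat_symm j i]
  rfl

end QTensor

lemma exists_trace_pow_eq_sum_pow {n : Type*} [Fintype n] [DecidableEq n] {A : Matrix n n ℝ}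
    (hA : A.IsHermitian) : ∃ v : n → ℝ, ∀ k : ℕ, (A ^ k).trace = ∑ i, v i ^ k := by
  refine ⟨hA.eigenvalues, fun k => ?_⟩
  conv_lhs => rw [hA.spectral_theorem, ← map_pow, Matrix.diagonal_pow]
  rw [Unitary.conjStarAlgAut_apply, Matrix.trace_mul_comm, ← mul_assoc]
  simp [Matrix.trace]

lemma six_mul_sum_cube_sq_le {x y z : ℝ} (h : x + y + z = 0) :
    6 * (x ^ 3 + y ^ 3 + z ^ 3) ^ 2 ≤ (x ^ 2 + y ^ 2 + z ^ 2) ^ 3 := by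
  obtain rfl : z = -x - y := by linarith
  have hdiscriminant : (x ^ 2 + y ^ 2 + (-x - y) ^ 2) ^ 3 - 6 * (x ^ 3 + y ^ 3 + (-x - y) ^ 3) ^ 2 =
      2 * ((x - y) * (x + 2 * y) * (2 * x + y)) ^ 2 := by ring
  exact sub_nonneg.mp (hdiscriminant ▸ by positivity)

lemma QTensor.six_mul_trace_mat_cube_sq_le (q : QTensor) :
    6 * (q.mat ^ 3).trace ^ 2 ≤ (‖q‖ ^ 2) ^ 3 := by
  obtain ⟨v, hv⟩ := exists_trace_pow_eq_sum_pow (A := q.mat) (by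
    ext i j
    simp [Matrix.conjTranspose_apply, q.mat_symm i j])
  have htrace := hv 1
  rw [pow_one, q.trace_mat] at htrace
  rw [← q.trace_mat_sq, hv, hv]
  simp only [Fin.sum_univ_three, pow_one] at htrace ⊢
  exact six_mul_sum_cube_sq_le htrace.symm

lemma continuous_bulkEnergy (a b c : ℝ) : Continuous (bulkEnergy a b c) := by
  have hsq : Continuous fun q : QTensor => (q.mat ^ 2).trace :=
    (QTensor.continuous_mat.pow 2).matrix_trace
  have hcube : Continuous fun q : QTensor => (q.mat ^ 3).trace :=
    (QTensor.continuous_mat.pow 3).matrix_trace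
  unfold bulkEnergy
  fun_prop

lemma uniaxialEnergy_le_bulkEnergy {a b c : ℝ} (hb : 0 ≤ b) {q : QTensor} {s : ℝ} (hs : 0 ≤ s)
    (hq : ‖q‖ ^ 2 = 2 / 3 * s ^ 2) : uniaxialEnergy a b c s ≤ bulkEnergy a b c q := by
  have hcube : (q.mat ^ 3).trace ≤ 2 / 9 * s ^ 3 := by
    have hbound := q.six_mul_trace_mat_cube_sq_le
    rw [hq] at hbound
    exact le_of_sq_le_sq (by linarith) (by positivity)
  rw [bulkEnergy, uniaxialEnergy, q.trace_mat_sq, hq]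
  linarith [mul_le_mul_of_nonneg_left hcube hb]

section Director

lemma mat_director (e : S2) : (director e).mat =
    Matrix.vecMulVec e.1 e.1 - (1 / 3 : ℝ) • (1 : Matrix (Fin 3) (Fin 3) ℝ) := by
  ext i j
  by_cases h : i = j <;>
    simp [QTensor.mat, director, Matrix.vecMulVec_apply, h]

lemma mat_director_sq (e : S2) :
    (director e).mat ^ 2 = (1 / 3 : ℝ) • (director e).mat + (2 / 9 : ℝ) • 1 := by
  have hdot : e.1.ofLp ⬝ᵥ e.1.ofLp = 1 := by
    simpa [dotProduct, ← pow_two] using (EuclideanSpace.real_norm_sq_eq e.1).symm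
  rw [mat_director, pow_two, sub_mul, mul_sub, mul_sub, Matrix.vecMulVec_mul_vecMulVec,
    hdot, one_smul]
  simp only [mul_smul_comm, smul_mul_assoc, mul_one, one_mul, smul_smul]
  module

lemma trace_mat_director_sq (e : S2) : ((director e).mat ^ 2).trace = 2 / 3 := by
  rw [mat_director_sq, Matrix.trace_add, Matrix.trace_smul, Matrix.trace_smul, QTensor.trace_mat,
    Matrix.trace_one, Fintype.card_fin]
  norm_num

lemma trace_mat_director_cube (e : S2) : ((director e).mat ^ 3).trace = 2 / 9 := by
  rw [pow_succ, mat_director_sq, add_mul, smul_mul_assoc, smul_mul_assoc, one_mul, ← pow_two,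
    Matrix.trace_add, Matrix.trace_smul, Matrix.trace_smul, QTensor.trace_mat,
    trace_mat_director_sq]
  norm_num

lemma norm_director_sq (e : S2) : ‖director e‖ ^ 2 = 2 / 3 := by
  rw [← QTensor.trace_mat_sq, trace_mat_director_sq]

lemma norm_smul_director_sq (s : ℝ) (e : S2) : ‖s • director e‖ ^ 2 = 2 / 3 * s ^ 2 := by
  rw [norm_smul, mul_pow, norm_director_sq, Real.norm_eq_abs, sq_abs, mul_comm]

lemma norm_director_le_one (e : S2) : ‖director e‖ ≤ 1 :=
  (sq_le_one_iff₀ (norm_nonneg _)).mp (by rw [norm_director_sq]; norm_num)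

lemma bulkEnergy_smul_director (a b c s : ℝ) (e : S2) :
    bulkEnergy a b c (s • director e) = uniaxialEnergy a b c s := by
  simp only [bulkEnergy, uniaxialEnergy, QTensor.mat_smul, smul_pow, Matrix.trace_smul,
    trace_mat_director_sq, trace_mat_director_cube, smul_eq_mul]
  ring

end Director

/-- The entries `q₁₁, q₂₂, q₁₂, q₁₃, q₂₃` as linear coordinates on the space of Q-tensors; they
determine its dimension. -/
def qCoordinates : QTensor ≃ₗ[ℝ] (Fin 5 → ℝ) where
  toFun q := ![q.1 (0, 0), q.1 (1, 1), q.1 (0, 1), q.1 (0, 2), q.1 (1, 2)]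
  map_add' p q := by ext i; fin_cases i <;> simp
  map_smul' r q := by ext i; fin_cases i <;> simp
  invFun x := ⟨WithLp.toLp 2 fun ij =>
      (!![x 0, x 2, x 3; x 2, x 1, x 4; x 3, x 4, -x 0 - x 1] : Matrix (Fin 3) (Fin 3) ℝ) ij.1 ij.2,
    by
      refine ⟨fun i j => ?_, ?_⟩
      · fin_cases i <;> fin_cases j <;> simp
      · simp [Fin.sum_univ_three]⟩
  left_inv q := by
    obtain ⟨q, hsymm, htrace⟩ := q
    simp only [Fin.sum_univ_three] at htrace
    ext ⟨i, j⟩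
    fin_cases i <;> fin_cases j <;>
      simp [hsymm 1 0, hsymm 2 0, hsymm 2 1]
    linarith
  right_inv x := by ext i; fin_cases i <;> simp

lemma finrank_qTensor : Module.finrank ℝ QTensor = 5 := by
  rw [qCoordinates.finrank_eq, Module.finrank_fin_fun]

/-! ### The uniaxial double well -/

section DoubleWell

/-- The square root `√c / 3 · s (s₊ - s)` of the uniaxial energy at `b ^ 2 = 27 a c`; it is
negative for `s` outside the interval between the wells `0` and `s₊`. -/
noncomputable def uniaxialRoot (a b c s : ℝ) : ℝ := √c / 3 * (s * (sPlus a b c - s))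

/-- The primitive of `2 / √3 * uniaxialRoot` that vanishes at `0`, so that its value at `s₊` is
the surface tension. -/
noncomputable def wellPrimitive (a b c s : ℝ) : ℝ :=
  2 / √3 * (√c / 3 * (sPlus a b c * s ^ 2 / 2 - s ^ 3 / 3))

variable {a b c : ℝ}

lemma sPlus_eq (hb : 0 ≤ b) (habc : b ^ 2 = 27 * a * c) : sPlus a b c = b / (3 * c) := by
  have hdiscriminant : b ^ 2 - 24 * a * c = (b / 3) ^ 2 := by linarith
  rw [sPlus, hdiscriminant, Real.sqrt_sq (by positivity), show b + b / 3 = 4 * (b / 3) by ring,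
    mul_div_mul_left _ _ four_ne_zero, div_div]

lemma sPlus_pos (hb : 0 < b) (hc : 0 < c) (habc : b ^ 2 = 27 * a * c) : 0 < sPlus a b c := by
  rw [sPlus_eq hb.le habc]
  positivity

lemma mul_sPlus (hb : 0 ≤ b) (hc : 0 < c) (habc : b ^ 2 = 27 * a * c) :
    3 * c * sPlus a b c = b := by
  rw [sPlus_eq hb habc, mul_div_cancel₀ _ (by positivity)]

lemma mul_sPlus_sq (hb : 0 ≤ b) (hc : 0 < c) (habc : b ^ 2 = 27 * a * c) :
    c * sPlus a b c ^ 2 = 3 * a := by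
  rw [sPlus_eq hb habc]
  field_simp
  linarith

lemma sqrt_mul_sPlus (hb : 0 < b) (hc : 0 < c) (habc : b ^ 2 = 27 * a * c) :
    √c * sPlus a b c = √3 * √a := by
  rw [← Real.sqrt_mul (by norm_num), ← mul_sPlus_sq hb.le hc habc, Real.sqrt_mul hc.le,
    Real.sqrt_sq (sPlus_pos hb hc habc).le]

lemma uniaxialEnergy_eq_sq (hb : 0 ≤ b) (hc : 0 < c) (habc : b ^ 2 = 27 * a * c) (s : ℝ) :
    uniaxialEnergy a b c s = uniaxialRoot a b c s ^ 2 := by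
  rw [uniaxialEnergy, uniaxialRoot, mul_pow, div_pow, Real.sq_sqrt hc.le]
  linear_combination (2 / 27 * s ^ 3) * mul_sPlus hb hc habc - s ^ 2 / 9 * mul_sPlus_sq hb hc habc

lemma sqrt_two_mul_uniaxialEnergy (hb : 0 ≤ b) (hc : 0 < c) (habc : b ^ 2 = 27 * a * c) (s : ℝ) :
    √(2 * uniaxialEnergy a b c s) = √2 * |uniaxialRoot a b c s| := by
  rw [uniaxialEnergy_eq_sq hb hc habc, Real.sqrt_mul zero_le_two, Real.sqrt_sq_eq_abs]

lemma uniaxialRoot_nonneg {s : ℝ} (hs : s ∈ Icc 0 (sPlus a b c)) : 0 ≤ uniaxialRoot a b c s :=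
  mul_nonneg (by positivity) (mul_nonneg hs.1 (sub_nonneg.mpr hs.2))

lemma continuous_uniaxialRoot : Continuous (uniaxialRoot a b c) := by
  unfold uniaxialRoot
  fun_prop

lemma hasDerivAt_wellPrimitive (s : ℝ) :
    HasDerivAt (wellPrimitive a b c) (2 / √3 * uniaxialRoot a b c s) s := by
  have hderiv := (((((hasDerivAt_pow (𝕜 := ℝ) 2 s).const_mul (sPlus a b c)).div_const 2).sub
    ((hasDerivAt_pow 3 s).div_const 3)).const_mul (√c / 3)).const_mul (2 / √3)
  refine hderiv.congr_deriv ?_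
  push_cast
  rw [uniaxialRoot]
  ring

lemma wellPrimitive_zero : wellPrimitive a b c 0 = 0 := by simp [wellPrimitive]

lemma integral_uniaxialRoot (s t : ℝ) :
    ∫ τ in s..t, 2 / √3 * uniaxialRoot a b c τ = wellPrimitive a b c t - wellPrimitive a b c s :=
  intervalIntegral.integral_eq_sub_of_hasDerivAt (fun x _ => hasDerivAt_wellPrimitive x)
    ((continuous_const.mul continuous_uniaxialRoot).intervalIntegrable _ _)

lemma surfaceTension_eq (hb : 0 < b) (hc : 0 < c) (habc : b ^ 2 = 27 * a * c) :
    surfaceTension a b c = wellPrimitive a b c (sPlus a b c) := by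
  have hprimitive := integral_uniaxialRoot (a := a) (b := b) (c := c) 0 (sPlus a b c)
  rw [wellPrimitive_zero, sub_zero] at hprimitive
  rw [surfaceTension, ← intervalIntegral.integral_const_mul, ← hprimitive]
  refine intervalIntegral.integral_congr fun τ hτ => ?_
  rw [uIcc_of_le (sPlus_pos hb hc habc).le] at hτ
  simp only [uniaxialEnergy_eq_sq hb.le hc habc, Real.sqrt_sq (uniaxialRoot_nonneg hτ)]

end DoubleWell

/-! ### The quasi-distance -/

section QuasiDistance

/-- The weighted speed of a curve of Q-tensors. -/
noncomputable def weightedSpeed (a b c : ℝ) (γ : ℝ → QTensor) (t : ℝ) : ℝ :=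
  √(2 * bulkEnergy a b c (γ t)) * ‖deriv γ t‖

/-- The weighted lengths of the admissible curves from the nematic manifold to `q`, so that their
infimum is `quasiDist a b c q`. -/
def lengthSet (a b c : ℝ) (q : QTensor) : Set ℝ :=
  {L | ∃ γ : ℝ → QTensor, (∃ K, LipschitzOnWith K γ (Icc 0 1)) ∧
    γ 0 ∈ nematic a b c ∧ γ 1 = q ∧ L = ∫ t in (0 : ℝ)..1, weightedSpeed a b c γ t}

/-- The curve that traverses `γ₁` in `[0, 1/2]` and `γ₂` in `[1/2, 1]`, at double speed; a sum of
Lipschitz curves, meaningful if `γ₁ 1 = γ₂ 0`. -/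
noncomputable def concatCurves (γ₁ γ₂ : ℝ → QTensor) (t : ℝ) : QTensor :=
  γ₁ (min (2 * t) 1) + (γ₂ (max (2 * t - 1) 0) - γ₂ 0)

variable {a b c : ℝ} {γ γ₁ γ₂ : ℝ → QTensor} {K K₁ K₂ : NNReal} {p q : QTensor} {L : ℝ}

lemma continuous_sqrt_two_mul_bulkEnergy : Continuous fun q => √(2 * bulkEnergy a b c q) :=
  Real.continuous_sqrt.comp (continuous_const.mul (continuous_bulkEnergy a b c))

lemma weightedSpeed_nonneg (γ : ℝ → QTensor) (t : ℝ) : 0 ≤ weightedSpeed a b c γ t :=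
  mul_nonneg (Real.sqrt_nonneg _) (norm_nonneg _)

lemma intervalIntegrable_weightedSpeed (hγ : LipschitzOnWith K γ (Icc 0 1)) :
    IntervalIntegrable (weightedSpeed a b c γ) volume 0 1 := by
  have hweight : ContinuousOn (fun t => √(2 * bulkEnergy a b c (γ t))) (Icc 0 1) :=
    continuous_sqrt_two_mul_bulkEnergy.comp_continuousOn hγ.continuousOn
  obtain ⟨B, hB⟩ := isCompact_Icc.exists_bound_of_continuousOn hweight
  rw [intervalIntegrable_iff_integrableOn_Ioo_of_le zero_le_one]
  refine IntegrableOn.of_bound (by simp) ?_ (B * K) ?_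
  · exact ((hweight.mono Ioo_subset_Icc_self).aestronglyMeasurable measurableSet_Ioo).mul
      (stronglyMeasurable_deriv γ).norm.aestronglyMeasurable
  · rw [ae_restrict_iff' measurableSet_Ioo]
    refine Eventually.of_forall fun t ht => ?_
    have ht' := Ioo_subset_Icc_self ht
    rw [weightedSpeed, norm_mul, norm_norm]
    exact mul_le_mul (hB t ht') (norm_deriv_le_of_lipschitzOn (Icc_mem_nhds ht.1 ht.2) hγ)
      (norm_nonneg _) ((norm_nonneg _).trans (hB t ht'))

lemma bddBelow_lengthSet (q : QTensor) : BddBelow (lengthSet a b c q) := by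
  refine ⟨0, ?_⟩
  rintro L ⟨γ, -, -, -, rfl⟩
  exact intervalIntegral.integral_nonneg zero_le_one fun t _ => weightedSpeed_nonneg γ t

lemma quasiDist_le_of_mem_lengthSet (hL : L ∈ lengthSet a b c q) : quasiDist a b c q ≤ L :=
  csInf_le (bddBelow_lengthSet q) hL

lemma abs_deriv_norm_le {E : Type*} [NormedAddCommGroup E] [NormedSpace ℝ E] {γ : ℝ → E} {t : ℝ}
    (hγ : DifferentiableAt ℝ γ t) (hnorm : DifferentiableAt ℝ (fun s => ‖γ s‖) t) :
    |deriv (fun s => ‖γ s‖) t| ≤ ‖deriv γ t‖ := by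
  have hslope := (hasDerivAt_iff_tendsto_slope.mp hγ.hasDerivAt).norm
  have hslope_norm := (hasDerivAt_iff_tendsto_slope.mp hnorm.hasDerivAt).norm
  refine le_of_tendsto_of_tendsto' hslope_norm hslope fun s => ?_
  rw [slope_def_module, slope_def_module, norm_smul, norm_smul]
  exact mul_le_mul_of_nonneg_left (abs_norm_sub_norm_le _ _) (norm_nonneg _)

lemma sqrt_three_halves_mul_norm_smul_director {s : ℝ} (hs : 0 ≤ s) (e : S2) :
    √(3 / 2) * ‖s • director e‖ = s := by
  refine (sq_eq_sq₀ (by positivity) hs).mp ?_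
  rw [mul_pow, norm_smul_director_sq, Real.sq_sqrt (by norm_num)]
  ring

lemma two_div_sqrt_three_mul_sqrt_three_halves : 2 / √3 * √(3 / 2) = √2 := by
  rw [Real.sqrt_div (by norm_num)]
  field_simp
  norm_num

lemma sqrt_two_mul_abs_uniaxialRoot_le (hb : 0 ≤ b) (hc : 0 < c) (habc : b ^ 2 = 27 * a * c)
    (q : QTensor) : √2 * |uniaxialRoot a b c (√(3 / 2) * ‖q‖)| ≤ √(2 * bulkEnergy a b c q) := by
  rw [← sqrt_two_mul_uniaxialEnergy hb hc habc]
  refine Real.sqrt_le_sqrt (mul_le_mul_of_nonneg_left ?_ zero_le_two)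
  refine uniaxialEnergy_le_bulkEnergy hb (by positivity) ?_
  rw [mul_pow, Real.sq_sqrt (by norm_num)]
  ring

lemma neg_deriv_wellPrimitive_norm_le (hb : 0 ≤ b) (hc : 0 < c) (habc : b ^ 2 = 27 * a * c)
    {t : ℝ} (hγ : DifferentiableAt ℝ γ t) (hnorm : DifferentiableAt ℝ (fun s => ‖γ s‖) t) :
    -deriv (fun s => wellPrimitive a b c (√(3 / 2) * ‖γ s‖)) t ≤ weightedSpeed a b c γ t := by
  set u := uniaxialRoot a b c (√(3 / 2) * ‖γ t‖)
  have hderiv : deriv (fun s => wellPrimitive a b c (√(3 / 2) * ‖γ s‖)) t =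
      √2 * u * deriv (fun s => ‖γ s‖) t := by
    refine ((hasDerivAt_wellPrimitive _).comp t (hnorm.hasDerivAt.const_mul _)).deriv.trans ?_
    rw [← two_div_sqrt_three_mul_sqrt_three_halves]
    ring
  calc -deriv (fun s => wellPrimitive a b c (√(3 / 2) * ‖γ s‖)) t
      ≤ |√2 * u * deriv (fun s => ‖γ s‖) t| := hderiv ▸ neg_le_abs _
    _ = √2 * |u| * |deriv (fun s => ‖γ s‖) t| := by
      rw [abs_mul, abs_mul, abs_of_nonneg (Real.sqrt_nonneg 2)]
    _ ≤ weightedSpeed a b c γ t :=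
      mul_le_mul (sqrt_two_mul_abs_uniaxialRoot_le hb hc habc (γ t)) (abs_deriv_norm_le hγ hnorm)
        (abs_nonneg _) (Real.sqrt_nonneg _)

lemma absolutelyContinuousOnInterval_wellPrimitive_comp {r : ℝ → ℝ} {s t : ℝ}
    (hr : AbsolutelyContinuousOnInterval r s t) :
    AbsolutelyContinuousOnInterval (fun τ => wellPrimitive a b c (r τ)) s t := by
  have hsq := hr.mul hr
  have hpolynomial := (hsq.const_mul (2 / √3 * (√c / 3) * sPlus a b c / 2)).sub
    ((hsq.mul hr).const_mul (2 / √3 * (√c / 3) / 3))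
  refine (congrArg (AbsolutelyContinuousOnInterval · s t) (funext fun τ => ?_)).mp hpolynomial
  simp only [wellPrimitive, Pi.sub_apply, Pi.mul_apply]
  ring

-- Since `√(3/2) ‖s • director e‖ = s`, the bound is attained along radial segments.
lemma wellPrimitive_sub_le_integral_weightedSpeed (hb : 0 ≤ b) (hc : 0 < c)
    (habc : b ^ 2 = 27 * a * c) (hγ : LipschitzOnWith K γ (Icc 0 1)) :
    wellPrimitive a b c (√(3 / 2) * ‖γ 0‖) - wellPrimitive a b c (√(3 / 2) * ‖γ 1‖) ≤
      ∫ t in (0 : ℝ)..1, weightedSpeed a b c γ t := by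
  have hIcc : uIcc (0 : ℝ) 1 = Icc 0 1 := uIcc_of_le zero_le_one
  have hnorm : AbsolutelyContinuousOnInterval (fun t => ‖γ t‖) 0 1 :=
    LipschitzOnWith.absolutelyContinuousOnInterval
      (hIcc ▸ lipschitzWith_one_norm.comp_lipschitzOnWith hγ)
  have hac := absolutelyContinuousOnInterval_wellPrimitive_comp (a := a) (b := b) (c := c)
    (hnorm.const_mul √(3 / 2))
  have hle : ∀ᵐ t ∂volume.restrict (Icc (0 : ℝ) 1),
      -deriv (fun s => wellPrimitive a b c (√(3 / 2) * ‖γ s‖)) t ≤ weightedSpeed a b c γ t := by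
    rw [ae_restrict_iff' measurableSet_Icc]
    filter_upwards [hnorm.ae_differentiableAt, Measure.ae_ne volume (0 : ℝ),
      Measure.ae_ne volume (1 : ℝ), hγ.ae_differentiableWithinAt_of_mem] with t hnorm_t h0 h1 hγt ht
    have hnhds : Icc (0 : ℝ) 1 ∈ 𝓝 t :=
      Icc_mem_nhds (lt_of_le_of_ne ht.1 h0.symm) (lt_of_le_of_ne ht.2 h1)
    exact neg_deriv_wellPrimitive_norm_le hb hc habc ((hγt ht).differentiableAt hnhds)
      (hnorm_t (hIcc ▸ ht))
  have hintegral := intervalIntegral.integral_mono_ae_restrict zero_le_one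
    hac.intervalIntegrable_deriv.neg (intervalIntegrable_weightedSpeed hγ) hle
  simp only [Pi.neg_apply, intervalIntegral.integral_neg, hac.integral_deriv_eq_sub] at hintegral
  linarith

lemma wellPrimitive_sub_le_of_mem_lengthSet (hb : 0 < b) (hc : 0 < c)
    (habc : b ^ 2 = 27 * a * c) (hL : L ∈ lengthSet a b c q) :
    wellPrimitive a b c (sPlus a b c) - wellPrimitive a b c (√(3 / 2) * ‖q‖) ≤ L := by
  obtain ⟨γ, ⟨K, hγ⟩, ⟨e, he⟩, h1, rfl⟩ := hL
  have hle := wellPrimitive_sub_le_integral_weightedSpeed hb.le hc habc hγ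
  rwa [he, h1, sqrt_three_halves_mul_norm_smul_director (sPlus_pos hb hc habc).le] at hle

lemma weightedSpeed_lineMap (p q : QTensor) (t : ℝ) :
    weightedSpeed a b c (AffineMap.lineMap p q) t =
      √(2 * bulkEnergy a b c (AffineMap.lineMap p q t)) * ‖q - p‖ := by
  rw [weightedSpeed, AffineMap.hasDerivAt_lineMap.deriv]

lemma lipschitzOnWith_lineMap (p q : QTensor) (s : Set ℝ) :
    LipschitzOnWith (nndist p q) (AffineMap.lineMap p q : ℝ → QTensor) s :=
  (lipschitzWith_lineMap p q).lipschitzOnWith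

lemma integral_weightedSpeed_lineMap_smul_director (hb : 0 ≤ b) (hc : 0 < c)
    (habc : b ^ 2 = 27 * a * c) {s t : ℝ} (hs : s ∈ Icc 0 (sPlus a b c))
    (ht : t ∈ Icc 0 (sPlus a b c)) (hst : s ≤ t) (e : S2) :
    ∫ τ in (0 : ℝ)..1, weightedSpeed a b c (AffineMap.lineMap (t • director e) (s • director e)) τ =
      wellPrimitive a b c t - wellPrimitive a b c s := by
  have hnorm : √2 * ‖s • director e - t • director e‖ = 2 / √3 * (t - s) := by
    rw [norm_sub_rev, ← sub_smul, ← two_div_sqrt_three_mul_sqrt_three_halves, mul_assoc,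
      sqrt_three_halves_mul_norm_smul_director (sub_nonneg.mpr hst)]
  have hderiv : ∀ τ ∈ uIcc (0 : ℝ) 1,
      HasDerivAt (fun τ => -wellPrimitive a b c (AffineMap.lineMap t s τ))
        (weightedSpeed a b c (AffineMap.lineMap (t • director e) (s • director e)) τ) τ := by
    intro τ hτ
    rw [uIcc_of_le zero_le_one] at hτ
    have horder : AffineMap.lineMap t s τ ∈ Icc 0 (sPlus a b c) :=
      (convex_Icc _ _).lineMap_mem ht hs hτ
    refine ((hasDerivAt_wellPrimitive _).comp τ AffineMap.hasDerivAt_lineMap).neg.congr_deriv ?_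
    rw [weightedSpeed_lineMap, show AffineMap.lineMap (t • director e) (s • director e) τ =
        AffineMap.lineMap t s τ • director e by simp [AffineMap.lineMap_apply, add_smul, sub_smul,
          mul_smul, smul_sub], bulkEnergy_smul_director, sqrt_two_mul_uniaxialEnergy hb hc habc,
      abs_of_nonneg (uniaxialRoot_nonneg horder)]
    linear_combination -uniaxialRoot a b c (AffineMap.lineMap t s τ) * hnorm
  rw [intervalIntegral.integral_eq_sub_of_hasDerivAt hderiv
    (intervalIntegrable_weightedSpeed (lipschitzOnWith_lineMap _ _ _))]
  simp only [AffineMap.lineMap_apply_one, AffineMap.lineMap_apply_zero]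
  ring

lemma mem_lengthSet_smul_director (hb : 0 < b) (hc : 0 < c) (habc : b ^ 2 = 27 * a * c)
    {s : ℝ} (hs : s ∈ Icc 0 (sPlus a b c)) (e : S2) :
    wellPrimitive a b c (sPlus a b c) - wellPrimitive a b c s ∈
      lengthSet a b c (s • director e) :=
  ⟨AffineMap.lineMap (sPlus a b c • director e) (s • director e),
    ⟨_, lipschitzOnWith_lineMap _ _ _⟩, ⟨e, AffineMap.lineMap_apply_zero _ _⟩,
    AffineMap.lineMap_apply_one _ _, (integral_weightedSpeed_lineMap_smul_director hb.le hc habc hs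
      ⟨(sPlus_pos hb hc habc).le, le_rfl⟩ hs.2 e).symm⟩

lemma lipschitzOnWith_concatCurves (h₁ : LipschitzOnWith K₁ γ₁ (Icc 0 1))
    (h₂ : LipschitzOnWith K₂ γ₂ (Icc 0 1)) :
    LipschitzOnWith (K₁ * 2 + K₂ * 2) (concatCurves γ₁ γ₂) (Icc 0 1) := by
  have hdouble : LipschitzWith 2 (fun t : ℝ => 2 * t) :=
    LipschitzWith.of_dist_le_mul fun x y => by
      rw [Real.dist_eq, Real.dist_eq, ← mul_sub, abs_mul]
      simp
  have hshift : LipschitzWith 2 (fun t : ℝ => 2 * t - 1) := by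
    simpa using hdouble.sub (LipschitzWith.const (1 : ℝ))
  refine (h₁.comp (hdouble.min_const 1).lipschitzOnWith fun t ht => ?_).add
    (LipschitzOnWith.of_dist_le_mul fun x hx y hy => ?_)
  · exact ⟨le_min (mul_nonneg zero_le_two ht.1) zero_le_one, min_le_right _ _⟩
  · rw [dist_sub_right]
    refine (h₂.comp (hshift.max_const 0).lipschitzOnWith fun t ht => ?_).dist_le_mul x hx y hy
    exact ⟨le_max_right _ _, max_le (by linarith [ht.2]) zero_le_one⟩

lemma weightedSpeed_comp_mul_sub {k : ℝ} (hk : 0 ≤ k) (γ : ℝ → QTensor) (d t : ℝ) :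
    weightedSpeed a b c (fun s => γ (k * s - d)) t = k * weightedSpeed a b c γ (k * t - d) := by
  have hderiv : deriv (fun s => γ (k * s - d)) t = k • deriv γ (k * t - d) := by
    rw [deriv_comp_mul_left k (fun s => γ (s - d)) t, deriv_comp_sub_const]
  rw [weightedSpeed, hderiv, norm_smul, Real.norm_of_nonneg hk, weightedSpeed]
  ring

lemma integral_weightedSpeed_comp_mul_sub {k : ℝ} (hk : 0 < k) (γ : ℝ → QTensor) (d s t : ℝ) :
    ∫ τ in s..t, weightedSpeed a b c (fun s => γ (k * s - d)) τ =
      ∫ τ in k * s - d..k * t - d, weightedSpeed a b c γ τ := by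
  simp_rw [weightedSpeed_comp_mul_sub hk.le]
  rw [intervalIntegral.integral_const_mul, intervalIntegral.integral_comp_mul_sub _ hk.ne',
    smul_eq_mul, mul_inv_cancel_left₀ hk.ne']

lemma integral_weightedSpeed_congr {s t : ℝ} (hst : s ≤ t) (h : EqOn γ₁ γ₂ (Ioo s t)) :
    ∫ τ in s..t, weightedSpeed a b c γ₁ τ = ∫ τ in s..t, weightedSpeed a b c γ₂ τ := by
  rw [intervalIntegral.integral_of_le hst, intervalIntegral.integral_of_le hst,
    integral_Ioc_eq_integral_Ioo, integral_Ioc_eq_integral_Ioo]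
  refine setIntegral_congr_fun measurableSet_Ioo fun τ hτ => ?_
  have hev : γ₁ =ᶠ[𝓝 τ] γ₂ := h.eventuallyEq_of_mem (Ioo_mem_nhds hτ.1 hτ.2)
  simp only [weightedSpeed, hev.deriv_eq, h hτ]

lemma integral_weightedSpeed_concatCurves (h₁ : LipschitzOnWith K₁ γ₁ (Icc 0 1))
    (h₂ : LipschitzOnWith K₂ γ₂ (Icc 0 1)) (h : γ₁ 1 = γ₂ 0) :
    ∫ t in (0 : ℝ)..1, weightedSpeed a b c (concatCurves γ₁ γ₂) t =
      (∫ t in (0 : ℝ)..1, weightedSpeed a b c γ₁ t) +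
        ∫ t in (0 : ℝ)..1, weightedSpeed a b c γ₂ t := by
  have hint := intervalIntegrable_weightedSpeed (a := a) (b := b) (c := c)
    (lipschitzOnWith_concatCurves h₁ h₂)
  have hhalf : (1 / 2 : ℝ) ∈ uIcc (0 : ℝ) 1 := by
    rw [uIcc_of_le zero_le_one]
    constructor <;> norm_num
  have hfst : EqOn (concatCurves γ₁ γ₂) (fun t => γ₁ (2 * t - 0)) (Ioo 0 (1 / 2)) := by
    intro t ht
    rw [concatCurves, min_eq_left (by linarith [ht.2]), max_eq_right (by linarith [ht.2])]
    simp
  have hsnd : EqOn (concatCurves γ₁ γ₂) (fun t => γ₂ (2 * t - 1)) (Ioo (1 / 2) 1) := by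
    intro t ht
    rw [concatCurves, min_eq_right (by linarith [ht.1]), max_eq_left (by linarith [ht.1]), h]
    simp
  rw [← intervalIntegral.integral_add_adjacent_intervals
      (hint.mono_set (uIcc_subset_uIcc left_mem_uIcc hhalf))
      (hint.mono_set (uIcc_subset_uIcc hhalf right_mem_uIcc)),
    integral_weightedSpeed_congr (by norm_num) hfst,
    integral_weightedSpeed_congr (by norm_num) hsnd,
    integral_weightedSpeed_comp_mul_sub two_pos, integral_weightedSpeed_comp_mul_sub two_pos]
  norm_num

lemma add_segment_mem_lengthSet (hL : L ∈ lengthSet a b c p) (q : QTensor) :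
    L + ∫ t in (0 : ℝ)..1, weightedSpeed a b c (AffineMap.lineMap p q) t ∈ lengthSet a b c q := by
  obtain ⟨γ, ⟨K, hγ⟩, h0, rfl, rfl⟩ := hL
  have hsegment := lipschitzOnWith_lineMap (γ 1) q (Icc 0 1)
  refine ⟨concatCurves γ (AffineMap.lineMap (γ 1) q),
    ⟨_, lipschitzOnWith_concatCurves hγ hsegment⟩, ?_, ?_,
    (integral_weightedSpeed_concatCurves hγ hsegment (AffineMap.lineMap_apply_zero _ _).symm).symm⟩
  · simpa [concatCurves] using h0
  · norm_num [concatCurves]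

lemma lengthSet_nonempty (hb : 0 < b) (hc : 0 < c) (habc : b ^ 2 = 27 * a * c) (q : QTensor) :
    (lengthSet a b c q).Nonempty :=
  ⟨_, add_segment_mem_lengthSet (mem_lengthSet_smul_director hb hc habc
    ⟨(sPlus_pos hb hc habc).le, le_rfl⟩ ⟨EuclideanSpace.single 0 1, by simp⟩) q⟩

lemma quasiDist_smul_director (hb : 0 < b) (hc : 0 < c) (habc : b ^ 2 = 27 * a * c)
    {s : ℝ} (hs : s ∈ Icc 0 (sPlus a b c)) (e : S2) :
    quasiDist a b c (s • director e) =
      wellPrimitive a b c (sPlus a b c) - wellPrimitive a b c s := by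
  refine le_antisymm (quasiDist_le_of_mem_lengthSet (mem_lengthSet_smul_director hb hc habc hs e))
    (le_csInf (lengthSet_nonempty hb hc habc _) fun L hL => ?_)
  have hle := wellPrimitive_sub_le_of_mem_lengthSet hb hc habc hL
  rwa [sqrt_three_halves_mul_norm_smul_director hs.1] at hle

lemma quasiDist_le_add_integral_lineMap (hb : 0 < b) (hc : 0 < c) (habc : b ^ 2 = 27 * a * c)
    (p q : QTensor) : quasiDist a b c q ≤
      quasiDist a b c p + ∫ t in (0 : ℝ)..1, weightedSpeed a b c (AffineMap.lineMap p q) t := by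
  rw [← sub_le_iff_le_add]
  refine le_csInf (lengthSet_nonempty hb hc habc p) fun L hL => ?_
  rw [sub_le_iff_le_add]
  exact quasiDist_le_of_mem_lengthSet (add_segment_mem_lengthSet hL q)

lemma exists_lipschitzOnWith_quasiDist (hb : 0 < b) (hc : 0 < c) (habc : b ^ 2 = 27 * a * c)
    (R : ℝ) : ∃ B, LipschitzOnWith B (quasiDist a b c) (closedBall 0 R) := by
  obtain ⟨B, hB⟩ := (isCompact_closedBall (0 : QTensor) R).exists_bound_of_continuousOn
    (continuous_sqrt_two_mul_bulkEnergy (a := a) (b := b) (c := c)).continuousOn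
  refine ⟨B.toNNReal, LipschitzOnWith.of_le_add_mul _ fun q hq p hp => ?_⟩
  refine (quasiDist_le_add_integral_lineMap hb hc habc p q).trans ?_
  gcongr
  calc ∫ t in (0 : ℝ)..1, weightedSpeed a b c (AffineMap.lineMap p q) t
      ≤ ∫ _ in (0 : ℝ)..1, B.toNNReal * dist q p := by
        refine intervalIntegral.integral_mono_on zero_le_one
          (intervalIntegrable_weightedSpeed (lipschitzOnWith_lineMap p q _)) (by simp)
          fun t ht => ?_
        rw [weightedSpeed_lineMap, dist_eq_norm]
        have hmem := (convex_closedBall (0 : QTensor) R).lineMap_mem hp hq ht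
        gcongr
        exact (le_abs_self _).trans ((hB _ hmem).trans (Real.le_coe_toNNReal B))
    _ = B.toNNReal * dist q p := by simp

lemma continuous_quasiDist (hb : 0 < b) (hc : 0 < c) (habc : b ^ 2 = 27 * a * c) :
    Continuous (quasiDist a b c) := by
  rw [continuous_iff_continuousAt]
  intro p
  obtain ⟨B, hB⟩ := exists_lipschitzOnWith_quasiDist hb hc habc (‖p‖ + 1)
  refine hB.continuousOn.continuousAt (mem_of_superset (ball_mem_nhds p one_pos) fun q hq => ?_)
  rw [mem_closedBall_zero_iff]
  have hq' : ‖q - p‖ < 1 := mem_ball_iff_norm.mp hq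
  linarith [norm_le_norm_add_norm_sub' q p]

end QuasiDistance

section Mollification

/-- Mollifiers on the space of Q-tensors, not necessarily isotropic. -/
structure IsMollifier (η : QTensor → ℝ) : Prop where
  smooth : ContDiff ℝ ∞ η
  nonneg : ∀ q, 0 ≤ η q
  support : tsupport η ⊆ ball 0 1
  mass : ∫ q, η q ∂qMeasure = 1

variable {a b c ε : ℝ} {η : QTensor → ℝ}

instance isAddHaarMeasure_qMeasure : qMeasure.IsAddHaarMeasure := by
  unfold qMeasure
  infer_instance

lemma IsIsotropicMollifier.isMollifier {η : QTensor → ℝ} (hη : IsIsotropicMollifier η) :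
    IsMollifier η :=
  ⟨hη.smooth, hη.nonneg, hη.support, hη.mass⟩

namespace IsMollifier

lemma support_scaled (hη : IsMollifier η) (hε : 0 < ε) :
    Function.support (fun q => (ε ^ 20)⁻¹ * η ((ε ^ 4)⁻¹ • q)) ⊆ ball 0 (ε ^ 4) := by
  intro q hq
  have hne : η ((ε ^ 4)⁻¹ • q) ≠ 0 := right_ne_zero_of_mul hq
  have hmem := hη.support (subset_tsupport η hne)
  rw [mem_ball_zero_iff, norm_smul, norm_inv, Real.norm_of_nonneg (by positivity),
    inv_mul_lt_iff₀ (by positivity), mul_one] at hmem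
  exact mem_ball_zero_iff.mpr hmem

-- `ε ^ 20 = (ε ^ 4) ^ 5` is the volume factor of the scaling in dimension five.
lemma integral_scaled (hη : IsMollifier η) (hε : 0 < ε) :
    ∫ q, (ε ^ 20)⁻¹ * η ((ε ^ 4)⁻¹ • q) ∂qMeasure = 1 := by
  rw [integral_const_mul, Measure.integral_comp_inv_smul_of_nonneg _ _ (by positivity),
    finrank_qTensor, hη.mass, ← pow_mul]
  simp [hε.ne']

lemma contDiff_quasiDistReg (hη : IsMollifier η) (hb : 0 < b) (hc : 0 < c)
    (habc : b ^ 2 = 27 * a * c) (hε : 0 < ε) : ContDiff ℝ ∞ (quasiDistReg a b c η ε) := by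
  have hcompact : HasCompactSupport (fun q => (ε ^ 20)⁻¹ * η ((ε ^ 4)⁻¹ • q)) :=
    HasCompactSupport.of_support_subset_isCompact (isCompact_closedBall (0 : QTensor) (ε ^ 4))
      ((hη.support_scaled hε).trans ball_subset_closedBall)
  have hsmooth : ContDiff ℝ ∞ (fun q => (ε ^ 20)⁻¹ * η ((ε ^ 4)⁻¹ • q)) :=
    contDiff_const.mul (hη.smooth.comp (contDiff_const_smul _))
  exact hcompact.contDiff_convolution_left (n := ⊤) _ hsmooth
    (continuous_quasiDist hb hc habc).locallyIntegrable

end IsMollifier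

lemma exists_abs_quasiDistReg_sub_quasiDist_le (hb : 0 < b) (hc : 0 < c)
    (habc : b ^ 2 = 27 * a * c) (R : ℝ) :
    ∃ B, 0 ≤ B ∧ ∀ η, IsMollifier η → ∀ ε, 0 < ε → ε ≤ 1 → ∀ q ∈ closedBall (0 : QTensor) R,
      |quasiDistReg a b c η ε q - quasiDist a b c q| ≤ B * ε := by
  obtain ⟨B, hB⟩ := exists_lipschitzOnWith_quasiDist hb hc habc (R + 1)
  refine ⟨B, B.2, fun η hη ε hε hε1 q hq => ?_⟩
  have hε4 : ε ^ 4 ≤ ε := pow_le_of_le_one hε.le hε1 four_ne_zero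
  rw [mem_closedBall_zero_iff] at hq
  have hclose : ∀ p ∈ ball q (ε ^ 4), dist (quasiDist a b c p) (quasiDist a b c q) ≤ B * ε := by
    intro p hp
    have hpq : ‖p - q‖ < ε ^ 4 := mem_ball_iff_norm.mp hp
    have hpR : ‖p‖ ≤ R + 1 := by linarith [norm_le_norm_add_norm_sub' p q]
    refine (hB.dist_le_mul p (mem_closedBall_zero_iff.mpr hpR) q
      (mem_closedBall_zero_iff.mpr (by linarith))).trans ?_
    gcongr
    exact (mem_ball.mp hp).le.trans hε4
  exact dist_convolution_le (by positivity) (hη.support_scaled hε)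
    (fun p => mul_nonneg (by positivity) (hη.nonneg _)) (hη.integral_scaled hε)
    (continuous_quasiDist hb hc habc).aestronglyMeasurable hclose

end Mollification

/-! ### Geometry of the interface -/

section Geometry

section DistanceToFrontier

variable {E : Type*} [NormedAddCommGroup E] [NormedSpace ℝ E] {U : Set E} {x y : E}

lemma segment_inter_frontier_nonempty (hx : x ∈ U) (hy : y ∉ U) :
    (segment ℝ x y ∩ frontier U).Nonempty := by
  by_contra hempty
  have hcover : segment ℝ x y ⊆ interior U ∪ interior Uᶜ := by
    rw [← compl_frontier_eq_union_interior]
    exact fun z hz hzU => hempty ⟨z, hz, hzU⟩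
  obtain ⟨z, -, hzU, hzU'⟩ := (convex_segment (𝕜 := ℝ) x y).isPreconnected _ _ isOpen_interior
    isOpen_interior hcover
    ⟨x, left_mem_segment ℝ x y, (hcover (left_mem_segment ℝ x y)).resolve_right fun h =>
      interior_subset h hx⟩
    ⟨y, right_mem_segment ℝ x y, (hcover (right_mem_segment ℝ x y)).resolve_left fun h =>
      hy (interior_subset h)⟩
  exact interior_subset hzU' (interior_subset hzU)

lemma infDist_frontier_le_dist (hx : x ∈ U) (hy : y ∉ U) : infDist x (frontier U) ≤ dist x y := by
  obtain ⟨z, hz, hzU⟩ := segment_inter_frontier_nonempty hx hy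
  calc infDist x (frontier U) ≤ dist x z := infDist_le_dist_of_mem hzU
    _ ≤ dist x z + dist z y := le_add_of_nonneg_right dist_nonneg
    _ = dist x y := dist_add_dist_of_mem_segment hz

variable {S : Set E}

lemma fderiv_infDist_apply_le (hy : y ∈ S) (hxy : infDist x S = dist x y)
    (hd : DifferentiableAt ℝ (fun z => infDist z S) x) :
    fderiv ℝ (fun z => infDist z S) x (y - x) ≤ -‖y - x‖ := by
  refine le_of_tendsto (hd.hasFDerivAt.hasLineDerivAt (y - x)).tendsto_slope_zero_right ?_
  filter_upwards [Ioo_mem_nhdsGT (zero_lt_one (α := ℝ))] with t ht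
  have hpoint : x + t • (y - x) - y = (1 - t) • (x - y) := by module
  have hle : infDist (x + t • (y - x)) S ≤ (1 - t) * ‖y - x‖ := by
    refine (infDist_le_dist_of_mem hy).trans_eq ?_
    rw [dist_eq_norm, hpoint, norm_smul, Real.norm_of_nonneg (by linarith [ht.2]), norm_sub_rev]
  rw [smul_eq_mul, inv_mul_le_iff₀ ht.1, hxy, dist_eq_norm, norm_sub_rev]
  linarith

lemma norm_fderiv_infDist [ProperSpace E] (hS : IsClosed S) (hne : S.Nonempty) (hx : x ∉ S)
    (hd : DifferentiableAt ℝ (fun z => infDist z S) x) :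
    ‖fderiv ℝ (fun z => infDist z S) x‖ = 1 := by
  refine le_antisymm ?_ ?_
  · simpa using norm_fderiv_le_of_lipschitz ℝ (lipschitz_infDist_pt S) (x₀ := x)
  · obtain ⟨y, hy, hxy⟩ := hS.exists_infDist_eq_dist hne x
    have hpos : 0 < ‖y - x‖ := norm_pos_iff.mpr (sub_ne_zero.mpr (ne_of_mem_of_not_mem hy hx))
    have hle : 1 * ‖y - x‖ ≤ ‖fderiv ℝ (fun z => infDist z S) x‖ * ‖y - x‖ := by
      rw [one_mul]
      exact (le_neg_of_le_neg (fderiv_infDist_apply_le hy hxy hd)).trans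
        ((neg_le_abs _).trans ((fderiv ℝ (fun z => infDist z S) x).le_opNorm (y - x)))
    exact le_of_mul_le_mul_right hle hpos

end DistanceToFrontier

section Gradient

variable {ι : Type*} [Fintype ι] [DecidableEq ι]

lemma gradient_apply (f : EuclideanSpace ℝ ι → ℝ) (x : EuclideanSpace ℝ ι) (k : ι) :
    gradient f x k = fderiv ℝ f x (EuclideanSpace.single k 1) := by
  rw [← inner_gradient_left, EuclideanSpace.inner_single_right]
  simp

lemma sum_fderiv_sq (f : EuclideanSpace ℝ ι → ℝ) (x : EuclideanSpace ℝ ι) :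
    ∑ k, fderiv ℝ f x (EuclideanSpace.single k 1) ^ 2 = ‖fderiv ℝ f x‖ ^ 2 := by
  have hnorm : ‖gradient f x‖ = ‖fderiv ℝ f x‖ := LinearIsometryEquiv.norm_map _ _
  simp only [← hnorm, EuclideanSpace.real_norm_sq_eq, gradient_apply]

end Gradient

section SmoothBoundary

variable {E : Type*} [NormedAddCommGroup E] [NormedSpace ℝ E]

lemma eventually_lt_of_hasFDerivAt_neg {f : E → ℝ} {f' : E →L[ℝ] ℝ} {x v : E}
    (hf : HasFDerivAt f f' x) (hv : f' v < 0) : ∀ᶠ t in 𝓝[>] (0 : ℝ), f (x + t • v) < f x := by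
  filter_upwards [(hf.hasLineDerivAt v).tendsto_slope_zero_right.eventually_lt_const hv,
    self_mem_nhdsWithin] with t ht (ht0 : 0 < t)
  rw [smul_eq_mul, inv_mul_lt_iff₀ ht0] at ht
  linarith

lemma exists_apply_neg {f' : E →L[ℝ] ℝ} (hf' : f' ≠ 0) : ∃ v, f' v < 0 := by
  by_contra! hnonneg
  refine hf' (ContinuousLinearMap.ext fun v => le_antisymm ?_ (hnonneg v))
  simpa using hnonneg (-v)

lemma notMem_closure_of_neg {X : Type*} [TopologicalSpace X] {U V : Set X} {ρ : X → ℝ} {p : X}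
    (hV : IsOpen V) (hρ : ContinuousOn ρ V) (hUV : U ∩ V = {x ∈ V | 0 < ρ x}) (hp : p ∈ V)
    (hneg : ρ p < 0) : p ∉ closure U := by
  intro hcl
  have hnear : ∀ᶠ z in 𝓝 p, z ∈ V ∧ ρ z < 0 :=
    (hV.eventually_mem hp).and
      ((hρ.continuousAt (hV.mem_nhds hp)).eventually (gt_mem_nhds hneg))
  obtain ⟨z, hzU, hzV, hz⟩ := ((mem_closure_iff_frequently.mp hcl).and_eventually hnear).exists
  have hpos : z ∈ {x ∈ V | 0 < ρ x} := hUV ▸ ⟨hzU, hzV⟩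
  exact hpos.2.not_gt hz

lemma mem_closure_diff_closure {U V W : Set E} {ρ : E → ℝ} {p : E} (hV : IsOpen V)
    (hρ : ContinuousOn ρ V) (hdiff : DifferentiableAt ℝ ρ p) (hρ' : fderiv ℝ ρ p ≠ 0)
    (hUV : U ∩ V = {x ∈ V | 0 < ρ x}) (hpV : p ∈ V) (hpU : p ∉ U) (hpW : W ∈ 𝓝 p) :
    p ∈ closure (W \ closure U) := by
  have hρp : ρ p ≤ 0 := by
    by_contra! hpos
    have hp : p ∈ U ∩ V := hUV ▸ ⟨hpV, hpos⟩
    exact hpU hp.1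
  obtain ⟨v, hv⟩ := exists_apply_neg hρ'
  have hray : Tendsto (fun t : ℝ => p + t • v) (𝓝[>] 0) (𝓝 p) :=
    tendsto_nhdsWithin_of_tendsto_nhds (Continuous.tendsto' (by fun_prop) _ _ (by simp))
  refine mem_closure_of_tendsto hray ?_
  filter_upwards [eventually_lt_of_hasFDerivAt_neg hdiff.hasFDerivAt hv,
    hray.eventually (hV.mem_nhds hpV), hray.eventually hpW] with t ht htV htW
  exact ⟨htW, notMem_closure_of_neg hV hρ hUV htV (ht.trans_le hρp)⟩

lemma HasSmoothBoundary.frontier_subset_closure_outerPhase {Ω Ωp : Set Vec3}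
    (h : HasSmoothBoundary Ωp) (hΩp : IsOpen Ωp) (hΩ : IsOpen Ω) (hsub : closure Ωp ⊆ Ω) :
    frontier Ωp ⊆ closure (outerPhase Ω Ωp) := by
  intro p hp
  obtain ⟨V, ρ, hV, hpV, hρ, hρ', hUV⟩ := h p hp
  rw [hΩp.frontier_eq] at hp
  exact mem_closure_diff_closure hV hρ.continuousOn
    ((hρ.contDiffAt (hV.mem_nhds hpV)).differentiableAt (by simp)) hρ' hUV hpV hp.2
    (hΩ.mem_nhds (hsub hp.1))

end SmoothBoundary

/-- An interface with a smooth signed distance: `Ω` is a bounded open set, `Ω⁺` a nonempty open set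
compactly contained in it whose boundary is accessible from the outer phase, and `δ` a tubular width
of that boundary. -/
structure IsTubularInterface (Ω Ωp : Set Vec3) (δ : ℝ) : Prop where
  isOpen : IsOpen Ω
  bounded : Bornology.IsBounded Ω
  isOpen_plus : IsOpen Ωp
  nonempty_plus : Ωp.Nonempty
  closure_plus : closure Ωp ⊆ Ω
  frontier_subset : frontier Ωp ⊆ closure (outerPhase Ω Ωp)
  δ_pos : 0 < δ
  dist_boundary : ∀ x ∈ frontier Ωp, ∀ y ∈ frontier Ω, 3 * δ ≤ dist x y
  smooth_sdist : ContDiffOn ℝ ∞ (sdist Ω Ωp) (tube Ω Ωp (3 * δ))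

variable {Ω Ωp : Set Vec3} {δ : ℝ} {x : Vec3}

lemma IsInterface.isTubularInterface (h : IsInterface Ω Ωp δ) : IsTubularInterface Ω Ωp δ where
  isOpen := h.isOpen
  bounded := h.bounded
  isOpen_plus := h.isOpen_plus
  nonempty_plus := by
    have := h.simplyConnected_plus
    exact nonempty_coe_sort.mp inferInstance
  closure_plus := h.closure_plus
  frontier_subset :=
    h.smooth_plus.frontier_subset_closure_outerPhase h.isOpen_plus h.isOpen h.closure_plus
  δ_pos := h.δ_pos
  dist_boundary := h.dist_boundary
  smooth_sdist := h.smooth_sdist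

namespace IsTubularInterface

lemma frontier_nonempty (h : IsTubularInterface Ω Ωp δ) : (frontier Ωp).Nonempty := by
  refine nonempty_frontier_iff.mpr ⟨h.nonempty_plus, fun huniv => ?_⟩
  exact NormedSpace.unbounded_univ ℝ Vec3
    (huniv ▸ h.bounded.subset (subset_closure.trans h.closure_plus))

lemma isOpen_outer (h : IsTubularInterface Ω Ωp δ) : IsOpen (outerPhase Ω Ωp) :=
  h.isOpen.sdiff isClosed_closure

lemma isOpen_tube (h : IsTubularInterface Ω Ωp δ) (r : ℝ) : IsOpen (tube Ω Ωp r) :=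
  h.isOpen.inter (isOpen_lt (continuous_infDist_pt _) continuous_const)

lemma sdist_of_mem_outer (h : IsTubularInterface Ω Ωp δ) (hx : x ∈ outerPhase Ω Ωp) :
    sdist Ω Ωp x = -infDist x (frontier Ωp) := by
  rw [sdist, if_pos hx, neg_inj]
  refine le_antisymm ?_ ((le_infDist h.nonempty_plus).mpr fun y hy => ?_)
  · rw [← infDist_closure]
    exact infDist_le_infDist_of_subset frontier_subset_closure h.frontier_nonempty
  · rw [← frontier_compl]
    exact infDist_frontier_le_dist (fun hx' => hx.2 (subset_closure hx')) (not_not.mpr hy)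

lemma sdist_of_mem_closure (h : IsTubularInterface Ω Ωp δ) (hx : x ∈ closure Ωp) :
    sdist Ω Ωp x = infDist x (frontier Ωp) := by
  rw [sdist, if_neg fun hx' => hx'.2 hx]
  have hne : (outerPhase Ω Ωp).Nonempty :=
    closure_nonempty_iff.mp (h.frontier_nonempty.mono h.frontier_subset)
  refine le_antisymm ?_ ((le_infDist hne).mpr fun y hy => ?_)
  · rw [← infDist_closure]
    exact infDist_le_infDist_of_subset h.frontier_subset h.frontier_nonempty
  · exact (infDist_le_infDist_of_subset frontier_closure_subset
      ((segment_inter_frontier_nonempty hx hy.2).mono inter_subset_right)).trans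
      (infDist_frontier_le_dist hx hy.2)

lemma abs_sdist (h : IsTubularInterface Ω Ωp δ) (hx : x ∈ Ω) :
    |sdist Ω Ωp x| = infDist x (frontier Ωp) := by
  by_cases hc : x ∈ closure Ωp
  · rw [h.sdist_of_mem_closure hc, abs_of_nonneg infDist_nonneg]
  · rw [h.sdist_of_mem_outer ⟨hx, hc⟩, abs_neg, abs_of_nonneg infDist_nonneg]

lemma mem_tube_iff (h : IsTubularInterface Ω Ωp δ) (hx : x ∈ Ω) (r : ℝ) :
    x ∈ tube Ω Ωp r ↔ |sdist Ω Ωp x| < r := by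
  rw [h.abs_sdist hx]
  exact and_iff_right hx

lemma infDist_frontier_pos (h : IsTubularInterface Ω Ωp δ) (hx : x ∉ frontier Ωp) :
    0 < infDist x (frontier Ωp) :=
  (isClosed_frontier.notMem_iff_infDist_pos h.frontier_nonempty).mp hx

lemma sdist_pos (h : IsTubularInterface Ω Ωp δ) (hx : x ∈ Ωp) : 0 < sdist Ω Ωp x := by
  rw [h.sdist_of_mem_closure (subset_closure hx)]
  refine h.infDist_frontier_pos fun hxf => ?_
  exact (h.isOpen_plus.frontier_eq ▸ hxf).2 hx

lemma sdist_neg (h : IsTubularInterface Ω Ωp δ) (hx : x ∈ outerPhase Ω Ωp) :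
    sdist Ω Ωp x < 0 := by
  rw [h.sdist_of_mem_outer hx, neg_lt_zero]
  exact h.infDist_frontier_pos fun hxf => hx.2 (frontier_subset_closure hxf)

lemma sdist_eq_zero (h : IsTubularInterface Ω Ωp δ) (hx : x ∈ frontier Ωp) :
    sdist Ω Ωp x = 0 := by
  rw [h.sdist_of_mem_closure (frontier_subset_closure hx), infDist_zero_of_mem hx]

lemma trichotomy (h : IsTubularInterface Ω Ωp δ) (hx : x ∈ Ω) :
    x ∈ Ωp ∨ x ∈ frontier Ωp ∨ x ∈ outerPhase Ω Ωp := by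
  rw [h.isOpen_plus.frontier_eq]
  by_cases hp : x ∈ Ωp
  · exact .inl hp
  · by_cases hc : x ∈ closure Ωp
    · exact .inr (.inl ⟨hc, hp⟩)
    · exact .inr (.inr ⟨hx, hc⟩)

lemma mem_plus_iff (h : IsTubularInterface Ω Ωp δ) (hx : x ∈ Ω) :
    x ∈ Ωp ↔ 0 < sdist Ω Ωp x := by
  refine ⟨h.sdist_pos, fun hpos => ?_⟩
  rcases h.trichotomy hx with hp | hf | ho
  · exact hp
  · exact absurd (h.sdist_eq_zero hf) hpos.ne'
  · exact absurd (h.sdist_neg ho) hpos.not_gt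

lemma mem_outer_iff (h : IsTubularInterface Ω Ωp δ) (hx : x ∈ Ω) :
    x ∈ outerPhase Ω Ωp ↔ sdist Ω Ωp x < 0 := by
  refine ⟨h.sdist_neg, fun hneg => ?_⟩
  rcases h.trichotomy hx with hp | hf | ho
  · exact absurd (h.sdist_pos hp) hneg.not_gt
  · exact absurd (h.sdist_eq_zero hf) hneg.ne
  · exact ho

lemma contDiffAt_sdist (h : IsTubularInterface Ω Ωp δ) (hx : x ∈ tube Ω Ωp (3 * δ)) :
    ContDiffAt ℝ ∞ (sdist Ω Ωp) x :=
  h.smooth_sdist.contDiffAt ((h.isOpen_tube _).mem_nhds hx)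

lemma eventually_sdist_eq (h : IsTubularInterface Ω Ωp δ) (hx : x ∈ Ω) (hxf : x ∉ frontier Ωp) :
    (sdist Ω Ωp =ᶠ[𝓝 x] fun y => infDist y (frontier Ωp)) ∨
      sdist Ω Ωp =ᶠ[𝓝 x] fun y => -infDist y (frontier Ωp) := by
  rcases h.trichotomy hx with hp | hf | ho
  · left
    filter_upwards [h.isOpen_plus.mem_nhds hp] with y hy
    exact h.sdist_of_mem_closure (subset_closure hy)
  · exact absurd hf hxf
  · right
    filter_upwards [h.isOpen_outer.mem_nhds ho] with y hy
    exact h.sdist_of_mem_outer hy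

lemma continuousAt_sdist (h : IsTubularInterface Ω Ωp δ) (hx : x ∈ Ω) :
    ContinuousAt (sdist Ω Ωp) x := by
  by_cases hf : x ∈ frontier Ωp
  · refine (h.contDiffAt_sdist ?_).continuousAt
    rw [h.mem_tube_iff hx, h.sdist_eq_zero hf]
    simpa using h.δ_pos
  · have hc : ContinuousAt (fun y => infDist y (frontier Ωp)) x :=
      (continuous_infDist_pt _).continuousAt
    rcases h.eventually_sdist_eq hx hf with he | he
    · exact hc.congr he.symm
    · exact hc.neg.congr he.symm

lemma norm_fderiv_sdist_of_notMem_frontier (h : IsTubularInterface Ω Ωp δ)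
    (hx : x ∈ tube Ω Ωp (3 * δ)) (hxf : x ∉ frontier Ωp) : ‖fderiv ℝ (sdist Ω Ωp) x‖ = 1 := by
  have hd := (h.contDiffAt_sdist hx).differentiableAt (by simp)
  rcases h.eventually_sdist_eq hx.1 hxf with he | he
  · rw [he.fderiv_eq]
    exact norm_fderiv_infDist isClosed_frontier h.frontier_nonempty hxf
      (hd.congr_of_eventuallyEq he.symm)
  · have hneg : (fun y => infDist y (frontier Ωp)) =ᶠ[𝓝 x] fun y => -sdist Ω Ωp y := by
      filter_upwards [he] with y hy
      rw [hy, neg_neg]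
    rw [he.fderiv_eq, fderiv_fun_neg, norm_neg]
    exact norm_fderiv_infDist isClosed_frontier h.frontier_nonempty hxf
      (hd.neg.congr_of_eventuallyEq hneg)

lemma norm_fderiv_sdist (h : IsTubularInterface Ω Ωp δ) (hx : x ∈ tube Ω Ωp (3 * δ)) :
    ‖fderiv ℝ (sdist Ω Ωp) x‖ = 1 := by
  by_cases hf : x ∈ frontier Ωp
  · by_contra hne
    -- by continuity of the gradient, the identity fails at nearby points of the outer phase
    have hc : ContinuousAt (fun y => ‖fderiv ℝ (sdist Ω Ωp) y‖) x :=
      ((h.contDiffAt_sdist hx).fderiv_right (m := 0) (by simp)).continuousAt.norm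
    have hnear := (hc.eventually_ne hne).and ((h.isOpen_tube (3 * δ)).mem_nhds hx)
    obtain ⟨y, hy, hyne, hyt⟩ :=
      ((mem_closure_iff_frequently.mp (h.frontier_subset hf)).and_eventually hnear).exists
    exact hyne (h.norm_fderiv_sdist_of_notMem_frontier hyt fun hyf =>
      hy.2 (frontier_subset_closure hyf))
  · exact h.norm_fderiv_sdist_of_notMem_frontier hx hf

lemma sum_fderiv_sdist_sq (h : IsTubularInterface Ω Ωp δ) (hx : x ∈ tube Ω Ωp (3 * δ)) :
    ∑ k, fderiv ℝ (sdist Ω Ωp) x (EuclideanSpace.single k 1) ^ 2 = 1 := by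
  rw [sum_fderiv_sq, h.norm_fderiv_sdist hx, one_pow]

lemma mem_tube_of_abs_sdist_le (h : IsTubularInterface Ω Ωp δ) (hx : x ∈ Ω)
    (hd : |sdist Ω Ωp x| ≤ δ) : x ∈ tube Ω Ωp (3 * δ) :=
  (h.mem_tube_iff hx _).mpr (by linarith [h.δ_pos])

variable {f : ℝ → ℝ}

lemma contDiffAt_comp_sdist (h : IsTubularInterface Ω Ωp δ) (hf : ContDiff ℝ ∞ f)
    (hconst : ∀ r, δ < |r| → f =ᶠ[𝓝 r] fun _ => f r) (hx : x ∈ Ω) :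
    ContDiffAt ℝ ∞ (fun y => f (sdist Ω Ωp y)) x := by
  rcases lt_or_ge δ |sdist Ω Ωp x| with hfar | hnear
  · exact contDiffAt_const.congr_of_eventuallyEq
      ((h.continuousAt_sdist hx).eventually (hconst _ hfar))
  · exact hf.contDiffAt.comp x (h.contDiffAt_sdist (h.mem_tube_of_abs_sdist_le hx hnear))

lemma fderiv_comp_sdist (h : IsTubularInterface Ω Ωp δ) (hf : Differentiable ℝ f)
    (hconst : ∀ r, δ < |r| → f =ᶠ[𝓝 r] fun _ => f r) (hx : x ∈ Ω) :
    fderiv ℝ (fun y => f (sdist Ω Ωp y)) x =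
      deriv f (sdist Ω Ωp x) • fderiv ℝ (sdist Ω Ωp) x := by
  rcases lt_or_ge δ |sdist Ω Ωp x| with hfar | hnear
  · have he : (fun y => f (sdist Ω Ωp y)) =ᶠ[𝓝 x] fun _ => f (sdist Ω Ωp x) :=
      (h.continuousAt_sdist hx).eventually (hconst _ hfar)
    rw [he.fderiv_eq, (hconst _ hfar).deriv_eq, deriv_const, zero_smul, fderiv_fun_const,
      Pi.zero_apply]
  · have hs := (h.contDiffAt_sdist (h.mem_tube_of_abs_sdist_le hx hnear)).differentiableAt
      (by simp)
    exact ((hf _).hasDerivAt.comp_hasFDerivAt x hs.hasFDerivAt).fderiv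

lemma isCompact_closed_tube (h : IsTubularInterface Ω Ωp δ) :
    IsCompact {x ∈ Ω | infDist x (frontier Ωp) ≤ δ} := by
  have hclosed : {x ∈ Ω | infDist x (frontier Ωp) ≤ δ} =
      closure Ω ∩ {x | infDist x (frontier Ωp) ≤ δ} := by
    refine Subset.antisymm (inter_subset_inter_left _ subset_closure) fun x hx => ⟨?_, hx.2⟩
    by_contra hxΩ
    have hxf : x ∈ frontier Ω := h.isOpen.frontier_eq ▸ ⟨hx.1, hxΩ⟩
    have hfar : 3 * δ ≤ infDist x (frontier Ωp) :=
      (le_infDist h.frontier_nonempty).mpr fun y hy => dist_comm x y ▸ h.dist_boundary y hy x hxf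
    have hnear : infDist x (frontier Ωp) ≤ δ := hx.2
    linarith [h.δ_pos]
  rw [hclosed]
  exact h.bounded.isCompact_closure.inter_right
    (isClosed_le (continuous_infDist_pt _) continuous_const)

end IsTubularInterface

variable {φ : ℝ → ℝ}

lemma calibration_apply (x : Vec3) (k : Fin 3) : calibration Ω Ωp δ φ x k =
    -(φ (sdist Ω Ωp x / δ) * fderiv ℝ (sdist Ω Ωp) x (EuclideanSpace.single k 1)) := by
  rw [← gradient_apply]
  simp [calibration]

namespace IsTubularInterface

lemma tsupport_indicator_calibration_subset (h : IsTubularInterface Ω Ωp δ)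
    (hφ : ∀ r, 1 ≤ |r| → φ r = 0) (k : Fin 3) :
    tsupport (Ω.indicator fun x => calibration Ω Ωp δ φ x k) ⊆
      {x ∈ Ω | infDist x (frontier Ωp) ≤ δ} := by
  refine closure_minimal (fun x hx => ?_) h.isCompact_closed_tube.isClosed
  obtain ⟨hxΩ, hne⟩ := indicator_apply_ne_zero.mp hx
  refine ⟨hxΩ, ?_⟩
  by_contra! hfar
  refine hne ?_
  simp only
  rw [calibration_apply, hφ, zero_mul, neg_zero]
  rw [abs_div, abs_of_pos h.δ_pos, one_le_div h.δ_pos, h.abs_sdist hxΩ]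
  exact hfar.le

lemma hasCompactSupport_indicator_calibration (h : IsTubularInterface Ω Ωp δ)
    (hφ : ∀ r, 1 ≤ |r| → φ r = 0) (k : Fin 3) :
    HasCompactSupport (Ω.indicator fun x => calibration Ω Ωp δ φ x k) :=
  h.isCompact_closed_tube.of_isClosed_subset (isClosed_tsupport _)
    (h.tsupport_indicator_calibration_subset hφ k)

lemma contDiff_indicator_calibration (h : IsTubularInterface Ω Ωp δ) (hφ : ContDiff ℝ ∞ φ)
    (hφ' : ∀ r, 1 ≤ |r| → φ r = 0) (k : Fin 3) :
    ContDiff ℝ ∞ (Ω.indicator fun x => calibration Ω Ωp δ φ x k) := by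
  refine contDiff_iff_contDiffAt.mpr fun x => ?_
  by_cases hx : x ∈ tsupport (Ω.indicator fun x => calibration Ω Ωp δ φ x k)
  swap
  · exact contDiffAt_const.congr_of_eventuallyEq (notMem_tsupport_iff_eventuallyEq.mp hx)
  obtain ⟨hxΩ, hxδ⟩ := h.tsupport_indicator_calibration_subset hφ' k hx
  have hs : ContDiffAt ℝ ∞ (sdist Ω Ωp) x :=
    h.contDiffAt_sdist (h.mem_tube_of_abs_sdist_le hxΩ ((h.abs_sdist hxΩ).trans_le hxδ))
  have hsmooth : ContDiffAt ℝ ∞ (fun x => -(φ (sdist Ω Ωp x / δ) *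
      fderiv ℝ (sdist Ω Ωp) x (EuclideanSpace.single k 1))) x :=
    ((hφ.contDiffAt.comp x (hs.div_const δ)).mul
      ((hs.fderiv_right (m := ∞) (by simp)).clm_apply contDiffAt_const)).neg
  refine hsmooth.congr_of_eventuallyEq ?_
  filter_upwards [h.isOpen.mem_nhds hxΩ] with y hy
  rw [indicator_of_mem hy, calibration_apply]

end IsTubularInterface

end Geometry

/-! ### The transition layer -/

section TransitionLayer

/-- The decay rate of the transition layer of width `ε` at distance `|r|` from the interface. -/
noncomputable def layerDecay (a ε r : ℝ) : ℝ := Real.exp (-(√a * |r| / ε))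

/-- The Heaviside function, with value `0` at `0`: the sharp-interface limit of the layer. -/
noncomputable def heaviside (r : ℝ) : ℝ := (Ioi 0).indicator 1 r

/-- The order parameter of the initial datum as a function of the signed distance `r`. -/
noncomputable def layerProfile (a b c δ : ℝ) (ζ : ℝ → ℝ) (ε r : ℝ) : ℝ :=
  ζ (r / δ) * profile a b c (r / ε) + (1 - ζ (r / δ)) * (sPlus a b c * heaviside r)

/-- The density `ε |∇Q|² / 2 + F(Q) / ε - ξ · ∇(d^F ∘ Q)` for `Q = s (e ⊗ e - I / 3)` with constant
`e` and calibration `ξ = -κ ∇d_Γ`, as a function of `s` and of its normal derivative `s'`. -/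
noncomputable def calibratedDensity (a b c ε κ s s' : ℝ) : ℝ :=
  ε / 3 * s' ^ 2 + 1 / ε * uniaxialRoot a b c s ^ 2 -
    κ * (2 / √3 * uniaxialRoot a b c s * s')

variable {a b c δ ε r : ℝ} {ζ φ : ℝ → ℝ}

lemma layerDecay_nonneg : 0 ≤ layerDecay a ε r := Real.exp_nonneg _

lemma layerDecay_le_one (hε : 0 < ε) : layerDecay a ε r ≤ 1 := by
  rw [layerDecay, Real.exp_le_one_iff, neg_nonpos]
  positivity

lemma layerDecay_sq_le (hε : 0 < ε) : layerDecay a ε r ^ 2 ≤ layerDecay a ε r :=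
  pow_le_of_le_one layerDecay_nonneg (layerDecay_le_one hε) two_ne_zero

lemma abs_mul_layerDecay_le (ha : 0 < a) (hε : 0 < ε) : |r| * layerDecay a ε r ≤ ε / √a := by
  have hexp : √a * |r| / ε ≤ Real.exp (√a * |r| / ε) := by
    linarith [Real.add_one_le_exp (√a * |r| / ε)]
  rw [layerDecay, Real.exp_neg, ← div_eq_mul_inv, div_le_iff₀ (Real.exp_pos _)]
  have := Real.sqrt_pos.mpr ha
  calc |r| = ε / √a * (√a * |r| / ε) := by field_simp
    _ ≤ ε / √a * Real.exp (√a * |r| / ε) := by gcongr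

lemma sq_mul_layerDecay_le (ha : 0 < a) (hε : 0 < ε) :
    r ^ 2 * layerDecay a ε r ≤ 2 * ε ^ 2 / a := by
  have hrate : 0 ≤ √a * |r| / ε := by positivity
  have hexp : (√a * |r| / ε) ^ 2 / 2 ≤ Real.exp (√a * |r| / ε) := by
    linarith [Real.quadratic_le_exp_of_nonneg hrate]
  rw [layerDecay, Real.exp_neg, ← div_eq_mul_inv, div_le_iff₀ (Real.exp_pos _)]
  calc r ^ 2 = 2 * ε ^ 2 / a * ((√a * |r| / ε) ^ 2 / 2) := by
        rw [div_pow, mul_pow, Real.sq_sqrt ha.le, sq_abs]; field_simp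
    _ ≤ 2 * ε ^ 2 / a * Real.exp (√a * |r| / ε) := by gcongr

lemma heaviside_of_pos (hr : 0 < r) : heaviside r = 1 := indicator_of_mem hr 1

lemma heaviside_of_nonpos (hr : r ≤ 0) : heaviside r = 0 := indicator_of_notMem hr.not_gt 1

lemma heaviside_eventuallyEq (hr : r ≠ 0) : heaviside =ᶠ[𝓝 r] fun _ => heaviside r := by
  rcases lt_or_gt_of_ne hr with hneg | hpos
  · filter_upwards [Iio_mem_nhds hneg] with s hs
    rw [heaviside_of_nonpos (le_of_lt hs), heaviside_of_nonpos hneg.le]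
  · filter_upwards [Ioi_mem_nhds hpos] with s hs
    rw [heaviside_of_pos hs, heaviside_of_pos hpos]

lemma mul_heaviside_mem (hp : 0 ≤ sPlus a b c) (r : ℝ) :
    sPlus a b c * heaviside r ∈ Icc 0 (sPlus a b c) := by
  rcases lt_or_ge 0 r with hr | hr
  · rw [heaviside_of_pos hr, mul_one]
    exact right_mem_Icc.mpr hp
  · rw [heaviside_of_nonpos hr, mul_zero]
    exact left_mem_Icc.mpr hp

lemma sigmoid_neg_le_exp_neg (x : ℝ) : (-x).sigmoid ≤ Real.exp (-x) := by
  rw [← Real.sigmoid_mul_rexp_neg]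
  exact mul_le_of_le_one_left (Real.exp_nonneg _) (Real.sigmoid_le_one x)

lemma abs_sigmoid_sub_heaviside_le (x : ℝ) : |x.sigmoid - heaviside x| ≤ Real.exp (-|x|) := by
  rcases lt_or_ge 0 x with hx | hx
  · rw [heaviside_of_pos hx, abs_sub_comm, ← Real.sigmoid_neg, abs_of_pos hx,
      abs_of_nonneg (Real.sigmoid_nonneg _)]
    exact sigmoid_neg_le_exp_neg x
  · rw [heaviside_of_nonpos hx, sub_zero, abs_of_nonneg (Real.sigmoid_nonneg _),
      abs_of_nonpos hx]
    simpa using sigmoid_neg_le_exp_neg (-x)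

lemma profile_eq_sigmoid (z : ℝ) : profile a b c z = sPlus a b c * (√a * z).sigmoid := by
  have hsq : Real.exp (-(√a * z)) = Real.exp (-(√a / 2 * z)) * Real.exp (-(√a / 2 * z)) := by
    rw [← Real.exp_add]; congr 1; ring
  have hinv : Real.exp (√a / 2 * z) = (Real.exp (-(√a / 2 * z)))⁻¹ := by
    rw [Real.exp_neg, inv_inv]
  have := Real.exp_pos (-(√a / 2 * z))
  rw [profile, Real.tanh_eq_sinh_div_cosh, Real.sinh_eq, Real.cosh_eq, Real.sigmoid_def, hsq, hinv]
  field_simp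
  ring

lemma contDiff_profile : ContDiff ℝ ∞ (profile a b c) := by
  rw [funext (profile_eq_sigmoid (a := a) (b := b) (c := c))]
  exact contDiff_const.mul
    ((contDiff_sigmoid.of_le (by simp)).comp (contDiff_const.mul contDiff_id))

lemma profile_mem (hp : 0 ≤ sPlus a b c) (z : ℝ) : profile a b c z ∈ Icc 0 (sPlus a b c) := by
  rw [profile_eq_sigmoid]
  exact ⟨mul_nonneg hp (Real.sigmoid_nonneg _), mul_le_of_le_one_right hp (Real.sigmoid_le_one _)⟩

lemma hasDerivAt_profile (hb : 0 < b) (hc : 0 < c) (habc : b ^ 2 = 27 * a * c) (z : ℝ) :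
    HasDerivAt (profile a b c) (√3 * uniaxialRoot a b c (profile a b c z)) z := by
  have hderiv := ((Real.hasDerivAt_sigmoid (√a * z)).comp z
    ((hasDerivAt_id z).const_mul √a)).const_mul (sPlus a b c)
  rw [funext (profile_eq_sigmoid (a := a) (b := b) (c := c))]
  refine hderiv.congr_deriv ?_
  have hthree : √3 * √3 = 3 := Real.mul_self_sqrt (by norm_num)
  rw [uniaxialRoot]
  linear_combination
    (-(√3 / 3) * sPlus a b c * (√a * z).sigmoid * (1 - (√a * z).sigmoid)) *
        sqrt_mul_sPlus hb hc habc -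
      √a / 3 * sPlus a b c * (√a * z).sigmoid * (1 - (√a * z).sigmoid) * hthree

lemma hasDerivAt_scaled_profile (hb : 0 < b) (hc : 0 < c) (habc : b ^ 2 = 27 * a * c) (ε r : ℝ) :
    HasDerivAt (fun r => profile a b c (r / ε))
      (√3 * uniaxialRoot a b c (profile a b c (r / ε)) / ε) r := by
  have hcomp := (hasDerivAt_profile hb hc habc (r / ε)).comp r ((hasDerivAt_id r).div_const ε)
  exact hcomp.congr_deriv (mul_one_div _ _)

lemma abs_profile_sub_le (hp : 0 ≤ sPlus a b c) (ha : 0 < a) (hε : 0 < ε) (r : ℝ) :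
    |profile a b c (r / ε) - sPlus a b c * heaviside r| ≤ sPlus a b c * layerDecay a ε r := by
  have hstep : heaviside (√a * (r / ε)) = heaviside r := by
    have hiff : √a * (r / ε) ∈ Ioi (0 : ℝ) ↔ r ∈ Ioi (0 : ℝ) := by
      simp only [mem_Ioi, mul_pos_iff_of_pos_left (Real.sqrt_pos.mpr ha),
        div_pos_iff_of_pos_right hε]
    simp only [heaviside, indicator_apply, hiff, Pi.one_apply]
  have hdecay : Real.exp (-|√a * (r / ε)|) = layerDecay a ε r := by
    rw [layerDecay, abs_mul, abs_div, abs_of_pos hε, abs_of_nonneg (Real.sqrt_nonneg a),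
      mul_div_assoc]
  rw [profile_eq_sigmoid, ← mul_sub, abs_mul, abs_of_nonneg hp, ← hstep, ← hdecay]
  exact mul_le_mul_of_nonneg_left (abs_sigmoid_sub_heaviside_le _) hp

lemma uniaxialRoot_le {s : ℝ} (hs : s ∈ Icc 0 (sPlus a b c)) (r : ℝ) :
    uniaxialRoot a b c s ≤ √c / 3 * sPlus a b c * |s - sPlus a b c * heaviside r| := by
  rw [uniaxialRoot, mul_assoc]
  refine mul_le_mul_of_nonneg_left ?_ (by positivity)
  rcases lt_or_ge 0 r with hr | hr
  · rw [heaviside_of_pos hr, mul_one, abs_sub_comm, abs_of_nonneg (sub_nonneg.mpr hs.2)]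
    exact mul_le_mul_of_nonneg_right hs.2 (sub_nonneg.mpr hs.2)
  · rw [heaviside_of_nonpos hr, mul_zero, sub_zero, abs_of_nonneg hs.1, mul_comm]
    exact mul_le_mul_of_nonneg_right (sub_le_self _ hs.1) hs.1

lemma uniaxialRoot_le_mul_layerDecay {s : ℝ} (hs : s ∈ Icc 0 (sPlus a b c))
    (hd : |s - sPlus a b c * heaviside r| ≤ sPlus a b c * layerDecay a ε r) :
    uniaxialRoot a b c s ≤ √c / 3 * sPlus a b c ^ 2 * layerDecay a ε r := by
  have hp : 0 ≤ sPlus a b c := hs.1.trans hs.2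
  calc uniaxialRoot a b c s ≤ √c / 3 * sPlus a b c * |s - sPlus a b c * heaviside r| :=
        uniaxialRoot_le hs r
    _ ≤ √c / 3 * sPlus a b c * (sPlus a b c * layerDecay a ε r) := by gcongr
    _ = √c / 3 * sPlus a b c ^ 2 * layerDecay a ε r := by ring

lemma layerProfile_mem (hp : 0 ≤ sPlus a b c) (hζ : IsInitialCutoff ζ) (r : ℝ) :
    layerProfile a b c δ ζ ε r ∈ Icc 0 (sPlus a b c) := by
  have hmem := convex_Icc 0 (sPlus a b c) (profile_mem hp (r / ε)) (mul_heaviside_mem hp r)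
    (hζ.range (r / δ)).1 (sub_nonneg.mpr (hζ.range (r / δ)).2) (by ring)
  simpa only [layerProfile, smul_eq_mul] using hmem

lemma abs_layerProfile_sub_le (hp : 0 ≤ sPlus a b c) (ha : 0 < a) (hζ : IsInitialCutoff ζ)
    (hε : 0 < ε) (r : ℝ) :
    |layerProfile a b c δ ζ ε r - sPlus a b c * heaviside r| ≤
      sPlus a b c * layerDecay a ε r := by
  have hdiff : layerProfile a b c δ ζ ε r - sPlus a b c * heaviside r =
      ζ (r / δ) * (profile a b c (r / ε) - sPlus a b c * heaviside r) := by
    rw [layerProfile]; ring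
  rw [hdiff, abs_mul, abs_of_nonneg (hζ.range _).1]
  exact (mul_le_of_le_one_left (abs_nonneg _) (hζ.range _).2).trans
    (abs_profile_sub_le hp ha hε r)

lemma layerProfile_of_abs_le (hζ : IsInitialCutoff ζ) (hδ : 0 < δ) (hr : |r| ≤ δ / 2) :
    layerProfile a b c δ ζ ε r = profile a b c (r / ε) := by
  rw [layerProfile, hζ.one]
  · ring
  · rw [abs_div, abs_of_pos hδ, div_le_iff₀ hδ]; linarith

lemma layerProfile_of_le_abs (hζ : IsInitialCutoff ζ) (hδ : 0 < δ) (hr : δ ≤ |r|) :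
    layerProfile a b c δ ζ ε r = sPlus a b c * heaviside r := by
  rw [layerProfile, hζ.zero]
  · ring
  · rwa [abs_div, abs_of_pos hδ, one_le_div hδ]

lemma layerProfile_eventuallyEq_profile (hζ : IsInitialCutoff ζ) (hδ : 0 < δ)
    (hr : |r| < δ / 2) :
    layerProfile a b c δ ζ ε =ᶠ[𝓝 r] fun r => profile a b c (r / ε) := by
  filter_upwards [continuous_abs.continuousAt.eventually (gt_mem_nhds hr)] with s hs
  exact layerProfile_of_abs_le hζ hδ hs.le

lemma layerProfile_eventuallyEq_of_ne_zero (hr : r ≠ 0) :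
    layerProfile a b c δ ζ ε =ᶠ[𝓝 r] fun s => ζ (s / δ) * profile a b c (s / ε) +
      (1 - ζ (s / δ)) * (sPlus a b c * heaviside r) := by
  filter_upwards [heaviside_eventuallyEq hr] with s hs
  rw [layerProfile, hs]

lemma layerProfile_eventuallyEq_const (hζ : IsInitialCutoff ζ) (hδ : 0 < δ) (hr : δ < |r|) :
    layerProfile a b c δ ζ ε =ᶠ[𝓝 r] fun _ => layerProfile a b c δ ζ ε r := by
  filter_upwards [heaviside_eventuallyEq (abs_pos.mp (hδ.trans hr)),
    continuous_abs.continuousAt.eventually (lt_mem_nhds hr)] with s hstep hs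
  rw [layerProfile_of_le_abs hζ hδ hs.le, layerProfile_of_le_abs hζ hδ hr.le, hstep]

lemma contDiff_layerProfile (hζ : IsInitialCutoff ζ) (hδ : 0 < δ) :
    ContDiff ℝ ∞ (layerProfile a b c δ ζ ε) := by
  have hprofile : ContDiff ℝ ∞ fun r => profile a b c (r / ε) :=
    contDiff_profile.comp (contDiff_id.div_const ε)
  have hcutoff : ContDiff ℝ ∞ fun r => ζ (r / δ) := hζ.smooth.comp (contDiff_id.div_const δ)
  refine contDiff_iff_contDiffAt.mpr fun r => ?_
  rcases eq_or_ne r 0 with rfl | hr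
  · exact hprofile.contDiffAt.congr_of_eventuallyEq
      (layerProfile_eventuallyEq_profile hζ hδ (by simpa using hδ))
  · exact ((hcutoff.mul hprofile).add ((contDiff_const.sub hcutoff).mul
      contDiff_const)).contDiffAt.congr_of_eventuallyEq (layerProfile_eventuallyEq_of_ne_zero hr)

lemma deriv_layerProfile_of_abs_lt (hb : 0 < b) (hc : 0 < c) (habc : b ^ 2 = 27 * a * c)
    (hζ : IsInitialCutoff ζ) (hδ : 0 < δ) (hr : |r| < δ / 2) :
    deriv (layerProfile a b c δ ζ ε) r =
      √3 * uniaxialRoot a b c (layerProfile a b c δ ζ ε r) / ε := by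
  rw [(layerProfile_eventuallyEq_profile hζ hδ hr).deriv_eq,
    (hasDerivAt_scaled_profile hb hc habc ε r).deriv, layerProfile_of_abs_le hζ hδ hr.le]

lemma deriv_layerProfile_of_ne_zero (hb : 0 < b) (hc : 0 < c) (habc : b ^ 2 = 27 * a * c)
    (hζ : Differentiable ℝ ζ) (hr : r ≠ 0) :
    deriv (layerProfile a b c δ ζ ε) r =
      deriv ζ (r / δ) / δ * (profile a b c (r / ε) - sPlus a b c * heaviside r) +
        ζ (r / δ) * (√3 * uniaxialRoot a b c (profile a b c (r / ε)) / ε) := by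
  have hcutoff : HasDerivAt (fun r => ζ (r / δ)) (deriv ζ (r / δ) * (1 / δ)) r :=
    (hζ _).hasDerivAt.comp r ((hasDerivAt_id r).div_const δ)
  have hsum := (hcutoff.mul (hasDerivAt_scaled_profile hb hc habc ε r)).add
    ((hcutoff.const_sub 1).mul_const (sPlus a b c * heaviside r))
  rw [(layerProfile_eventuallyEq_of_ne_zero hr).deriv_eq]
  exact (hsum.congr_deriv (by ring)).deriv

lemma IsInitialCutoff.exists_abs_deriv_le (hζ : IsInitialCutoff ζ) :
    ∃ Z, 0 ≤ Z ∧ ∀ s, |deriv ζ s| ≤ Z := by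
  have hsupp : HasCompactSupport ζ :=
    HasCompactSupport.intro (isCompact_Icc (a := (-1 : ℝ)) (b := 1)) fun s hs =>
      hζ.zero s (not_le.mp (mt abs_le.mp hs)).le
  obtain ⟨Z, hZ⟩ :=
    (hζ.smooth.continuous_deriv (by simp)).bounded_above_of_compact_support hsupp.deriv
  exact ⟨Z, (norm_nonneg _).trans (hZ 0), hZ⟩

lemma exists_abs_deriv_layerProfile_le (ha : 0 < a) (hb : 0 < b) (hc : 0 < c)
    (habc : b ^ 2 = 27 * a * c) (hζ : IsInitialCutoff ζ) (hδ : 0 < δ) :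
    ∃ D, 0 ≤ D ∧ ∀ ε, 0 < ε → ε ≤ 1 → ∀ r, r ≠ 0 →
      |deriv (layerProfile a b c δ ζ ε) r| ≤ D * layerDecay a ε r / ε := by
  obtain ⟨Z, hZ0, hZ⟩ := hζ.exists_abs_deriv_le
  have hp := (sPlus_pos hb hc habc).le
  refine ⟨Z / δ * sPlus a b c + √3 * (√c / 3 * sPlus a b c ^ 2), by positivity,
    fun ε hε hε1 r hr => ?_⟩
  have hdecay := abs_profile_sub_le hp ha hε r
  have hmem := profile_mem hp (r / ε)
  have hE : 0 ≤ layerDecay a ε r := layerDecay_nonneg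
  have hcutoff : |deriv ζ (r / δ) / δ * (profile a b c (r / ε) - sPlus a b c * heaviside r)| ≤
      Z / δ * sPlus a b c * layerDecay a ε r / ε := by
    rw [abs_mul, abs_div, abs_of_pos hδ, le_div_iff₀ hε]
    calc |deriv ζ (r / δ)| / δ * |profile a b c (r / ε) - sPlus a b c * heaviside r| * ε
        ≤ Z / δ * (sPlus a b c * layerDecay a ε r) * 1 := by gcongr; exact hZ _
      _ = Z / δ * sPlus a b c * layerDecay a ε r := by ring
  have hprofile : |ζ (r / δ) * (√3 * uniaxialRoot a b c (profile a b c (r / ε)) / ε)| ≤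
      √3 * (√c / 3 * sPlus a b c ^ 2) * layerDecay a ε r / ε := by
    have hroot := uniaxialRoot_nonneg hmem
    rw [abs_mul, abs_of_nonneg (hζ.range _).1, abs_of_nonneg (by positivity)]
    calc ζ (r / δ) * (√3 * uniaxialRoot a b c (profile a b c (r / ε)) / ε)
        ≤ 1 * (√3 * (√c / 3 * sPlus a b c ^ 2 * layerDecay a ε r) / ε) := by
          gcongr
          · exact (hζ.range _).2
          · exact uniaxialRoot_le_mul_layerDecay hmem hdecay
      _ = √3 * (√c / 3 * sPlus a b c ^ 2) * layerDecay a ε r / ε := by ring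
  rw [deriv_layerProfile_of_ne_zero hb hc habc (hζ.smooth.differentiable (by simp)) hr]
  exact (abs_add_le _ _).trans ((add_le_add hcutoff hprofile).trans_eq (by ring))


/-- Cut-offs `φ` for the calibration `ξ = -φ(d_Γ/δ) ∇d_Γ`, of either sign: supported in `[-1, 1]`,
bounded by `1`, and quadratically close to `1` at `0`. -/
structure IsQuadraticCutoff (φ : ℝ → ℝ) : Prop where
  smooth : ContDiff ℝ ∞ φ
  zero : ∀ x, 1 ≤ |x| → φ x = 0
  abs_le_one : ∀ x, |φ x| ≤ 1
  lower : ∀ x, |x| ≤ 1 / 2 → 1 - 4 * x ^ 2 ≤ φ x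

lemma IsCalibrationCutoff.nonneg (hφ : IsCalibrationCutoff φ) (x : ℝ) : 0 ≤ φ x := by
  rcases lt_or_ge |x| 1 with hx | hx
  · exact (hφ.pos x hx).le
  · exact (hφ.zero x hx).ge

lemma IsCalibrationCutoff.le_one (hφ : IsCalibrationCutoff φ) (x : ℝ) : φ x ≤ 1 := by
  have hsmall (y : ℝ) (hy : |y| ≤ 1 / 2) : φ y ≤ 1 := by
    linarith [(hφ.bounds y hy).2, sq_nonneg y]
  rcases le_or_gt |x| (1 / 2) with hx | hx
  · exact hsmall x hx
  rcases le_or_gt |x| 1 with hx1 | hx1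
  · have habs : φ |x| = φ x := by
      rcases abs_choice x with hsign | hsign <;> rw [hsign]
      exact hφ.even x
    rw [← habs]
    exact (hφ.antitone ⟨by norm_num, by norm_num⟩ ⟨abs_nonneg x, hx1⟩ hx.le).trans
      (hsmall (1 / 2) (by norm_num [abs_of_pos]))
  · rw [hφ.zero x hx1.le]
    exact zero_le_one

lemma IsCalibrationCutoff.isQuadraticCutoff (hφ : IsCalibrationCutoff φ) :
    IsQuadraticCutoff φ where
  smooth := hφ.smooth
  zero := hφ.zero
  abs_le_one x := abs_le.mpr ⟨by linarith [hφ.nonneg x], hφ.le_one x⟩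
  lower x hx := (hφ.bounds x hx).1

lemma calibratedDensity_of_equipartition (hε : ε ≠ 0) (κ s : ℝ) :
    calibratedDensity a b c ε κ s (√3 * uniaxialRoot a b c s / ε) =
      2 * (1 - κ) * (uniaxialRoot a b c s ^ 2 / ε) := by
  rw [calibratedDensity, div_pow, mul_pow, Real.sq_sqrt (by norm_num)]
  field_simp
  ring

lemma calibratedDensity_le {κ s s' A D E : ℝ} (hε : 0 < ε) (hκ : |κ| ≤ 1)
    (hs : |uniaxialRoot a b c s| ≤ A * E) (hs' : |s'| ≤ D * E / ε) :
    calibratedDensity a b c ε κ s s' ≤ (D ^ 2 / 3 + A ^ 2 + 2 / √3 * (A * D)) * (E ^ 2 / ε) := by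
  have hgradient : ε / 3 * s' ^ 2 ≤ D ^ 2 / 3 * (E ^ 2 / ε) := by
    rw [← sq_abs]
    calc ε / 3 * |s'| ^ 2 ≤ ε / 3 * (D * E / ε) ^ 2 := by gcongr
      _ = D ^ 2 / 3 * (E ^ 2 / ε) := by field_simp
  have hpotential : 1 / ε * uniaxialRoot a b c s ^ 2 ≤ A ^ 2 * (E ^ 2 / ε) := by
    rw [← sq_abs]
    calc 1 / ε * |uniaxialRoot a b c s| ^ 2 ≤ 1 / ε * (A * E) ^ 2 := by gcongr
      _ = A ^ 2 * (E ^ 2 / ε) := by ring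
  have hcalibration : -(κ * (2 / √3 * uniaxialRoot a b c s * s')) ≤
      2 / √3 * (A * D) * (E ^ 2 / ε) := by
    calc -(κ * (2 / √3 * uniaxialRoot a b c s * s'))
        ≤ |κ * (2 / √3 * uniaxialRoot a b c s * s')| := neg_le_abs _
      _ = |κ| * (2 / √3 * |uniaxialRoot a b c s| * |s'|) := by
        rw [abs_mul, abs_mul, abs_mul, abs_of_nonneg (by positivity : 0 ≤ 2 / √3)]
      _ ≤ 1 * (2 / √3 * (A * E) * (D * E / ε)) := by
        have := (abs_nonneg _).trans hs
        gcongr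
      _ = 2 / √3 * (A * D) * (E ^ 2 / ε) := by ring
  rw [calibratedDensity]
  linarith

lemma layerDecay_sq_div_le (ha : 0 < a) (hε : 0 < ε) (hδ : 0 < δ) (hr : δ / 2 ≤ |r|) :
    layerDecay a ε r ^ 2 / ε ≤ 8 / (a * δ ^ 2) * ε := by
  have hsq : (δ / 2) ^ 2 ≤ r ^ 2 := by rw [← sq_abs r]; gcongr
  have hdecay := sq_mul_layerDecay_le (r := r) ha hε
  rw [div_le_iff₀ hε]
  calc layerDecay a ε r ^ 2 ≤ layerDecay a ε r := layerDecay_sq_le hε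
    _ = 4 / δ ^ 2 * ((δ / 2) ^ 2 * layerDecay a ε r) := by field_simp; ring
    _ ≤ 4 / δ ^ 2 * (r ^ 2 * layerDecay a ε r) := by
      have := layerDecay_nonneg (a := a) (ε := ε) (r := r)
      gcongr
    _ ≤ 4 / δ ^ 2 * (2 * ε ^ 2 / a) := by gcongr
    _ = 8 / (a * δ ^ 2) * ε * ε := by field_simp; ring

lemma uniaxialRoot_layerProfile_le (hp : 0 ≤ sPlus a b c) (ha : 0 < a) (hζ : IsInitialCutoff ζ)
    (hε : 0 < ε) (r : ℝ) :
    |uniaxialRoot a b c (layerProfile a b c δ ζ ε r)| ≤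
      √c / 3 * sPlus a b c ^ 2 * layerDecay a ε r := by
  have hmem := layerProfile_mem (δ := δ) (ε := ε) hp hζ r
  rw [abs_of_nonneg (uniaxialRoot_nonneg hmem)]
  exact uniaxialRoot_le_mul_layerDecay hmem (abs_layerProfile_sub_le hp ha hζ hε r)

lemma calibratedDensity_layerProfile_le_of_abs_lt (ha : 0 < a) (hb : 0 < b) (hc : 0 < c)
    (habc : b ^ 2 = 27 * a * c) (hζ : IsInitialCutoff ζ) (hφ : IsQuadraticCutoff φ) (hδ : 0 < δ)
    (hε : 0 < ε) (hr : |r| < δ / 2) :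
    calibratedDensity a b c ε (φ (r / δ)) (layerProfile a b c δ ζ ε r)
        (deriv (layerProfile a b c δ ζ ε) r) ≤
      16 * (√c / 3 * sPlus a b c ^ 2) ^ 2 / (a * δ ^ 2) * ε := by
  rw [deriv_layerProfile_of_abs_lt hb hc habc hζ hδ hr,
    calibratedDensity_of_equipartition hε.ne']
  have hcutoff := hφ.lower (r / δ) (by rw [abs_div, abs_of_pos hδ, div_le_iff₀ hδ]; linarith)
  have hroot := uniaxialRoot_layerProfile_le (δ := δ) (sPlus_pos hb hc habc).le ha hζ hε r
  have hdecay := sq_mul_layerDecay_le (r := r) ha hε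
  set m := uniaxialRoot a b c (layerProfile a b c δ ζ ε r)
  set A := √c / 3 * sPlus a b c ^ 2
  have hm : m ^ 2 ≤ A ^ 2 * layerDecay a ε r := by
    calc m ^ 2 = |m| ^ 2 := (sq_abs m).symm
      _ ≤ (A * layerDecay a ε r) ^ 2 := by gcongr
      _ = A ^ 2 * layerDecay a ε r ^ 2 := by ring
      _ ≤ A ^ 2 * layerDecay a ε r := by gcongr; exact layerDecay_sq_le hε
  calc 2 * (1 - φ (r / δ)) * (m ^ 2 / ε)
      ≤ 2 * (4 * (r / δ) ^ 2) * (A ^ 2 * layerDecay a ε r / ε) := by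
        gcongr
        linarith
    _ = 8 * A ^ 2 / δ ^ 2 / ε * (r ^ 2 * layerDecay a ε r) := by field_simp; ring
    _ ≤ 8 * A ^ 2 / δ ^ 2 / ε * (2 * ε ^ 2 / a) := by gcongr
    _ = 16 * A ^ 2 / (a * δ ^ 2) * ε := by field_simp; ring

lemma exists_calibratedDensity_layerProfile_le (ha : 0 < a) (hb : 0 < b) (hc : 0 < c)
    (habc : b ^ 2 = 27 * a * c) (hζ : IsInitialCutoff ζ) (hφ : IsQuadraticCutoff φ)
    (hδ : 0 < δ) :
    ∃ C, 0 ≤ C ∧ ∀ ε, 0 < ε → ε ≤ 1 → ∀ r,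
      calibratedDensity a b c ε (φ (r / δ)) (layerProfile a b c δ ζ ε r)
        (deriv (layerProfile a b c δ ζ ε) r) ≤ C * ε := by
  obtain ⟨D, hD0, hD⟩ := exists_abs_deriv_layerProfile_le ha hb hc habc hζ hδ
  have hp := (sPlus_pos hb hc habc).le
  have hA : 0 ≤ √c / 3 * sPlus a b c ^ 2 := by positivity
  set A := √c / 3 * sPlus a b c ^ 2
  refine ⟨16 * A ^ 2 / (a * δ ^ 2) +
    (D ^ 2 / 3 + A ^ 2 + 2 / √3 * (A * D)) * (8 / (a * δ ^ 2)), by positivity,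
    fun ε hε hε1 r => ?_⟩
  rw [add_mul]
  rcases lt_or_ge |r| (δ / 2) with hr | hr
  · refine le_add_of_le_of_nonneg ?_ (by positivity)
    exact calibratedDensity_layerProfile_le_of_abs_lt ha hb hc habc hζ hφ hδ hε hr
  · have hr0 : r ≠ 0 := abs_pos.mp ((half_pos hδ).trans_le hr)
    refine le_add_of_nonneg_of_le (by positivity) ?_
    calc calibratedDensity a b c ε (φ (r / δ)) (layerProfile a b c δ ζ ε r)
          (deriv (layerProfile a b c δ ζ ε) r)
        ≤ (D ^ 2 / 3 + A ^ 2 + 2 / √3 * (A * D)) * (layerDecay a ε r ^ 2 / ε) :=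
          calibratedDensity_le hε (hφ.abs_le_one _)
            (uniaxialRoot_layerProfile_le hp ha hζ hε r) (hD ε hε hε1 r hr0)
      _ ≤ (D ^ 2 / 3 + A ^ 2 + 2 / √3 * (A * D)) * (8 / (a * δ ^ 2) * ε) := by
          gcongr
          exact layerDecay_sq_div_le ha hε hδ hr
      _ = (D ^ 2 / 3 + A ^ 2 + 2 / √3 * (A * D)) * (8 / (a * δ ^ 2)) * ε := by ring

lemma abs_wellPrimitive_sub_le {s t : ℝ} (hs : s ∈ Icc 0 (sPlus a b c))
    (ht : t ∈ Icc 0 (sPlus a b c)) :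
    |wellPrimitive a b c t - wellPrimitive a b c s| ≤
      2 / √3 * (√c / 3 * sPlus a b c ^ 2) * |t - s| := by
  refine Convex.norm_image_sub_le_of_norm_hasDerivWithin_le
    (fun x _ => (hasDerivAt_wellPrimitive x).hasDerivWithinAt) (fun x hx => ?_)
    (convex_Icc 0 (sPlus a b c)) hs ht
  have := uniaxialRoot_nonneg hx
  rw [Real.norm_of_nonneg (by positivity), uniaxialRoot, pow_two]
  gcongr
  · exact sub_nonneg.mpr hx.2
  · exact hx.1.trans hx.2
  · exact hx.2
  · exact sub_le_self _ hx.1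

lemma abs_truncation_le (hδ : 0 ≤ δ) (r : ℝ) : |truncation δ r| ≤ δ := by
  rw [truncation]
  split_ifs with hright hleft
  · rw [abs_neg, abs_of_nonneg hδ]
  · rw [abs_of_nonneg hδ]
  · rw [abs_neg]
    exact abs_le.mpr ⟨(not_le.mp hleft).le, (not_le.mp hright).le⟩

lemma abs_truncation_le_abs (hδ : 0 ≤ δ) (r : ℝ) : |truncation δ r| ≤ |r| := by
  rw [truncation]
  split_ifs with hright hleft
  · rw [abs_neg, abs_of_nonneg hδ]
    exact hright.trans (le_abs_self r)
  · rw [abs_of_nonneg hδ]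
    exact (le_neg.mp hleft).trans (neg_le_abs r)
  · rw [abs_neg]

lemma exists_wellPrimitive_layerProfile_sub_mul_truncation_le (ha : 0 < a) (hb : 0 < b)
    (hc : 0 < c) (habc : b ^ 2 = 27 * a * c) (hζ : IsInitialCutoff ζ) (hδ : 0 < δ) :
    ∃ C, 0 ≤ C ∧ ∀ ε, 0 < ε → ∀ r,
      |(wellPrimitive a b c (layerProfile a b c δ ζ ε r) -
        wellPrimitive a b c (sPlus a b c * heaviside r)) * truncation δ r| ≤ C * ε := by
  have hp := (sPlus_pos hb hc habc).le
  refine ⟨2 / √3 * (√c / 3 * sPlus a b c ^ 2) * sPlus a b c / √a, by positivity,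
    fun ε hε r => ?_⟩
  have hsub := abs_wellPrimitive_sub_le (mul_heaviside_mem hp r)
    (layerProfile_mem (δ := δ) (ε := ε) hp hζ r)
  have hlayer := abs_layerProfile_sub_le (δ := δ) hp ha hζ hε r
  have htrunc := abs_truncation_le_abs hδ.le r
  rw [abs_mul]
  calc |wellPrimitive a b c (layerProfile a b c δ ζ ε r) -
          wellPrimitive a b c (sPlus a b c * heaviside r)| * |truncation δ r|
      ≤ 2 / √3 * (√c / 3 * sPlus a b c ^ 2) * (sPlus a b c * layerDecay a ε r) * |r| := by
        have := layerDecay_nonneg (a := a) (ε := ε) (r := r)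
        gcongr
        exact hsub.trans (by gcongr)
    _ = 2 / √3 * (√c / 3 * sPlus a b c ^ 2) * sPlus a b c * (|r| * layerDecay a ε r) := by ring
    _ ≤ 2 / √3 * (√c / 3 * sPlus a b c ^ 2) * sPlus a b c * (ε / √a) := by
        gcongr
        exact abs_mul_layerDecay_le ha hε
    _ = 2 / √3 * (√c / 3 * sPlus a b c ^ 2) * sPlus a b c / √a * ε := by ring

lemma surfaceTension_mul_indicator_sub_mul_truncation (hb : 0 < b) (hc : 0 < c)
    (habc : b ^ 2 = 27 * a * c) (hδ : 0 ≤ δ) (r t : ℝ) :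
    (surfaceTension a b c * (Iio 0).indicator 1 r - (surfaceTension a b c - t)) *
        truncation δ r =
      (t - wellPrimitive a b c (sPlus a b c * heaviside r)) * truncation δ r := by
  rw [surfaceTension_eq hb hc habc]
  rcases lt_trichotomy r 0 with hr | rfl | hr
  · rw [heaviside_of_nonpos hr.le, mul_zero, wellPrimitive_zero, indicator_of_mem (mem_Iio.mpr hr),
      Pi.one_apply]
    ring
  · have hzero : truncation δ 0 = 0 := by simpa using abs_truncation_le_abs hδ 0
    rw [hzero, mul_zero, mul_zero]
  · rw [heaviside_of_pos hr, mul_one, indicator_of_notMem (notMem_Iio.mpr hr.le)]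
    ring

end TransitionLayer

/-! ### The initial datum -/

section DirectorField

lemma exists_contDiff_director_extension :
    ∃ Φ : Vec3 → QTensor, ContDiff ℝ ∞ Φ ∧ ∀ e : S2, Φ e = director e := by
  refine ⟨fun v => symTraceless.orthogonalProjectionOnto (WithLp.toLp 2 fun ij =>
    v ij.1 * v ij.2 - if ij.1 = ij.2 then 1 / 3 else 0), ?_, fun e =>
    Submodule.orthogonalProjectionOnto_mem_subspace_eq_self (director e)⟩
  refine (ContinuousLinearMap.contDiff _).comp (PiLp.contDiff_toLp.comp ?_)
  rw [contDiff_pi]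
  intro ij
  fun_prop

lemma IsWeakGradient.inner_ae_eq_zero {E : Type*} [NormedAddCommGroup E] [InnerProductSpace ℝ E]
    [FiniteDimensional ℝ E] {Ω : Set Vec3} {w : Vec3 → E} {G : Fin 3 → Vec3 → E} {r : ℝ}
    (hΩ : IsOpen Ω) (hw : IsWeakGradient Ω w G) (hr : ∀ x, ‖w x‖ ^ 2 = r) (k : Fin 3) :
    ∀ᵐ x ∂volume.restrict Ω, inner ℝ (w x) (G k x) = 0 := by
  have hsq := hw.comp_of_bounded hΩ
    (fun x => (le_abs_self _).trans (Real.abs_le_sqrt (hr x).le)) (contDiff_norm_sq ℝ)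
  simp only [hr] at hsq
  filter_upwards [hsq.ae_eq hΩ (isWeakGradient_const Ω r) k] with x hx
  simpa [fderiv_norm_sq_apply] using hx

variable {Ω : Set Vec3} {u₀ : Vec3 → S2}

lemma memH1_director (hΩ : IsOpen Ω) (hfin : volume Ω ≠ ⊤)
    (hu : MemH1 Ω (fun x => (u₀ x : Vec3))) : MemH1 Ω (fun x => director (u₀ x)) := by
  obtain ⟨Φ, hΦ, hΦd⟩ := exists_contDiff_director_extension
  simpa only [hΦd] using hu.comp_of_bounded hΩ hfin (fun x => (norm_eq_of_mem_sphere (u₀ x)).le)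
    (hΦ.of_le (by simp))

lemma exists_norm_weakGrad_director_le : ∃ B : ℝ, ∀ {Ω : Set Vec3}, IsOpen Ω → volume Ω ≠ ⊤ →
    ∀ u₀ : Vec3 → S2, MemH1 Ω (fun x => (u₀ x : Vec3)) → ∀ k, ∀ᵐ x ∂volume.restrict Ω,
      ‖weakGrad Ω (fun x => director (u₀ x)) k x‖ ≤
        B * ‖weakGrad Ω (fun x => (u₀ x : Vec3)) k x‖ := by
  obtain ⟨Φ, hΦ, hΦd⟩ := exists_contDiff_director_extension
  obtain ⟨B, hB⟩ := exists_norm_comp_le (F := Vec3 →L[ℝ] QTensor)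
    (w := fun e : S2 => (e : Vec3)) (fun e => (norm_eq_of_mem_sphere e).le)
    (hΦ.continuous_fderiv (by simp))
  refine ⟨B, fun {Ω} hΩ hfin u₀ hu k => ?_⟩
  have hchain := hu.isWeakGradient_weakGrad.comp_of_bounded hΩ
    (fun x => (norm_eq_of_mem_sphere (u₀ x)).le) (hΦ.of_le (by simp))
  simp only [hΦd] at hchain
  filter_upwards [(memH1_director hΩ hfin hu).isWeakGradient_weakGrad.ae_eq hΩ hchain k] with x hx
  rw [hx]
  exact ContinuousLinearMap.le_of_opNorm_le _ (hB (u₀ x)) _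

end DirectorField

section BoundedMultiplier

variable {E : Type*} [NormedAddCommGroup E] [NormedSpace ℝ E] {Ω : Set Vec3}

lemma memH1_const (hfin : volume Ω ≠ ⊤) (e : E) : MemH1 Ω (fun _ => e) := by
  have : IsFiniteMeasure (volume.restrict Ω) := isFiniteMeasure_restrict.mpr hfin
  exact ⟨memLp_const e, _, isWeakGradient_const Ω e, fun _ => MemLp.zero⟩

lemma MemH1.smul_of_bounded {w : Vec3 → E} {g : Vec3 → ℝ} {A B : ℝ} (hΩ : IsOpen Ω)
    (hw : MemH1 Ω w) (hg : ContDiffOn ℝ ∞ g Ω) (hA : ∀ x ∈ Ω, |g x| ≤ A)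
    (hB : ∀ x ∈ Ω, ∀ k, |fderiv ℝ g x (EuclideanSpace.single k 1)| ≤ B) :
    MemH1 Ω (fun x => g x • w x) := by
  obtain ⟨hw2, G, hG, hG2⟩ := hw
  have hbound {f : Vec3 → ℝ} {C : ℝ} (hf : ContinuousOn f Ω) (hC : ∀ x ∈ Ω, |f x| ≤ C) :
      MemLp f ⊤ (volume.restrict Ω) :=
    memLp_top_of_bound (hf.aestronglyMeasurable hΩ.measurableSet) C
      (ae_restrict_of_forall_mem hΩ.measurableSet hC)
  have hgtop := hbound hg.continuousOn hA
  refine ⟨hw2.smul hgtop, _, hG.smul hΩ hg, fun k => MemLp.add ?_ ((hG2 k).smul hgtop)⟩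
  exact hw2.smul
    (hbound (continuousOn_fderiv_apply hΩ (hg.of_le (by simp)) _) fun x hx => hB x hx k)

end BoundedMultiplier

section InitialDatum

variable {a b c δ ε : ℝ} {Ω Ωp : Set Vec3} {ζ φ : ℝ → ℝ} {u₀ : Vec3 → S2} {x : Vec3}

lemma initialOrder_eq_layerProfile (h : IsTubularInterface Ω Ωp δ) (hx : x ∈ Ω) :
    initialOrder a b c Ω Ωp δ ζ ε x = layerProfile a b c δ ζ ε (sdist Ω Ωp x) := by
  have hind : Ωp.indicator 1 x = heaviside (sdist Ω Ωp x) :=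
    indicator_const_eq_indicator_const (h.mem_plus_iff hx)
  rw [initialOrder, layerProfile, hind]

lemma initialOrder_eventuallyEq (h : IsTubularInterface Ω Ωp δ) (hx : x ∈ Ω) :
    initialOrder a b c Ω Ωp δ ζ ε =ᶠ[𝓝 x] fun y => layerProfile a b c δ ζ ε (sdist Ω Ωp y) := by
  filter_upwards [h.isOpen.mem_nhds hx] with y hy using initialOrder_eq_layerProfile h hy

lemma initialOrder_mem (hp : 0 ≤ sPlus a b c) (hζ : IsInitialCutoff ζ) (x : Vec3) :
    initialOrder a b c Ω Ωp δ ζ ε x ∈ Icc 0 (sPlus a b c) := by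
  have hsharp : sPlus a b c * Ωp.indicator 1 x ∈ Icc 0 (sPlus a b c) := by
    by_cases hx : x ∈ Ωp <;> simp [hx, hp]
  have hmem := convex_Icc 0 (sPlus a b c) (profile_mem hp (sdist Ω Ωp x / ε)) hsharp
    (hζ.range (sdist Ω Ωp x / δ)).1 (sub_nonneg.mpr (hζ.range (sdist Ω Ωp x / δ)).2) (by ring)
  simpa only [initialOrder, smul_eq_mul] using hmem

lemma abs_initialOrder_le (hp : 0 ≤ sPlus a b c) (hζ : IsInitialCutoff ζ) (x : Vec3) :
    |initialOrder a b c Ω Ωp δ ζ ε x| ≤ sPlus a b c :=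
  (abs_of_nonneg (initialOrder_mem hp hζ x).1).trans_le (initialOrder_mem hp hζ x).2

lemma norm_initialDatum_le (hp : 0 ≤ sPlus a b c) (hζ : IsInitialCutoff ζ) (u₀ : Vec3 → S2)
    (x : Vec3) : ‖initialDatum a b c Ω Ωp δ ζ ε u₀ x‖ ≤ sPlus a b c := by
  rw [initialDatum, norm_smul, Real.norm_eq_abs]
  exact (mul_le_of_le_one_right (abs_nonneg _) (norm_director_le_one _)).trans
    (abs_initialOrder_le hp hζ x)

lemma contDiffOn_initialOrder (h : IsTubularInterface Ω Ωp δ) (hζ : IsInitialCutoff ζ) :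
    ContDiffOn ℝ ∞ (initialOrder a b c Ω Ωp δ ζ ε) Ω := fun _ hx =>
  ((h.contDiffAt_comp_sdist (contDiff_layerProfile hζ h.δ_pos)
    (fun _ hr => layerProfile_eventuallyEq_const hζ h.δ_pos hr) hx).congr_of_eventuallyEq
    (initialOrder_eventuallyEq h hx)).contDiffWithinAt

lemma fderiv_initialOrder (h : IsTubularInterface Ω Ωp δ) (hζ : IsInitialCutoff ζ) (hx : x ∈ Ω) :
    fderiv ℝ (initialOrder a b c Ω Ωp δ ζ ε) x =
      deriv (layerProfile a b c δ ζ ε) (sdist Ω Ωp x) • fderiv ℝ (sdist Ω Ωp) x := by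
  rw [(initialOrder_eventuallyEq h hx).fderiv_eq]
  exact h.fderiv_comp_sdist ((contDiff_layerProfile hζ h.δ_pos).differentiable (by simp))
    (fun _ hr => layerProfile_eventuallyEq_const hζ h.δ_pos hr) hx

lemma deriv_layerProfile_mul_eikonal (h : IsTubularInterface Ω Ωp δ) (hζ : IsInitialCutoff ζ)
    (hx : x ∈ Ω) :
    deriv (layerProfile a b c δ ζ ε) (sdist Ω Ωp x) *
      ∑ k, fderiv ℝ (sdist Ω Ωp) x (EuclideanSpace.single k 1) ^ 2 =
    deriv (layerProfile a b c δ ζ ε) (sdist Ω Ωp x) := by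
  rcases lt_or_ge δ |sdist Ω Ωp x| with hfar | hnear
  · rw [(layerProfile_eventuallyEq_const hζ h.δ_pos hfar).deriv_eq, deriv_const, zero_mul]
  · rw [h.sum_fderiv_sdist_sq (h.mem_tube_of_abs_sdist_le hx hnear), mul_one]

lemma sum_fderiv_initialOrder_sq (h : IsTubularInterface Ω Ωp δ) (hζ : IsInitialCutoff ζ)
    (hx : x ∈ Ω) :
    ∑ k, fderiv ℝ (initialOrder a b c Ω Ωp δ ζ ε) x (EuclideanSpace.single k 1) ^ 2 =
      deriv (layerProfile a b c δ ζ ε) (sdist Ω Ωp x) ^ 2 := by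
  simp only [fderiv_initialOrder h hζ hx, smul_apply, smul_eq_mul, mul_pow]
  rw [← Finset.mul_sum, sq, mul_assoc, deriv_layerProfile_mul_eikonal h hζ hx]

lemma sum_calibration_mul_fderiv_initialOrder (h : IsTubularInterface Ω Ωp δ)
    (hζ : IsInitialCutoff ζ) (hx : x ∈ Ω) :
    ∑ k, calibration Ω Ωp δ φ x k *
        fderiv ℝ (initialOrder a b c Ω Ωp δ ζ ε) x (EuclideanSpace.single k 1) =
      -(φ (sdist Ω Ωp x / δ) * deriv (layerProfile a b c δ ζ ε) (sdist Ω Ωp x)) := by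
  rw [← deriv_layerProfile_mul_eikonal h hζ hx, Finset.mul_sum, Finset.mul_sum,
    ← Finset.sum_neg_distrib]
  refine Finset.sum_congr rfl fun k _ => ?_
  rw [calibration_apply, fderiv_initialOrder h hζ hx, smul_apply, smul_eq_mul]
  ring

lemma exists_abs_fderiv_initialOrder_le (h : IsTubularInterface Ω Ωp δ) (hζ : IsInitialCutoff ζ) :
    ∃ B, ∀ x ∈ Ω, ∀ k : Fin 3,
      |fderiv ℝ (initialOrder a b c Ω Ωp δ ζ ε) x (EuclideanSpace.single k 1)| ≤ B := by
  have hsupp : HasCompactSupport (deriv (layerProfile a b c δ ζ ε)) :=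
    HasCompactSupport.of_support_subset_isCompact (isCompact_Icc (a := -δ) (b := δ)) fun r hr => by
      rw [mem_Icc, ← abs_le]
      by_contra! hfar
      exact hr (by rw [(layerProfile_eventuallyEq_const hζ h.δ_pos hfar).deriv_eq, deriv_const])
  obtain ⟨B, hB⟩ := ((contDiff_layerProfile hζ h.δ_pos).continuous_deriv
    (by simp)).bounded_above_of_compact_support hsupp
  refine ⟨B, fun x hx k => le_trans ?_ (hB (sdist Ω Ωp x))⟩
  rw [Real.norm_eq_abs, ← sq_le_sq, ← sum_fderiv_initialOrder_sq h hζ hx]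
  exact Finset.single_le_sum (f := fun k => fderiv ℝ (initialOrder a b c Ω Ωp δ ζ ε) x
    (EuclideanSpace.single k 1) ^ 2) (fun _ _ => sq_nonneg _) (Finset.mem_univ k)

lemma initialDatum_of_mem_plus (h : IsTubularInterface Ω Ωp δ) (hζ : IsInitialCutoff ζ)
    (hx : x ∈ Ωp \ tube Ω Ωp δ) :
    initialDatum a b c Ω Ωp δ ζ ε u₀ x = sPlus a b c • director (u₀ x) := by
  have hxΩ := (subset_closure.trans h.closure_plus) hx.1
  have hfar : δ ≤ |sdist Ω Ωp x| := not_lt.mp fun hlt => hx.2 ((h.mem_tube_iff hxΩ δ).mpr hlt)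
  rw [initialDatum, initialOrder_eq_layerProfile h hxΩ, layerProfile_of_le_abs hζ h.δ_pos hfar,
    heaviside_of_pos ((h.mem_plus_iff hxΩ).mp hx.1), mul_one]

lemma initialDatum_of_mem_tube (h : IsTubularInterface Ω Ωp δ) (hζ : IsInitialCutoff ζ)
    (hx : x ∈ tube Ω Ωp (δ / 2)) :
    initialDatum a b c Ω Ωp δ ζ ε u₀ x =
      profile a b c (sdist Ω Ωp x / ε) • director (u₀ x) := by
  rw [initialDatum, initialOrder_eq_layerProfile h hx.1,
    layerProfile_of_abs_le hζ h.δ_pos ((h.mem_tube_iff hx.1 _).mp hx).le]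

lemma initialDatum_of_mem_outer (h : IsTubularInterface Ω Ωp δ) (hζ : IsInitialCutoff ζ)
    (hx : x ∈ outerPhase Ω Ωp \ tube Ω Ωp δ) : initialDatum a b c Ω Ωp δ ζ ε u₀ x = 0 := by
  have hxΩ : x ∈ Ω := hx.1.1
  have hfar : δ ≤ |sdist Ω Ωp x| := not_lt.mp fun hlt => hx.2 ((h.mem_tube_iff hxΩ δ).mpr hlt)
  rw [initialDatum, initialOrder_eq_layerProfile h hxΩ, layerProfile_of_le_abs hζ h.δ_pos hfar,
    heaviside_of_nonpos ((h.mem_outer_iff hxΩ).mp hx.1).le, mul_zero, zero_smul]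

lemma IsTubularInterface.volume_ne_top (h : IsTubularInterface Ω Ωp δ) : volume Ω ≠ ⊤ :=
  h.bounded.measure_lt_top.ne

lemma memH1_initialOrder (h : IsTubularInterface Ω Ωp δ) (hp : 0 ≤ sPlus a b c)
    (hζ : IsInitialCutoff ζ) : MemH1 Ω (initialOrder a b c Ω Ωp δ ζ ε) := by
  obtain ⟨B, hB⟩ := exists_abs_fderiv_initialOrder_le (a := a) (b := b) (c := c) (ε := ε) h hζ
  simpa only [smul_eq_mul, mul_one] using
    (memH1_const h.volume_ne_top (1 : ℝ)).smul_of_bounded h.isOpen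
      (contDiffOn_initialOrder h hζ) (fun x _ => abs_initialOrder_le hp hζ x) hB

lemma memH1_initialDatum (h : IsTubularInterface Ω Ωp δ) (hp : 0 ≤ sPlus a b c)
    (hζ : IsInitialCutoff ζ) (hu : MemH1 Ω (fun x => (u₀ x : Vec3))) :
    MemH1 Ω (initialDatum a b c Ω Ωp δ ζ ε u₀) := by
  obtain ⟨B, hB⟩ := exists_abs_fderiv_initialOrder_le (a := a) (b := b) (c := c) (ε := ε) h hζ
  exact (memH1_director h.isOpen h.volume_ne_top hu).smul_of_bounded h.isOpen
    (contDiffOn_initialOrder h hζ) (fun x _ => abs_initialOrder_le hp hζ x) hB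

lemma memLp_top_initialDatum (h : IsTubularInterface Ω Ωp δ) (hp : 0 ≤ sPlus a b c)
    (hζ : IsInitialCutoff ζ) (hu : MemH1 Ω (fun x => (u₀ x : Vec3))) :
    MemLp (initialDatum a b c Ω Ωp δ ζ ε u₀) ⊤ (volume.restrict Ω) :=
  memLp_top_of_bound (memH1_initialDatum h hp hζ hu).1.aestronglyMeasurable (sPlus a b c)
    (Eventually.of_forall (norm_initialDatum_le hp hζ u₀))

lemma memH1_psi_initialDatum {η : QTensor → ℝ} (h : IsTubularInterface Ω Ωp δ) (hb : 0 < b)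
    (hc : 0 < c) (habc : b ^ 2 = 27 * a * c) (hζ : IsInitialCutoff ζ)
    (hu : MemH1 Ω (fun x => (u₀ x : Vec3))) (hη : IsMollifier η) (hε : 0 < ε) :
    MemH1 Ω (psi a b c η ε (initialDatum a b c Ω Ωp δ ζ ε u₀)) :=
  have hp := (sPlus_pos hb hc habc).le
  (memH1_initialDatum h hp hζ hu).comp_of_bounded h.isOpen h.volume_ne_top
    (norm_initialDatum_le hp hζ u₀) ((hη.contDiff_quasiDistReg hb hc habc hε).of_le (by simp))

lemma quasiDist_initialDatum (hb : 0 < b) (hc : 0 < c) (habc : b ^ 2 = 27 * a * c)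
    (hζ : IsInitialCutoff ζ) (x : Vec3) :
    quasiDist a b c (initialDatum a b c Ω Ωp δ ζ ε u₀ x) =
      wellPrimitive a b c (sPlus a b c) -
        wellPrimitive a b c (initialOrder a b c Ω Ωp δ ζ ε x) :=
  quasiDist_smul_director hb hc habc (initialOrder_mem (sPlus_pos hb hc habc).le hζ x) _

lemma contDiff_wellPrimitive : ContDiff ℝ 1 (wellPrimitive a b c) := by
  unfold wellPrimitive
  fun_prop

lemma memH1_quasiDist_initialDatum (h : IsTubularInterface Ω Ωp δ) (hb : 0 < b) (hc : 0 < c)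
    (habc : b ^ 2 = 27 * a * c) (hζ : IsInitialCutoff ζ) :
    MemH1 Ω (fun x => quasiDist a b c (initialDatum a b c Ω Ωp δ ζ ε u₀ x)) := by
  have hp := (sPlus_pos hb hc habc).le
  simp only [quasiDist_initialDatum hb hc habc hζ]
  exact (memH1_initialOrder h hp hζ).comp_of_bounded h.isOpen h.volume_ne_top
    (abs_initialOrder_le hp hζ) (contDiff_const.sub contDiff_wellPrimitive)

end InitialDatum

/-! ### The energies of the initial datum -/

section TestField

/-- Smooth vector fields, given by their components, with compact support in `Ω`: the fields against
which a weak gradient can be integrated by parts. -/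
structure IsTestField (Ω : Set Vec3) (X : Fin 3 → Vec3 → ℝ) : Prop where
  contDiff : ∀ k, ContDiff ℝ ∞ (X k)
  hasCompactSupport : ∀ k, HasCompactSupport (X k)
  tsupport_subset : ∀ k, tsupport (X k) ⊆ Ω

namespace IsTestField

variable {Ω : Set Vec3} {X : Fin 3 → Vec3 → ℝ} {w : Vec3 → ℝ} {G : Fin 3 → Vec3 → ℝ}

lemma integrable_mul (hX : IsTestField Ω X) (hG : IsWeakGradient Ω w G) (k : Fin 3) :
    Integrable fun x => X k x * G k x :=
  integrable_smul_of_eq_zero_off_compact (hG.locInt_grad k) (hX.contDiff k).continuous.continuousOn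
    (hX.hasCompactSupport k) (hX.tsupport_subset k) fun _ => image_eq_zero_of_notMem_tsupport

lemma integrable_fderiv_mul (hX : IsTestField Ω X) (hw : LocallyIntegrableOn w Ω) (k : Fin 3) :
    Integrable fun x => fderiv ℝ (X k) x (EuclideanSpace.single k 1) * w x :=
  integrable_smul_of_eq_zero_off_compact hw
    (((hX.contDiff k).continuous_fderiv (by simp)).clm_apply continuous_const).continuousOn
    (hX.hasCompactSupport k) (hX.tsupport_subset k) fun x hx => by
      rw [fderiv_of_notMem_tsupport ℝ hx, zero_apply]

lemma integral_flux (hX : IsTestField Ω X) (hG : IsWeakGradient Ω w G) :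
    ∫ x in Ω, ∑ k, X k x * G k x =
      -∑ k, ∫ x in Ω, fderiv ℝ (X k) x (EuclideanSpace.single k 1) * w x := by
  rw [integral_finsetSum _ fun k _ => (hX.integrable_mul hG k).integrableOn,
    ← Finset.sum_neg_distrib]
  exact Finset.sum_congr rfl fun k _ => neg_eq_iff_eq_neg.mp
    (hG.byParts k (X k) (hX.contDiff k) (hX.hasCompactSupport k) (hX.tsupport_subset k)).symm

lemma exists_abs_integral_flux_sub_le (hΩ : IsOpen Ω) (hX : IsTestField Ω X) :
    ∃ D, 0 ≤ D ∧ ∀ {w w' : Vec3 → ℝ} {G G' : Fin 3 → Vec3 → ℝ} {β : ℝ}, IsWeakGradient Ω w G →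
      IsWeakGradient Ω w' G' → (∀ x ∈ Ω, |w x - w' x| ≤ β) →
      |(∫ x in Ω, ∑ k, X k x * G k x) - ∫ x in Ω, ∑ k, X k x * G' k x| ≤ D * β := by
  refine ⟨∑ k, ∫ x in Ω, |fderiv ℝ (X k) x (EuclideanSpace.single k 1)|,
    Finset.sum_nonneg fun k _ => integral_nonneg fun x => abs_nonneg _,
    fun {w w' G G' β} hG hG' hβ => ?_⟩
  rw [hX.integral_flux hG, hX.integral_flux hG', neg_sub_neg, ← Finset.sum_sub_distrib,
    Finset.sum_mul]
  refine (Finset.abs_sum_le_sum_abs _ _).trans (Finset.sum_le_sum fun k _ => ?_)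
  have hint : Integrable fun x => fderiv ℝ (X k) x (EuclideanSpace.single k 1) :=
    (((hX.contDiff k).continuous_fderiv (by simp)).clm_apply
      continuous_const).integrable_of_hasCompactSupport ((hX.hasCompactSupport k).fderiv_apply ℝ _)
  rw [← integral_sub (hX.integrable_fderiv_mul hG'.locInt k).integrableOn
    (hX.integrable_fderiv_mul hG.locInt k).integrableOn, ← integral_mul_const]
  refine norm_integral_le_of_norm_le (G := ℝ) (hint.abs.mul_const β).integrableOn
    (ae_restrict_of_forall_mem hΩ.measurableSet fun x hx => ?_)
  rw [← mul_sub, Real.norm_eq_abs, abs_mul, abs_sub_comm]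
  exact mul_le_mul_of_nonneg_left (hβ x hx) (abs_nonneg _)

end IsTestField

end TestField

section RelativeDensity

variable {a b c δ ε : ℝ} {Ω Ωp : Set Vec3} {φ : ℝ → ℝ} {η : QTensor → ℝ} {Q : Vec3 → QTensor}

/-- The density of the relative energy with the potential `d^F ∘ Q` in place of its mollification
`ψ_ε`. -/
noncomputable def sharpRelativeDensity (a b c : ℝ) (Ω Ωp : Set Vec3) (δ : ℝ) (φ : ℝ → ℝ) (ε : ℝ)
    (Q : Vec3 → QTensor) (x : Vec3) : ℝ :=
  ε / 2 * ∑ k, ‖weakGrad Ω Q k x‖ ^ 2 + 1 / ε * bulkEnergyReg a b c ε (Q x)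
    - ∑ k, calibration Ω Ωp δ φ x k * weakGrad Ω (fun x => quasiDist a b c (Q x)) k x

lemma isTestField_calibration (h : IsTubularInterface Ω Ωp δ) (hφ : IsQuadraticCutoff φ) :
    IsTestField Ω fun k => Ω.indicator fun x => calibration Ω Ωp δ φ x k where
  contDiff := h.contDiff_indicator_calibration hφ.smooth hφ.zero
  hasCompactSupport := h.hasCompactSupport_indicator_calibration hφ.zero
  tsupport_subset k := (h.tsupport_indicator_calibration_subset hφ.zero k).trans (sep_subset _ _)

lemma eqOn_calibration_flux (G : Fin 3 → Vec3 → ℝ) :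
    EqOn (fun x => ∑ k, (Ω.indicator fun x => calibration Ω Ωp δ φ x k) x * G k x)
      (fun x => ∑ k, calibration Ω Ωp δ φ x k * G k x) Ω := fun x hx => by
  simp only [indicator_of_mem hx]

lemma integrableOn_calibration_flux (h : IsTubularInterface Ω Ωp δ) (hφ : IsQuadraticCutoff φ)
    {w : Vec3 → ℝ} {G : Fin 3 → Vec3 → ℝ} (hG : IsWeakGradient Ω w G) :
    IntegrableOn (fun x => ∑ k, calibration Ω Ωp δ φ x k * G k x) Ω :=
  IntegrableOn.congr_fun (integrable_finsetSum _ fun k _ =>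
    (isTestField_calibration h hφ).integrable_mul hG k).integrableOn
    (eqOn_calibration_flux G) h.isOpen.measurableSet

lemma integrableOn_dirichletDensity {E : Type*} [NormedAddCommGroup E] [NormedSpace ℝ E]
    [CompleteSpace E] (hΩ : IsOpen Ω) {w : Vec3 → E} (hw : MemH1 Ω w) :
    IntegrableOn (fun x => ∑ k, ‖weakGrad Ω w k x‖ ^ 2) Ω :=
  integrable_finsetSum _ fun k _ => (hw.memLp_weakGrad hΩ k).integrable_norm_pow two_ne_zero

lemma integral_dirichletDensity_le {E : Type*} [NormedAddCommGroup E] [NormedSpace ℝ E]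
    {w : Vec3 → E} {M : ℝ} (hM : h1Norm Ω w ≤ M) :
    ∫ x in Ω, ∑ k, ‖weakGrad Ω w k x‖ ^ 2 ≤ M ^ 2 := by
  have hnonneg : 0 ≤ ∫ x in Ω, ‖w x‖ ^ 2 := integral_nonneg fun x => sq_nonneg _
  linarith [(Real.sqrt_le_iff.mp hM).2]

lemma integrableOn_bulkEnergyReg (hfin : volume Ω ≠ ⊤)
    (hQ : AEStronglyMeasurable Q (volume.restrict Ω)) {R : ℝ} (hR : ∀ x, ‖Q x‖ ≤ R) :
    IntegrableOn (fun x => bulkEnergyReg a b c ε (Q x)) Ω := by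
  have hcont : Continuous (bulkEnergyReg a b c ε) :=
    (continuous_bulkEnergy a b c).add continuous_const
  obtain ⟨B, hB⟩ := exists_norm_comp_le hR hcont
  exact IntegrableOn.of_bound hfin.lt_top (hcont.comp_aestronglyMeasurable hQ) B
    (Eventually.of_forall hB)

lemma integrableOn_energyDensity (h : IsTubularInterface Ω Ωp δ) (hQ : MemH1 Ω Q) {R : ℝ}
    (hR : ∀ x, ‖Q x‖ ≤ R) :
    IntegrableOn (fun x => ε / 2 * ∑ k, ‖weakGrad Ω Q k x‖ ^ 2 +
      1 / ε * bulkEnergyReg a b c ε (Q x)) Ω :=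
  ((integrableOn_dirichletDensity h.isOpen hQ).const_mul _).add
    ((integrableOn_bulkEnergyReg h.volume_ne_top hQ.1.aestronglyMeasurable hR).const_mul _)

lemma integrableOn_relativeDensity (h : IsTubularInterface Ω Ωp δ) (hφ : IsQuadraticCutoff φ)
    (hQ : MemH1 Ω Q) {R : ℝ} (hR : ∀ x, ‖Q x‖ ≤ R) (hψ : MemH1 Ω (psi a b c η ε Q)) :
    IntegrableOn (relativeDensity a b c Ω Ωp δ φ η ε Q) Ω :=
  (integrableOn_energyDensity h hQ hR).sub
    (integrableOn_calibration_flux h hφ hψ.isWeakGradient_weakGrad)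

lemma integrableOn_sharpRelativeDensity (h : IsTubularInterface Ω Ωp δ)
    (hφ : IsQuadraticCutoff φ) (hQ : MemH1 Ω Q) {R : ℝ} (hR : ∀ x, ‖Q x‖ ≤ R)
    (hd : MemH1 Ω (fun x => quasiDist a b c (Q x))) :
    IntegrableOn (sharpRelativeDensity a b c Ω Ωp δ φ ε Q) Ω :=
  (integrableOn_energyDensity h hQ hR).sub
    (integrableOn_calibration_flux h hφ hd.isWeakGradient_weakGrad)

-- Integrating the calibration flux by parts moves the mollification error off the gradient.
lemma exists_integral_relativeDensity_le (h : IsTubularInterface Ω Ωp δ)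
    (hφ : IsQuadraticCutoff φ) :
    ∃ D, 0 ≤ D ∧ ∀ {a b c ε β R : ℝ} {η : QTensor → ℝ} {Q : Vec3 → QTensor}, MemH1 Ω Q →
      (∀ x, ‖Q x‖ ≤ R) → MemH1 Ω (psi a b c η ε Q) → MemH1 Ω (fun x => quasiDist a b c (Q x)) →
      (∀ x ∈ Ω, |psi a b c η ε Q x - quasiDist a b c (Q x)| ≤ β) →
      ∫ x in Ω, relativeDensity a b c Ω Ωp δ φ η ε Q x ≤
        (∫ x in Ω, sharpRelativeDensity a b c Ω Ωp δ φ ε Q x) + D * β := by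
  obtain ⟨D, hD0, hD⟩ :=
    (isTestField_calibration h hφ).exists_abs_integral_flux_sub_le h.isOpen
  refine ⟨D, hD0, fun {a b c ε β R η Q} hQ hR hψ hd hβ => ?_⟩
  have hflux := hD hψ.isWeakGradient_weakGrad hd.isWeakGradient_weakGrad hβ
  rw [setIntegral_congr_fun h.isOpen.measurableSet (eqOn_calibration_flux _),
    setIntegral_congr_fun h.isOpen.measurableSet (eqOn_calibration_flux _)] at hflux
  have hrel : ∫ x in Ω, relativeDensity a b c Ω Ωp δ φ η ε Q x = _ :=
    integral_sub (integrableOn_energyDensity h hQ hR)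
      (integrableOn_calibration_flux h hφ hψ.isWeakGradient_weakGrad)
  have hsharp : ∫ x in Ω, sharpRelativeDensity a b c Ω Ωp δ φ ε Q x = _ :=
    integral_sub (integrableOn_energyDensity h hQ hR)
      (integrableOn_calibration_flux h hφ hd.isWeakGradient_weakGrad)
  rw [hrel, hsharp]
  linarith [(abs_le.mp hflux).1]

end RelativeDensity

section BulkError

variable {a b c δ ε : ℝ} {Ω Ωp : Set Vec3} {η : QTensor → ℝ} {Q : Vec3 → QTensor}

lemma measurable_truncation : Measurable (truncation δ) :=
  Measurable.ite measurableSet_Ici measurable_const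
    (Measurable.ite measurableSet_Iic measurable_const measurable_neg)

lemma integrableOn_bulkErrorDensity (h : IsTubularInterface Ω Ωp δ)
    (hψ : IntegrableOn (psi a b c η ε Q) Ω) :
    IntegrableOn (bulkErrorDensity a b c Ω Ωp δ η ε Q) Ω := by
  have : IsFiniteMeasure (volume.restrict Ω) := isFiniteMeasure_restrict.mpr h.volume_ne_top
  have hsdist : AEMeasurable (sdist Ω Ωp) (volume.restrict Ω) :=
    ContinuousOn.aemeasurable (fun x hx => (h.continuousAt_sdist hx).continuousWithinAt)
      h.isOpen.measurableSet
  have hphase : Integrable ((outerPhase Ω Ωp).indicator (1 : Vec3 → ℝ)) (volume.restrict Ω) :=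
    (integrable_const 1).indicator h.isOpen_outer.measurableSet
  exact ((hphase.const_mul (surfaceTension a b c)).sub hψ).mul_bdd (c := δ)
    (measurable_truncation.comp_aemeasurable hsdist).aestronglyMeasurable
    (Eventually.of_forall fun x => abs_truncation_le h.δ_pos.le _)

end BulkError

lemma norm_smul_add_smul_sq_of_inner_eq_zero {E : Type*} [NormedAddCommGroup E]
    [InnerProductSpace ℝ E] {v w : E} (h : inner ℝ v w = 0) (s t : ℝ) :
    ‖s • v + t • w‖ ^ 2 = s ^ 2 * ‖v‖ ^ 2 + t ^ 2 * ‖w‖ ^ 2 := by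
  rw [norm_add_sq_real, real_inner_smul_left, real_inner_smul_right, h, norm_smul, norm_smul,
    mul_pow, mul_pow, Real.norm_eq_abs, Real.norm_eq_abs, sq_abs, sq_abs]
  ring

section InitialEnergy

variable {a b c δ ε : ℝ} {Ω Ωp : Set Vec3} {ζ φ : ℝ → ℝ} {u₀ : Vec3 → S2}

lemma weakGrad_initialDatum_ae (h : IsTubularInterface Ω Ωp δ) (hp : 0 ≤ sPlus a b c)
    (hζ : IsInitialCutoff ζ) (hu : MemH1 Ω (fun x => (u₀ x : Vec3))) :
    ∀ᵐ x ∂volume.restrict Ω, ∀ k, weakGrad Ω (initialDatum a b c Ω Ωp δ ζ ε u₀) k x =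
      fderiv ℝ (initialOrder a b c Ω Ωp δ ζ ε) x (EuclideanSpace.single k 1) • director (u₀ x) +
        initialOrder a b c Ω Ωp δ ζ ε x • weakGrad Ω (fun x => director (u₀ x)) k x :=
  ae_all_iff.mpr fun k =>
    (memH1_initialDatum h hp hζ hu).isWeakGradient_weakGrad.ae_eq h.isOpen
      ((memH1_director h.isOpen h.volume_ne_top hu).isWeakGradient_weakGrad.smul h.isOpen
        (contDiffOn_initialOrder h hζ)) k

-- The director has constant norm, so its gradient is orthogonal to it and the squares add up.
lemma sum_norm_weakGrad_initialDatum_sq_ae (h : IsTubularInterface Ω Ωp δ)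
    (hp : 0 ≤ sPlus a b c) (hζ : IsInitialCutoff ζ) (hu : MemH1 Ω (fun x => (u₀ x : Vec3))) :
    ∀ᵐ x ∂volume.restrict Ω, ∑ k, ‖weakGrad Ω (initialDatum a b c Ω Ωp δ ζ ε u₀) k x‖ ^ 2 =
      2 / 3 * deriv (layerProfile a b c δ ζ ε) (sdist Ω Ωp x) ^ 2 +
        initialOrder a b c Ω Ωp δ ζ ε x ^ 2 *
          ∑ k, ‖weakGrad Ω (fun x => director (u₀ x)) k x‖ ^ 2 := by
  have horth := ae_all_iff.mpr ((memH1_director h.isOpen h.volume_ne_top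
    hu).isWeakGradient_weakGrad.inner_ae_eq_zero h.isOpen fun x => norm_director_sq (u₀ x))
  filter_upwards [weakGrad_initialDatum_ae (ε := ε) h hp hζ hu, horth,
    ae_restrict_mem h.isOpen.measurableSet] with x hgrad horth hx
  simp only [hgrad, norm_smul_add_smul_sq_of_inner_eq_zero (horth _), norm_director_sq,
    Finset.sum_add_distrib, ← Finset.sum_mul, ← Finset.mul_sum, sum_fderiv_initialOrder_sq h hζ hx]
  ring

lemma sum_calibration_mul_weakGrad_quasiDist_initialDatum_ae (h : IsTubularInterface Ω Ωp δ)
    (hb : 0 < b) (hc : 0 < c) (habc : b ^ 2 = 27 * a * c) (hζ : IsInitialCutoff ζ) :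
    ∀ᵐ x ∂volume.restrict Ω, ∑ k, calibration Ω Ωp δ φ x k *
        weakGrad Ω (fun x => quasiDist a b c (initialDatum a b c Ω Ωp δ ζ ε u₀ x)) k x =
      φ (sdist Ω Ωp x / δ) * (2 / √3 * uniaxialRoot a b c (initialOrder a b c Ω Ωp δ ζ ε x) *
        deriv (layerProfile a b c δ ζ ε) (sdist Ω Ωp x)) := by
  have hgrad := (isWeakGradient_of_contDiffOn h.isOpen (contDiffOn_initialOrder (a := a) (b := b)
    (c := c) (ε := ε) h hζ)).comp_of_bounded h.isOpen
    (abs_initialOrder_le (sPlus_pos hb hc habc).le hζ)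
    (contDiff_const.sub contDiff_wellPrimitive :
      ContDiff ℝ 1 fun s => wellPrimitive a b c (sPlus a b c) - wellPrimitive a b c s)
  simp only [← quasiDist_initialDatum (u₀ := u₀) hb hc habc hζ] at hgrad
  filter_upwards [ae_all_iff.mpr ((memH1_quasiDist_initialDatum h hb hc habc
    hζ).isWeakGradient_weakGrad.ae_eq h.isOpen hgrad), ae_restrict_mem h.isOpen.measurableSet]
    with x hx hxΩ
  have hderiv := ((hasDerivAt_wellPrimitive (a := a) (b := b) (c := c)
    (initialOrder a b c Ω Ωp δ ζ ε x)).const_sub (wellPrimitive a b c (sPlus a b c))).hasFDerivAt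
  simp only [hx, hderiv.fderiv, ContinuousLinearMap.toSpanSingleton_apply, smul_eq_mul,
    ← mul_assoc, ← Finset.sum_mul, sum_calibration_mul_fderiv_initialOrder h hζ hxΩ]
  ring

lemma sharpRelativeDensity_initialDatum_ae (h : IsTubularInterface Ω Ωp δ) (hb : 0 < b)
    (hc : 0 < c) (habc : b ^ 2 = 27 * a * c) (hζ : IsInitialCutoff ζ) (hε : ε ≠ 0)
    (hu : MemH1 Ω (fun x => (u₀ x : Vec3))) :
    ∀ᵐ x ∂volume.restrict Ω,
      sharpRelativeDensity a b c Ω Ωp δ φ ε (initialDatum a b c Ω Ωp δ ζ ε u₀) x =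
        calibratedDensity a b c ε (φ (sdist Ω Ωp x / δ))
            (layerProfile a b c δ ζ ε (sdist Ω Ωp x))
            (deriv (layerProfile a b c δ ζ ε) (sdist Ω Ωp x)) + ε ^ 2 +
          ε / 2 * (initialOrder a b c Ω Ωp δ ζ ε x ^ 2 *
            ∑ k, ‖weakGrad Ω (fun x => director (u₀ x)) k x‖ ^ 2) := by
  filter_upwards [sum_norm_weakGrad_initialDatum_sq_ae h (sPlus_pos hb hc habc).le hζ hu,
    sum_calibration_mul_weakGrad_quasiDist_initialDatum_ae h hb hc habc hζ,
    ae_restrict_mem h.isOpen.measurableSet] with x hgrad hflux hx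
  rw [sharpRelativeDensity, hgrad, hflux, bulkEnergyReg, initialDatum, bulkEnergy_smul_director,
    uniaxialEnergy_eq_sq hb.le hc habc, initialOrder_eq_layerProfile h hx, calibratedDensity]
  field_simp
  ring

lemma sharpRelativeDensity_initialDatum_ae_le {C : ℝ} (h : IsTubularInterface Ω Ωp δ)
    (hb : 0 < b) (hc : 0 < c) (habc : b ^ 2 = 27 * a * c) (hζ : IsInitialCutoff ζ) (hε : 0 < ε)
    (hε1 : ε ≤ 1) (hC : ∀ r, calibratedDensity a b c ε (φ (r / δ)) (layerProfile a b c δ ζ ε r)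
      (deriv (layerProfile a b c δ ζ ε) r) ≤ C * ε) (hu : MemH1 Ω (fun x => (u₀ x : Vec3))) :
    ∀ᵐ x ∂volume.restrict Ω,
      sharpRelativeDensity a b c Ω Ωp δ φ ε (initialDatum a b c Ω Ωp δ ζ ε u₀) x ≤
        (C + 1) * ε + sPlus a b c ^ 2 / 2 * ε *
          ∑ k, ‖weakGrad Ω (fun x => director (u₀ x)) k x‖ ^ 2 := by
  filter_upwards [sharpRelativeDensity_initialDatum_ae h hb hc habc hζ hε.ne' hu] with x hx
  obtain ⟨hs0, hs1⟩ := initialOrder_mem (Ω := Ω) (Ωp := Ωp) (δ := δ) (ε := ε)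
    (sPlus_pos hb hc habc).le hζ x
  calc _ ≤ C * ε + ε + ε / 2 * (sPlus a b c ^ 2 *
        ∑ k, ‖weakGrad Ω (fun x => director (u₀ x)) k x‖ ^ 2) := by
        rw [hx]
        gcongr
        · exact hC _
        · exact pow_le_of_le_one hε.le hε1 two_ne_zero
    _ = _ := by ring

lemma exists_integral_dirichletDensity_director_le : ∃ B, 0 ≤ B ∧ ∀ {Ω : Set Vec3}, IsOpen Ω →
    volume Ω ≠ ⊤ → ∀ u₀ : Vec3 → S2, MemH1 Ω (fun x => (u₀ x : Vec3)) →
      ∫ x in Ω, ∑ k, ‖weakGrad Ω (fun x => director (u₀ x)) k x‖ ^ 2 ≤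
        B * ∫ x in Ω, ∑ k, ‖weakGrad Ω (fun x => (u₀ x : Vec3)) k x‖ ^ 2 := by
  obtain ⟨B, hB⟩ := exists_norm_weakGrad_director_le
  refine ⟨B ^ 2, sq_nonneg B, fun {Ω} hΩ hfin u₀ hu => ?_⟩
  rw [← integral_const_mul]
  refine integral_mono_ae (integrableOn_dirichletDensity hΩ (memH1_director hΩ hfin hu))
    ((integrableOn_dirichletDensity hΩ hu).const_mul _) ?_
  filter_upwards [ae_all_iff.mpr (hB hΩ hfin u₀ hu)] with x hx
  rw [Finset.mul_sum]
  gcongr with k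
  rw [← mul_pow]
  gcongr
  exact hx k

lemma exists_integral_sharpRelativeDensity_initialDatum_le (h : IsTubularInterface Ω Ωp δ)
    (ha : 0 < a) (hb : 0 < b) (hc : 0 < c) (habc : b ^ 2 = 27 * a * c) (hζ : IsInitialCutoff ζ)
    (hφ : IsQuadraticCutoff φ) (M : ℝ) :
    ∃ C, 0 ≤ C ∧ ∀ u₀ : Vec3 → S2, MemH1 Ω (fun x => (u₀ x : Vec3)) →
      h1Norm Ω (fun x => (u₀ x : Vec3)) ≤ M → ∀ ε, 0 < ε → ε ≤ 1 →
      ∫ x in Ω, sharpRelativeDensity a b c Ω Ωp δ φ ε (initialDatum a b c Ω Ωp δ ζ ε u₀) x ≤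
        C * ε := by
  have : IsFiniteMeasure (volume.restrict Ω) := isFiniteMeasure_restrict.mpr h.volume_ne_top
  have hp := (sPlus_pos hb hc habc).le
  obtain ⟨C, hC0, hC⟩ := exists_calibratedDensity_layerProfile_le ha hb hc habc hζ hφ h.δ_pos
  obtain ⟨B, hB0, hB⟩ := exists_integral_dirichletDensity_director_le
  refine ⟨(C + 1) * volume.real Ω + sPlus a b c ^ 2 / 2 * (B * M ^ 2), by positivity,
    fun u₀ hu hM ε hε hε1 => ?_⟩
  have hD := integrableOn_dirichletDensity h.isOpen (memH1_director h.isOpen h.volume_ne_top hu)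
  calc ∫ x in Ω, sharpRelativeDensity a b c Ω Ωp δ φ ε (initialDatum a b c Ω Ωp δ ζ ε u₀) x
    _ ≤ ∫ x in Ω, ((C + 1) * ε + sPlus a b c ^ 2 / 2 * ε *
        ∑ k, ‖weakGrad Ω (fun x => director (u₀ x)) k x‖ ^ 2) :=
      integral_mono_ae (integrableOn_sharpRelativeDensity h hφ (memH1_initialDatum h hp hζ hu)
        (norm_initialDatum_le hp hζ u₀) (memH1_quasiDist_initialDatum h hb hc habc hζ))
        ((integrable_const _).add (hD.const_mul _))
        (sharpRelativeDensity_initialDatum_ae_le h hb hc habc hζ hε hε1 (hC ε hε hε1) hu)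
    _ = (C + 1) * volume.real Ω * ε + sPlus a b c ^ 2 / 2 * ε *
        ∫ x in Ω, ∑ k, ‖weakGrad Ω (fun x => director (u₀ x)) k x‖ ^ 2 := by
      rw [integral_add (integrable_const _) (hD.const_mul _), integral_const, integral_const_mul,
        measureReal_restrict_apply_univ, smul_eq_mul]
      ring
    _ ≤ (C + 1) * volume.real Ω * ε + sPlus a b c ^ 2 / 2 * ε * (B * M ^ 2) := by
      gcongr
      exact (hB h.isOpen h.volume_ne_top u₀ hu).trans
        (mul_le_mul_of_nonneg_left (integral_dirichletDensity_le hM) hB0)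
    _ = _ := by ring

lemma exists_abs_psi_sub_quasiDist_initialDatum_le (hb : 0 < b) (hc : 0 < c)
    (habc : b ^ 2 = 27 * a * c) (hζ : IsInitialCutoff ζ) :
    ∃ B, 0 ≤ B ∧ ∀ (u₀ : Vec3 → S2) (η : QTensor → ℝ), IsMollifier η → ∀ ε, 0 < ε → ε ≤ 1 → ∀ x,
      |psi a b c η ε (initialDatum a b c Ω Ωp δ ζ ε u₀) x -
        quasiDist a b c (initialDatum a b c Ω Ωp δ ζ ε u₀ x)| ≤ B * ε := by
  obtain ⟨B, hB0, hB⟩ := exists_abs_quasiDistReg_sub_quasiDist_le hb hc habc (sPlus a b c)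
  exact ⟨B, hB0, fun u₀ η hη ε hε hε1 x => hB η hη ε hε hε1 _ (mem_closedBall_zero_iff.mpr
    (norm_initialDatum_le (sPlus_pos hb hc habc).le hζ u₀ x))⟩

lemma exists_integral_relativeDensity_initialDatum_le (h : IsTubularInterface Ω Ωp δ)
    (ha : 0 < a) (hb : 0 < b) (hc : 0 < c) (habc : b ^ 2 = 27 * a * c) (hζ : IsInitialCutoff ζ)
    (hφ : IsQuadraticCutoff φ) (M : ℝ) :
    ∃ C, 0 ≤ C ∧ ∀ u₀ : Vec3 → S2, MemH1 Ω (fun x => (u₀ x : Vec3)) →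
      h1Norm Ω (fun x => (u₀ x : Vec3)) ≤ M → ∀ ε, 0 < ε → ε ≤ 1 → ∀ η, IsMollifier η →
      ∫ x in Ω, relativeDensity a b c Ω Ωp δ φ η ε (initialDatum a b c Ω Ωp δ ζ ε u₀) x ≤
        C * ε := by
  have hp := (sPlus_pos hb hc habc).le
  obtain ⟨C, hC0, hC⟩ :=
    exists_integral_sharpRelativeDensity_initialDatum_le h ha hb hc habc hζ hφ M
  obtain ⟨D, hD0, hD⟩ := exists_integral_relativeDensity_le h hφ
  obtain ⟨B, hB0, hB⟩ :=
    exists_abs_psi_sub_quasiDist_initialDatum_le (Ω := Ω) (Ωp := Ωp) (δ := δ) hb hc habc hζ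
  refine ⟨C + D * B, by positivity, fun u₀ hu hM ε hε hε1 η hη => ?_⟩
  have hmollified := hD (memH1_initialDatum h hp hζ hu) (norm_initialDatum_le hp hζ u₀)
    (memH1_psi_initialDatum h hb hc habc hζ hu hη hε)
    (memH1_quasiDist_initialDatum h hb hc habc hζ) fun x _ => hB u₀ η hη ε hε hε1 x
  linarith [hC u₀ hu hM ε hε hε1]

lemma bulkErrorDensity_initialDatum {η : QTensor → ℝ} {x : Vec3} (h : IsTubularInterface Ω Ωp δ)
    (hb : 0 < b) (hc : 0 < c) (habc : b ^ 2 = 27 * a * c) (hζ : IsInitialCutoff ζ) (hx : x ∈ Ω) :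
    bulkErrorDensity a b c Ω Ωp δ η ε (initialDatum a b c Ω Ωp δ ζ ε u₀) x =
      (wellPrimitive a b c (layerProfile a b c δ ζ ε (sdist Ω Ωp x)) -
          wellPrimitive a b c (sPlus a b c * heaviside (sdist Ω Ωp x))) *
        truncation δ (sdist Ω Ωp x) -
      (psi a b c η ε (initialDatum a b c Ω Ωp δ ζ ε u₀) x -
          quasiDist a b c (initialDatum a b c Ω Ωp δ ζ ε u₀ x)) *
        truncation δ (sdist Ω Ωp x) := by
  have hphase : (outerPhase Ω Ωp).indicator (1 : Vec3 → ℝ) x =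
      (Iio 0).indicator 1 (sdist Ω Ωp x) :=
    indicator_const_eq_indicator_const (h.mem_outer_iff hx)
  rw [← surfaceTension_mul_indicator_sub_mul_truncation hb hc habc h.δ_pos.le, bulkErrorDensity,
    hphase, quasiDist_initialDatum hb hc habc hζ, initialOrder_eq_layerProfile h hx,
    surfaceTension_eq hb hc habc]
  ring

lemma exists_bulkError_initialDatum_le (h : IsTubularInterface Ω Ωp δ) (ha : 0 < a) (hb : 0 < b)
    (hc : 0 < c) (habc : b ^ 2 = 27 * a * c) (hζ : IsInitialCutoff ζ) :
    ∃ C, 0 ≤ C ∧ ∀ (u₀ : Vec3 → S2) (η : QTensor → ℝ), IsMollifier η → ∀ ε, 0 < ε → ε ≤ 1 →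
      bulkError a b c Ω Ωp δ η ε (initialDatum a b c Ω Ωp δ ζ ε u₀) ≤ C * ε := by
  obtain ⟨C, hC0, hC⟩ :=
    exists_wellPrimitive_layerProfile_sub_mul_truncation_le ha hb hc habc hζ h.δ_pos
  obtain ⟨B, hB0, hB⟩ :=
    exists_abs_psi_sub_quasiDist_initialDatum_le (Ω := Ω) (Ωp := Ωp) (δ := δ) hb hc habc hζ
  refine ⟨(C + B * δ) * volume.real Ω,
    mul_nonneg (add_nonneg hC0 (mul_nonneg hB0 h.δ_pos.le)) measureReal_nonneg,
    fun u₀ η hη ε hε hε1 => ?_⟩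
  have hpoint : ∀ x ∈ Ω, ‖bulkErrorDensity a b c Ω Ωp δ η ε
      (initialDatum a b c Ω Ωp δ ζ ε u₀) x‖ ≤ (C + B * δ) * ε := fun x hx => by
    rw [bulkErrorDensity_initialDatum h hb hc habc hζ hx, add_mul, mul_right_comm]
    refine (norm_sub_le _ _).trans (add_le_add (hC ε hε _) ?_)
    rw [norm_mul]
    exact mul_le_mul (hB u₀ η hη ε hε hε1 x) (abs_truncation_le h.δ_pos.le _) (norm_nonneg _)
      (mul_nonneg hB0 hε.le)
  calc _ ≤ ‖∫ x in Ω, bulkErrorDensity a b c Ω Ωp δ η ε (initialDatum a b c Ω Ωp δ ζ ε u₀) x‖ :=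
        Real.le_norm_self _
    _ ≤ (C + B * δ) * ε * volume.real Ω :=
        norm_setIntegral_le_of_norm_le_const h.volume_ne_top.lt_top hpoint
    _ = _ := by ring

end InitialEnergy

end BerisEdwards

theorem proposition2p9_general
    (a b c : ℝ) (ha : 0 < a) (hb : 0 < b) (hc : 0 < c) (habc : b ^ 2 = 27 * a * c)
    (Ω Ωp : Set Vec3) (δ : ℝ) (hΩ : IsTubularInterface Ω Ωp δ)
    (φ ζ : ℝ → ℝ) (hφ : IsQuadraticCutoff φ) (hζ : IsInitialCutoff ζ) (M : ℝ) :
    ∃ C₀ : ℝ, 0 < C₀ ∧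
      ∀ u₀ : Vec3 → S2, MemH1 Ω (fun x => (u₀ x : Vec3)) →
        h1Norm Ω (fun x => (u₀ x : Vec3)) ≤ M →
      ∀ ε : ℝ, 0 < ε → ε ≤ 1 →
        MemH1 Ω (initialDatum a b c Ω Ωp δ ζ ε u₀) ∧
        MemLp (initialDatum a b c Ω Ωp δ ζ ε u₀) ⊤ (volume.restrict Ω) ∧
        (∀ x ∈ Ωp \ tube Ω Ωp δ,
          initialDatum a b c Ω Ωp δ ζ ε u₀ x = sPlus a b c • director (u₀ x)) ∧
        (∀ x ∈ tube Ω Ωp (δ / 2),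
          initialDatum a b c Ω Ωp δ ζ ε u₀ x =
            profile a b c (sdist Ω Ωp x / ε) • director (u₀ x)) ∧
        (∀ x ∈ outerPhase Ω Ωp \ tube Ω Ωp δ, initialDatum a b c Ω Ωp δ ζ ε u₀ x = 0) ∧
        ∀ η : QTensor → ℝ, IsMollifier η →
          MemH1 Ω (psi a b c η ε (initialDatum a b c Ω Ωp δ ζ ε u₀)) ∧
          IntegrableOn
            (relativeDensity a b c Ω Ωp δ φ η ε (initialDatum a b c Ω Ωp δ ζ ε u₀)) Ω ∧
          IntegrableOn
            (bulkErrorDensity a b c Ω Ωp δ η ε (initialDatum a b c Ω Ωp δ ζ ε u₀)) Ω ∧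
          ∀ v₀ε v₀ : Vec3 → Vec3, MemLp v₀ε 2 (volume.restrict Ω) →
            MemLp v₀ 2 (volume.restrict Ω) →
            ∀ K : ℝ, ∫ x in Ω, 1 / 2 * ‖v₀ε x - v₀ x‖ ^ 2 ≤ K * ε →
              relativeEnergy a b c Ω Ωp δ φ η ε v₀ε v₀ (initialDatum a b c Ω Ωp δ ζ ε u₀)
                + bulkError a b c Ω Ωp δ η ε (initialDatum a b c Ω Ωp δ ζ ε u₀)
              ≤ (C₀ + K) * ε := by
  have hp := (sPlus_pos hb hc habc).le
  obtain ⟨C, hC0, hC⟩ := exists_integral_relativeDensity_initialDatum_le hΩ ha hb hc habc hζ hφ M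
  obtain ⟨V, hV0, hV⟩ := exists_bulkError_initialDatum_le hΩ ha hb hc habc hζ
  refine ⟨C + V + 1, by positivity, fun u₀ hu hM ε hε hε1 => ?_⟩
  have hQ := memH1_initialDatum (ε := ε) hΩ hp hζ hu
  refine ⟨hQ, memLp_top_initialDatum hΩ hp hζ hu, fun _ => initialDatum_of_mem_plus hΩ hζ,
    fun _ => initialDatum_of_mem_tube hΩ hζ, fun _ => initialDatum_of_mem_outer hΩ hζ,
    fun η hη => ?_⟩
  have : IsFiniteMeasure (volume.restrict Ω) := isFiniteMeasure_restrict.mpr hΩ.volume_ne_top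
  have hψ := memH1_psi_initialDatum hΩ hb hc habc hζ hu hη hε
  refine ⟨hψ, integrableOn_relativeDensity hΩ hφ hQ (norm_initialDatum_le hp hζ u₀) hψ,
    integrableOn_bulkErrorDensity hΩ (hψ.1.integrable one_le_two), fun v₀ε v₀ _ _ K hK => ?_⟩
  rw [relativeEnergy]
  linarith [hC u₀ hu hM ε hε hε1 η hη, hV u₀ η hη ε hε hε1]

theorem proposition2p9
    (a b c : ℝ) (ha : 0 < a) (hb : 0 < b) (hc : 0 < c) (habc : b ^ 2 = 27 * a * c)
    (Ω Ωp : Set Vec3) (δ : ℝ) (hΩ : IsInterface Ω Ωp δ)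
    (φ ζ : ℝ → ℝ) (hφ : IsCalibrationCutoff φ) (hζ : IsInitialCutoff ζ) (M : ℝ) :
    ∃ C₀ : ℝ, 0 < C₀ ∧
      ∀ u₀ : Vec3 → S2, MemH1 Ω (fun x => (u₀ x : Vec3)) →
        h1Norm Ω (fun x => (u₀ x : Vec3)) ≤ M →
      ∀ ε : ℝ, 0 < ε → ε ≤ 1 →
        MemH1 Ω (initialDatum a b c Ω Ωp δ ζ ε u₀) ∧
        MemLp (initialDatum a b c Ω Ωp δ ζ ε u₀) ⊤ (volume.restrict Ω) ∧
        (∀ x ∈ Ωp \ tube Ω Ωp δ,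
          initialDatum a b c Ω Ωp δ ζ ε u₀ x = sPlus a b c • director (u₀ x)) ∧
        (∀ x ∈ tube Ω Ωp (δ / 2),
          initialDatum a b c Ω Ωp δ ζ ε u₀ x =
            profile a b c (sdist Ω Ωp x / ε) • director (u₀ x)) ∧
        (∀ x ∈ outerPhase Ω Ωp \ tube Ω Ωp δ, initialDatum a b c Ω Ωp δ ζ ε u₀ x = 0) ∧
        ∀ η : QTensor → ℝ, IsIsotropicMollifier η →
          MemH1 Ω (psi a b c η ε (initialDatum a b c Ω Ωp δ ζ ε u₀)) ∧
          IntegrableOn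
            (relativeDensity a b c Ω Ωp δ φ η ε (initialDatum a b c Ω Ωp δ ζ ε u₀)) Ω ∧
          IntegrableOn
            (bulkErrorDensity a b c Ω Ωp δ η ε (initialDatum a b c Ω Ωp δ ζ ε u₀)) Ω ∧
          ∀ v₀ε v₀ : Vec3 → Vec3, MemLp v₀ε 2 (volume.restrict Ω) →
            MemLp v₀ 2 (volume.restrict Ω) →
            ∀ K : ℝ, ∫ x in Ω, 1 / 2 * ‖v₀ε x - v₀ x‖ ^ 2 ≤ K * ε →
              relativeEnergy a b c Ω Ωp δ φ η ε v₀ε v₀ (initialDatum a b c Ω Ωp δ ζ ε u₀)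
                + bulkError a b c Ω Ωp δ η ε (initialDatum a b c Ω Ωp δ ζ ε u₀)
              ≤ (C₀ + K) * ε := by
  obtain ⟨C₀, hC₀, hbound⟩ := proposition2p9_general a b c ha hb hc habc Ω Ωp δ
    hΩ.isTubularInterface φ ζ hφ.isQuadraticCutoff hζ M
  refine ⟨C₀, hC₀, fun u₀ hu hM ε hε hε1 => ?_⟩
  obtain ⟨hQ, hbdd, hplus, htube, houter, henergy⟩ := hbound u₀ hu hM ε hε hε1
  exact ⟨hQ, hbdd, hplus, htube, houter, fun η hη => henergy η hη.isMollifier⟩
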